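/- Let $M$ be a smooth manifold of dimension $d\ge 2$ and let $(E,\pi,\langle\cdot,\cdot\rangle,[\cdot,\cdot])$ be an exact Courant algebroid over $M$, with anchor $\pi:E\to TM$, (neutral) scalar product $\langle\cdot,\cdot\rangle$ and Dorfman bracket $[\cdot,\cdot]$ satisfying $\pi(w)\langle u,v\rangle=\langle[u,v]+[v,u],w\rangle$. Let $\mathcal G=\langle\mathcal G^{\mathrm{end}}\cdot,\cdot\rangle$ be a semi-Riemannian generalised metric on $E$, i.e. $\mathcal G^{\mathrm{end}}$ is a smooth $\langle\cdot,\cdot\rangle$-symmetric involution of $E$ and $\mathcal G$ is nondegenerate on $T^*M=\ker\pi$; let $E_\pm=\ker(\mathcal G^{\mathrm{end}}\mp 1)$, and write $u_\pm$ for the component of $u$ in $E_\pm$. Let $g$ be the semi-Riemannian metric on $M$ for which $\pi:(E_+,\mathcal G)\to(TM,g)$ is isometric (equivalently $\pi:(E_-,\mathcal G)\to(TM,g)$ is), $\nabla$ its Levi-Civita connection, $\mathrm{div}_g(X)=\mathrm{tr}(\nabla X)$, $\sigma:TM\to E$ the splitting of $\pi$ with image the $\mathcal G$-orthogonal complement of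 $T^*M$, and $H(X,Y,Z)=2\langle[\sigma X,\sigma Y],\sigma Z\rangle$. For $u\in\Gamma(E)$ put $\mathrm{div}_g(u)=\mathrm{div}^{\mathcal G}(u)=\mathrm{div}_g(\pi u)$ and $|u|^2_{\mathcal G}=\mathcal G(u,u)$. Let $\mathrm{div}=\mathrm{div}^{\mathcal G}-\langle e,\cdot\rangle$, $e\in\Gamma(E)$, be a divergence operator on $E$, and let $D=D^{\mathcal G,\mathrm{div}}=D^0+S$ be the canonical generalised Levi-Civita connection. Here $D^0$ is the canonical generalised Levi-Civita connection with metric divergence: $D^0$ preserves $E_\pm$, $D^0_{\bar a}b=[\bar a,b]_\pm$ for $\bar a\in\Gamma(E_\mp)$, $b\in\Gamma(E_\pm)$, and $\pi D^0_ab=\nabla_{\pi a}\pi b\pm\tfrac16\,g^{-1}H(\pi a,\pi b,\cdot)$ for $a,b\in\Gamma(E_\pm)$. Further, $S_ab=\frac1{d-1}\big(\langle a,b\rangle e_\pm-\langle e_\pm,b\rangle a\big)$ for $a,b\in E_\pm$, and $S_ab=0$ for $a\in E_\mp$, $b\in E_\pm$. Let $$2\,\mathcal Rm^D(a,b,v,w)=\langle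 D_vD_wb-D_wD_vb-D_{[v,w]}b,\,a\rangle+\langle D_bD_av-D_aD_bv-D_{[b,a]}v,\,w\rangle+\mathrm{tr}_E\big(\langle Dv,w\rangle\langle Db,a\rangle\big)$$ be the generalised Riemann tensor, and let $\overline{\mathcal Rc}^D(a,b)=\mathrm{tr}_E\,\mathcal Rm^D(\cdot,a,\cdot,b)$ be the full generalised Ricci tensor, where $\mathrm{tr}_E$ is the trace taken with $\langle\cdot,\cdot\rangle$. Then $$\mathrm{tr}_E\,\overline{\mathcal Rc}^D=2\,\mathrm{div}_g(e)-\big(|e_+|^2_{\mathcal G}-|e_-|^2_{\mathcal G}\big).$$ -/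

import Mathlib

open scoped Manifold ContDiff
open Bundle

noncomputable section

namespace GeneralisedGeometry

/-! ## Smooth sections and vectors extended to smooth sections -/

/-- A section `s` of a vector bundle `V` (with model fibre `F`) is smooth. -/
def IsSmoothSection (d : ℕ) {M : Type*} [TopologicalSpace M]
    [ChartedSpace (EuclideanSpace ℝ (Fin d)) M]
    (F : Type*) [NormedAddCommGroup F] [NormedSpace ℝ F] {V : M → Type*}
    [TopologicalSpace (TotalSpace F V)] [∀ x, TopologicalSpace (V x)] [FiberBundle F V]
    (s : Π x, V x) : Prop :=
  ContMDiff (𝓡 d) ((𝓡 d).prod 𝓘(ℝ, F)) ∞ (fun x => TotalSpace.mk' F x (s x))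

/-- A smooth real function on `M`. -/
def IsSmoothFunction (d : ℕ) {M : Type*} [TopologicalSpace M]
    [ChartedSpace (EuclideanSpace ℝ (Fin d)) M] (f : M → ℝ) : Prop :=
  ContMDiff (𝓡 d) 𝓘(ℝ, ℝ) ∞ f

/-- A smooth vector field on `M`. -/
abbrev IsSmoothVectorField {d : ℕ} {M : Type*} [TopologicalSpace M]
    [ChartedSpace (EuclideanSpace ℝ (Fin d)) M] [IsManifold (𝓡 d) ∞ M]
    (X : Π x : M, TangentSpace (𝓡 d) x) : Prop :=
  IsSmoothSection d (EuclideanSpace ℝ (Fin d)) X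

/-- Every vector in a fibre is the value of a global smooth section. -/
theorem exists_smoothSection_eq {d : ℕ} {M : Type*} [TopologicalSpace M] [T2Space M]
    [ChartedSpace (EuclideanSpace ℝ (Fin d)) M] [IsManifold (𝓡 d) ∞ M]
    (F : Type*) [NormedAddCommGroup F] [NormedSpace ℝ F] {V : M → Type*}
    [TopologicalSpace (TotalSpace F V)] [∀ x, TopologicalSpace (V x)]
    [∀ x, AddCommGroup (V x)] [∀ x, Module ℝ (V x)] [FiberBundle F V] [VectorBundle ℝ F V]
    [ContMDiffVectorBundle ∞ F V (𝓡 d)] (x : M) (v : V x) :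
    ∃ s : Π y, V y, IsSmoothSection d F s ∧ s x = v := by
  obtain ⟨u, hu, hs⟩ := FiberBundle.exists_contMDiffOn_extend (k := ∞) (𝓡 d) F v
  obtain ⟨f, -, hf⟩ := (SmoothBumpFunction.nhds_basis_tsupport (I := 𝓡 d) x).mem_iff.1
    (interior_mem_nhds.2 hu)
  refine ⟨(f : M → ℝ) • FiberBundle.extend F v, ?_, ?_⟩
  · exact ContMDiffOn.smul_section_of_tsupport f.contMDiff.contMDiffOn isOpen_interior hf
      (hs.mono interior_subset)
  · simp [f.eq_one]

/-- A global smooth section through a given vector `v ∈ V x`. It is used only as an argument of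
expressions which are tensorial in it, i.e. which depend only on its value `v` at `x`. -/
def smoothExtension (d : ℕ) {M : Type*} [TopologicalSpace M] [T2Space M]
    [ChartedSpace (EuclideanSpace ℝ (Fin d)) M] [IsManifold (𝓡 d) ∞ M]
    (F : Type*) [NormedAddCommGroup F] [NormedSpace ℝ F] {V : M → Type*}
    [TopologicalSpace (TotalSpace F V)] [∀ x, TopologicalSpace (V x)]
    [∀ x, AddCommGroup (V x)] [∀ x, Module ℝ (V x)] [FiberBundle F V] [VectorBundle ℝ F V]
    [ContMDiffVectorBundle ∞ F V (𝓡 d)] (x : M) (v : V x) : Π y, V y :=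
  (exists_smoothSection_eq (d := d) F x v).choose

/-! ## Exact Courant algebroids -/

/-- An exact Courant algebroid on the bundle `E → M`. The Dorfman bracket is an operation on
smooth sections (its values on other sections play no role). -/
structure ExactCourantAlgebroid (d : ℕ) {M : Type*} [TopologicalSpace M]
    [ChartedSpace (EuclideanSpace ℝ (Fin d)) M] [IsManifold (𝓡 d) ∞ M]
    (F : Type*) [NormedAddCommGroup F] [NormedSpace ℝ F] (E : M → Type*)
    [TopologicalSpace (TotalSpace F E)] [∀ x, TopologicalSpace (E x)]
    [∀ x, AddCommGroup (E x)] [∀ x, Module ℝ (E x)] [FiberBundle F E] where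
  /-- the anchor `π : E → TM` -/
  anchor : Π x : M, E x →ₗ[ℝ] TangentSpace (𝓡 d) x
  /-- the scalar product `⟨·,·⟩` -/
  pairing : Π x : M, LinearMap.BilinForm ℝ (E x)
  /-- the Dorfman bracket -/
  bracket : (Π x, E x) → (Π x, E x) → (Π x, E x)
  smooth_anchor : ∀ u : Π x, E x, IsSmoothSection d F u →
    IsSmoothVectorField (fun x => anchor x (u x))
  smooth_pairing : ∀ u v : Π x, E x, IsSmoothSection d F u → IsSmoothSection d F v →
    IsSmoothFunction d (fun x => pairing x (u x) (v x))
  smooth_bracket : ∀ u v : Π x, E x, IsSmoothSection d F u → IsSmoothSection d F v →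
    IsSmoothSection d F (bracket u v)
  pairing_symm : ∀ x (u v : E x), pairing x u v = pairing x v u
  pairing_nondegenerate : ∀ x, (pairing x).Nondegenerate
  bracket_add_left : ∀ u v w : Π x, E x, IsSmoothSection d F u → IsSmoothSection d F v →
    IsSmoothSection d F w → bracket (u + v) w = bracket u w + bracket v w
  bracket_add_right : ∀ u v w : Π x, E x, IsSmoothSection d F u → IsSmoothSection d F v →
    IsSmoothSection d F w → bracket u (v + w) = bracket u v + bracket u w
  /-- `[u, f v] = f [u, v] + (π(u) f) v` -/
  bracket_leibniz : ∀ (u v : Π x, E x) (f : M → ℝ), IsSmoothSection d F u → IsSmoothSection d F v →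
    IsSmoothFunction d f → ∀ x, bracket u (fun y => f y • v y) x =
      f x • bracket u v x + mvfderiv (𝓡 d) f x (anchor x (u x)) • v x
  /-- `[u, [v, w]] = [[u, v], w] + [v, [u, w]]` -/
  bracket_jacobi : ∀ u v w : Π x, E x, IsSmoothSection d F u → IsSmoothSection d F v →
    IsSmoothSection d F w →
    bracket u (bracket v w) = bracket (bracket u v) w + bracket v (bracket u w)
  /-- `π [u, v] = [π u, π v]` -/
  anchor_bracket : ∀ u v : Π x, E x, IsSmoothSection d F u → IsSmoothSection d F v →
    ∀ x, anchor x (bracket u v x) =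
      VectorField.mlieBracket (𝓡 d) (fun y => anchor y (u y)) (fun y => anchor y (v y)) x
  /-- `π(u) ⟨v, w⟩ = ⟨[u, v], w⟩ + ⟨v, [u, w]⟩` -/
  pairing_invariant : ∀ u v w : Π x, E x, IsSmoothSection d F u → IsSmoothSection d F v →
    IsSmoothSection d F w → ∀ x,
    mvfderiv (𝓡 d) (fun y => pairing y (v y) (w y)) x (anchor x (u x)) =
      pairing x (bracket u v x) (w x) + pairing x (v x) (bracket u w x)
  /-- `π(w) ⟨u, v⟩ = ⟨[u, v] + [v, u], w⟩` -/
  bracket_symmetric_part : ∀ u v w : Π x, E x, IsSmoothSection d F u → IsSmoothSection d F v →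
    IsSmoothSection d F w → ∀ x,
    mvfderiv (𝓡 d) (fun y => pairing y (u y) (v y)) x (anchor x (w x)) =
      pairing x (bracket u v x + bracket v u x) (w x)
  /-- exactness of `0 → T*M → E → TM → 0` at `TM` (equivalently, by duality, at `T*M`) -/
  anchor_surjective : ∀ x, Function.Surjective (anchor x)
  /-- exactness of `0 → T*M → E → TM → 0` at `E`; a covector `ξ` is viewed as the element `u` of
  `E` with `⟨u, ·⟩ = ξ ∘ π` (up to a constant factor) -/
  anchor_eq_zero_iff : ∀ x (u : E x), anchor x u = 0 ↔
    ∃ ξ : TangentSpace (𝓡 d) x →ₗ[ℝ] ℝ, ∀ w : E x, pairing x u w = ξ (anchor x w)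

/-- A semi-Riemannian generalised metric `𝒢` on an exact Courant algebroid, encoded by the
endomorphism `𝒢ᵉⁿᵈ`, where `𝒢(u, v) = ⟨𝒢ᵉⁿᵈ u, v⟩`: a smooth symmetric involution, such that
`𝒢` is nondegenerate on `T*M = ker π`. -/
structure GeneralisedMetric {d : ℕ} {M : Type*} [TopologicalSpace M]
    [ChartedSpace (EuclideanSpace ℝ (Fin d)) M] [IsManifold (𝓡 d) ∞ M]
    {F : Type*} [NormedAddCommGroup F] [NormedSpace ℝ F] {E : M → Type*}
    [TopologicalSpace (TotalSpace F E)] [∀ x, TopologicalSpace (E x)]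
    [∀ x, AddCommGroup (E x)] [∀ x, Module ℝ (E x)] [FiberBundle F E]
    (A : ExactCourantAlgebroid d F E) where
  /-- the endomorphism `𝒢ᵉⁿᵈ` -/
  endo : Π x : M, E x →ₗ[ℝ] E x
  smooth_endo : ∀ u : Π x, E x, IsSmoothSection d F u → IsSmoothSection d F (fun x => endo x (u x))
  endo_endo : ∀ x (u : E x), endo x (endo x u) = u
  endo_symm : ∀ x (u v : E x), A.pairing x (endo x u) v = A.pairing x u (endo x v)
  nondegenerate_ker : ∀ x (u : E x), A.anchor x u = 0 →
    (∀ v : E x, A.anchor x v = 0 → A.pairing x (endo x u) v = 0) → u = 0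

/-- A divergence operator on a Courant algebroid: a linear map `div : Γ(E) → C^∞(M)` with
`div (f u) = f div u + π(u) f`. -/
structure DivergenceOperator {d : ℕ} {M : Type*} [TopologicalSpace M]
    [ChartedSpace (EuclideanSpace ℝ (Fin d)) M] [IsManifold (𝓡 d) ∞ M]
    {F : Type*} [NormedAddCommGroup F] [NormedSpace ℝ F] {E : M → Type*}
    [TopologicalSpace (TotalSpace F E)] [∀ x, TopologicalSpace (E x)]
    [∀ x, AddCommGroup (E x)] [∀ x, Module ℝ (E x)] [FiberBundle F E]
    (A : ExactCourantAlgebroid d F E) where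
  /-- the underlying operation on sections -/
  toFun : (Π x, E x) → M → ℝ
  smooth : ∀ u : Π x, E x, IsSmoothSection d F u → IsSmoothFunction d (toFun u)
  add : ∀ u v : Π x, E x, IsSmoothSection d F u → IsSmoothSection d F v →
    toFun (u + v) = toFun u + toFun v
  leibniz : ∀ (f : M → ℝ) (u : Π x, E x), IsSmoothFunction d f → IsSmoothSection d F u →
    ∀ x, toFun (fun y => f y • u y) x =
      f x * toFun u x + mvfderiv (𝓡 d) f x (A.anchor x (u x))

section Construction

variable {d : ℕ} {M : Type*} [TopologicalSpace M]
  [ChartedSpace (EuclideanSpace ℝ (Fin d)) M] [IsManifold (𝓡 d) ∞ M]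
  {F : Type*} [NormedAddCommGroup F] [NormedSpace ℝ F] [FiniteDimensional ℝ F] {E : M → Type*}
  [TopologicalSpace (TotalSpace F E)] [∀ x, TopologicalSpace (E x)]
  [∀ x, AddCommGroup (E x)] [∀ x, Module ℝ (E x)] [FiberBundle F E] [VectorBundle ℝ F E]
  {A : ExactCourantAlgebroid d F E}

/-- A basis of the fibre `E x`. -/
def fibreBasis (A : ExactCourantAlgebroid d F E) (x : M) :
    Module.Basis (Fin (Module.finrank ℝ (E x))) ℝ (E x) :=
  haveI := VectorBundle.finiteDimensional ℝ F E x
  Module.finBasis ℝ (E x)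

/-- A basis of the tangent space. -/
def tangentBasis (x : M) : Module.Basis (Fin d) ℝ (TangentSpace (𝓡 d) x) :=
  (EuclideanSpace.basisFun (Fin d) ℝ).toBasis

/-- The trace `tr_E T = ∑ᵢ T(eᵢ, eⁱ)` at `x`, taken with the scalar product `⟨·,·⟩`, of an
operation `T` on pairs of sections which is `C^∞`-bilinear; `(eᵢ)` and `(eⁱ)` are dual bases of
`E x` with respect to `⟨·,·⟩`. -/
def trE [T2Space M] [ContMDiffVectorBundle ∞ F E (𝓡 d)] (A : ExactCourantAlgebroid d F E)
    (T : (Π x, E x) → (Π x, E x) → M → ℝ) (x : M) : ℝ :=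
  ∑ i, T (smoothExtension d F x (fibreBasis A x i))
    (smoothExtension d F x
      ((A.pairing x).dualBasis (A.pairing_nondegenerate x) (fibreBasis A x) i)) x

namespace GeneralisedMetric

variable (G : GeneralisedMetric A)

/-- The symmetric bilinear form `𝒢(u, v) = ⟨𝒢ᵉⁿᵈ u, v⟩`. -/
def form (x : M) : LinearMap.BilinForm ℝ (E x) :=
  (A.pairing x).comp (G.endo x) LinearMap.id

/-- The component `u₊` of a section in `E₊ = ker (𝒢ᵉⁿᵈ - 1)`. -/
def plus (u : Π x, E x) : Π x, E x := fun x => (1 / 2 : ℝ) • (u x + G.endo x (u x))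

/-- The component `u₋` of a section in `E₋ = ker (𝒢ᵉⁿᵈ + 1)`. -/
def minus (u : Π x, E x) : Π x, E x := fun x => (1 / 2 : ℝ) • (u x - G.endo x (u x))

/-- The `𝒢`-orthogonal complement of `T*M = ker π`. -/
def horizontal (x : M) : Submodule ℝ (E x) where
  carrier := {u | ∀ z : E x, A.anchor x z = 0 → G.form x u z = 0}
  zero_mem' := by intro z _; simp
  add_mem' := by intro u v hu hv z hz; simp [hu z hz, hv z hz]
  smul_mem' := by intro c u hu z hz; simp [hu z hz]

theorem form_symm (x : M) (u v : E x) : G.form x u v = G.form x v u := by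
  simp only [form, LinearMap.BilinForm.comp_apply, LinearMap.id_apply]
  rw [G.endo_symm, A.pairing_symm]

theorem anchor_horizontal_bijective (x : M) :
    Function.Bijective ((A.anchor x).domRestrict (G.horizontal x)) := by
  haveI := VectorBundle.finiteDimensional ℝ F E x
  constructor
  · rw [injective_iff_map_eq_zero]
    rintro ⟨u, hu⟩ h0
    have h0' : A.anchor x u = 0 := h0
    exact Subtype.ext (G.nondegenerate_ker x u h0' fun v hv => hu v hv)
  · intro v
    obtain ⟨w, rfl⟩ := A.anchor_surjective x v
    have hsymm : (G.form x).IsRefl := fun u v h => by rw [G.form_symm]; exact h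
    have hnd : ((G.form x).restrict (LinearMap.ker (A.anchor x))).Nondegenerate := by
      constructor
      · rintro ⟨u, hu⟩ h
        exact Subtype.ext (G.nondegenerate_ker x u hu fun v hv => h ⟨v, hv⟩)
      · rintro ⟨u, hu⟩ h
        refine Subtype.ext (G.nondegenerate_ker x u hu fun v hv => ?_)
        have := h ⟨v, hv⟩
        change G.form x v u = 0 at this
        rw [G.form_symm] at this
        exact this
    have hc := LinearMap.BilinForm.isCompl_orthogonal_of_restrict_nondegenerate hsymm hnd
    obtain ⟨z, hz, h, hh, rfl⟩ := Submodule.mem_sup.1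
      (hc.sup_eq_top ▸ Submodule.mem_top : w ∈ LinearMap.ker (A.anchor x) ⊔ _)
    refine ⟨⟨h, fun z' hz' => ?_⟩, ?_⟩
    · rw [G.form_symm]
      exact hh z' hz'
    · have : A.anchor x z = 0 := hz
      simp [this]

/-- The splitting `σ : TM → E` of the anchor defined by `𝒢`: the vector `σ v` is the element of
the `𝒢`-orthogonal complement of `T*M` over `v`. -/
def splitting (x : M) : TangentSpace (𝓡 d) x →ₗ[ℝ] E x :=
  (G.horizontal x).subtype ∘ₗ
    (LinearEquiv.ofBijective _ (G.anchor_horizontal_bijective x)).symm.toLinearMap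

/-- The inverse `σ + 𝒢ᵉⁿᵈ σ : TM → E₊` of `π|E₊`. -/
def liftPlus (x : M) : TangentSpace (𝓡 d) x →ₗ[ℝ] E x :=
  G.splitting x + G.endo x ∘ₗ G.splitting x

/-- The inverse `σ - 𝒢ᵉⁿᵈ σ : TM → E₋` of `π|E₋`. -/
def liftMinus (x : M) : TangentSpace (𝓡 d) x →ₗ[ℝ] E x :=
  G.splitting x - G.endo x ∘ₗ G.splitting x

/-- The semi-Riemannian metric `g` on `M`, for which `π : (E₊, 𝒢) → (TM, g)` is isometric. -/
def metric (x : M) : LinearMap.BilinForm ℝ (TangentSpace (𝓡 d) x) :=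
  (G.form x).comp (G.liftPlus x) (G.liftPlus x)

theorem anchor_splitting (x : M) (v : TangentSpace (𝓡 d) x) :
    A.anchor x (G.splitting x v) = v :=
  (LinearEquiv.ofBijective _ (G.anchor_horizontal_bijective x)).apply_symm_apply v

theorem anchor_endo_splitting (x : M) (v : TangentSpace (𝓡 d) x) :
    A.anchor x (G.endo x (G.splitting x v)) = 0 := by
  obtain ⟨r, hr⟩ := (A.anchor x).exists_rightInverse_of_surjective
    (LinearMap.range_eq_top.2 (A.anchor_surjective x))
  rw [A.anchor_eq_zero_iff]
  refine ⟨(A.pairing x (G.endo x (G.splitting x v))) ∘ₗ r, fun w => ?_⟩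
  have hmem : G.splitting x v ∈ G.horizontal x := Subtype.coe_prop _
  have h := hmem (w - r (A.anchor x w)) (by
    rw [map_sub, sub_eq_zero]
    exact (LinearMap.congr_fun hr (A.anchor x w)).symm)
  change A.pairing x (G.endo x (G.splitting x v)) (w - r (A.anchor x w)) = 0 at h
  rw [map_sub, sub_eq_zero] at h
  exact h

theorem anchor_liftPlus (x : M) (v : TangentSpace (𝓡 d) x) :
    A.anchor x (G.liftPlus x v) = v := by
  simp [liftPlus, G.anchor_splitting, G.anchor_endo_splitting]

theorem anchor_liftMinus (x : M) (v : TangentSpace (𝓡 d) x) :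
    A.anchor x (G.liftMinus x v) = v := by
  simp [liftMinus, G.anchor_splitting, G.anchor_endo_splitting]

theorem endo_liftPlus (x : M) (v : TangentSpace (𝓡 d) x) :
    G.endo x (G.liftPlus x v) = G.liftPlus x v := by
  simp [liftPlus, G.endo_endo, add_comm]

theorem endo_liftMinus (x : M) (v : TangentSpace (𝓡 d) x) :
    G.endo x (G.liftMinus x v) = -G.liftMinus x v := by
  simp [liftMinus, G.endo_endo]

theorem metric_symm (x : M) (v w : TangentSpace (𝓡 d) x) :
    G.metric x v w = G.metric x w v := G.form_symm x _ _

theorem liftPlus_anchor (x : M) (u : E x) (hu : G.endo x u = u) :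
    G.liftPlus x (A.anchor x u) = u := by
  rw [← sub_eq_zero]
  set z := G.liftPlus x (A.anchor x u) - u with hz
  have hz0 : A.anchor x z = 0 := by rw [hz, map_sub, G.anchor_liftPlus, sub_self]
  have hzG : G.endo x z = z := by rw [hz, map_sub, G.endo_liftPlus, hu]
  refine G.nondegenerate_ker x z hz0 fun v hv => ?_
  obtain ⟨ξ, hξ⟩ := (A.anchor_eq_zero_iff x z).1 hz0
  rw [hzG, hξ, hv, map_zero]

theorem metric_nondegenerate (x : M) : (G.metric x).Nondegenerate := by
  have key : ∀ v, (∀ w, G.metric x v w = 0) → v = 0 := by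
    intro v hv
    have h0 : G.liftPlus x v = 0 := by
      refine (A.pairing_nondegenerate x).1 _ fun u => ?_
      have h1 := hv (A.anchor x (u + G.endo x u))
      change A.pairing x (G.endo x (G.liftPlus x v)) (G.liftPlus x _) = 0 at h1
      rw [G.liftPlus_anchor x _ (by rw [map_add, G.endo_endo, add_comm]), map_add,
        ← G.endo_symm, G.endo_endo, G.endo_liftPlus] at h1
      linarith
    rw [← G.anchor_liftPlus x v, h0, map_zero]
  exact ⟨key, fun v hv => key v fun w => by rw [G.metric_symm]; exact hv w⟩

/-- The vector `g⁻¹ φ` metrically dual to a covector `φ` at `x`. -/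
def sharp (x : M) (φ : TangentSpace (𝓡 d) x → ℝ) : TangentSpace (𝓡 d) x :=
  ∑ i, φ (tangentBasis x i) •
    (G.metric x).dualBasis (G.metric_nondegenerate x) (tangentBasis x) i

/-- The right-hand side of the Koszul formula for `2 g(∇_X Y, Z)`. -/
def koszul (X Y Z : Π x : M, TangentSpace (𝓡 d) x) (x : M) : ℝ :=
  mvfderiv (𝓡 d) (fun y => G.metric y (Y y) (Z y)) x (X x)
    + mvfderiv (𝓡 d) (fun y => G.metric y (X y) (Z y)) x (Y x)
    - mvfderiv (𝓡 d) (fun y => G.metric y (X y) (Y y)) x (Z x)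
    + G.metric x (VectorField.mlieBracket (𝓡 d) X Y x) (Z x)
    - G.metric x (VectorField.mlieBracket (𝓡 d) X Z x) (Y x)
    - G.metric x (VectorField.mlieBracket (𝓡 d) Y Z x) (X x)

/-- The three-form `H(X, Y, Z) = 2 ⟨[σ X, σ Y], σ Z⟩` of the splitting `σ`, as a covector
`H(X, Y, ·)` at `x`. -/
def threeForm (X Y : Π x : M, TangentSpace (𝓡 d) x) (x : M) (z : TangentSpace (𝓡 d) x) : ℝ :=
  2 * A.pairing x
    (A.bracket (fun y => G.splitting y (X y)) (fun y => G.splitting y (Y y)) x)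
    (G.splitting x z)

variable [T2Space M]

/-- The Levi-Civita connection `∇_X Y` of `g`. -/
def leviCivita (X Y : Π x : M, TangentSpace (𝓡 d) x) : Π x : M, TangentSpace (𝓡 d) x :=
  fun x => G.sharp x fun z => (1 / 2 : ℝ) *
    G.koszul X Y (smoothExtension d (EuclideanSpace ℝ (Fin d)) x z) x

/-- The divergence `div_g X = tr (v ↦ ∇_v X)` of a vector field. -/
def divMetric (X : Π x : M, TangentSpace (𝓡 d) x) (x : M) : ℝ :=
  ∑ i, (tangentBasis x).coord i
    (G.leviCivita (smoothExtension d (EuclideanSpace ℝ (Fin d)) x (tangentBasis x i)) X x)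

/-- The metric divergence operator `div^𝒢 u = div_g (π u)`; it is also the meaning of `div_g u`
for a section `u` of `E`. -/
def div (u : Π x, E x) (x : M) : ℝ := G.divMetric (fun y => A.anchor y (u y)) x

/-- The canonical generalised Levi-Civita connection `D⁰` with metric divergence: its mixed-type
part is `D⁰_{a₋} b₊ = [a₋, b₊]₊`, `D⁰_{a₊} b₋ = [a₊, b₋]₋`, and its pure-type part is
`π (D⁰_a b) = ∇_{π a} π b ± (1/6) g⁻¹ H(π a, π b, ·)` for `a, b ∈ Γ(E₊)`, resp. `Γ(E₋)`. -/
def connectionZero (a b : Π x, E x) : Π x, E x := fun x =>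
  G.plus (A.bracket (G.minus a) (G.plus b)) x
    + G.minus (A.bracket (G.plus a) (G.minus b)) x
    + G.liftPlus x
        (G.leviCivita (fun y => A.anchor y (G.plus a y)) (fun y => A.anchor y (G.plus b y)) x
          + (1 / 6 : ℝ) • G.sharp x (G.threeForm (fun y => A.anchor y (G.plus a y))
              (fun y => A.anchor y (G.plus b y)) x))
    + G.liftMinus x
        (G.leviCivita (fun y => A.anchor y (G.minus a y)) (fun y => A.anchor y (G.minus b y)) x
          - (1 / 6 : ℝ) • G.sharp x (G.threeForm (fun y => A.anchor y (G.minus a y))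
              (fun y => A.anchor y (G.minus b y)) x))

/-- The section `e` determined by a divergence operator through `div = div^𝒢 - ⟨e, ·⟩`. -/
def divergenceSection [ContMDiffVectorBundle ∞ F E (𝓡 d)] (δ : DivergenceOperator A) :
    Π x, E x := fun x =>
  ∑ i, (G.div (smoothExtension d F x (fibreBasis A x i)) x
      - δ.toFun (smoothExtension d F x (fibreBasis A x i)) x) •
    (A.pairing x).dualBasis (A.pairing_nondegenerate x) (fibreBasis A x) i

/-- The tensor `χ^e(a, b) = ⟨a, b⟩ e - ⟨e, b⟩ a`. -/
def chi (A : ExactCourantAlgebroid d F E) (e a b : Π x, E x) : Π x, E x := fun x =>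
  A.pairing x (a x) (b x) • e x - A.pairing x (e x) (b x) • a x

/-- The tensor `S = (χ₊^{e₊} + χ₋^{e₋}) / (d - 1)`, where `χ±^{e±}` is `χ^{e±}` on `E±` and zero on
`E∓`. It is the element of the first generalised prolongation of `so(E)_𝒢` orthogonal to the kernel
of the trace and with trace `(tr S)(b) = tr (a ↦ S_a b) = -⟨e, b⟩`. -/
def divergenceTensor (e a b : Π x, E x) : Π x, E x := fun x =>
  (1 / ((d : ℝ) - 1)) •
    (chi A (G.plus e) (G.plus a) (G.plus b) x + chi A (G.minus e) (G.minus a) (G.minus b) x)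

/-- The canonical generalised Levi-Civita connection `D^{𝒢,div} = D⁰ + S`. -/
def canonicalConnection [ContMDiffVectorBundle ∞ F E (𝓡 d)] (δ : DivergenceOperator A)
    (a b : Π x, E x) : Π x, E x := fun x =>
  G.connectionZero a b x + G.divergenceTensor (G.divergenceSection δ) a b x

end GeneralisedMetric

variable [T2Space M] [ContMDiffVectorBundle ∞ F E (𝓡 d)]

/-- The generalised Riemann tensor `Rm^D(a, b, v, w)` of a generalised connection `D`, given by
`2 Rm^D(a, b, v, w) = ⟨D_v D_w b - D_w D_v b - D_{[v,w]} b, a⟩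
  + ⟨D_b D_a v - D_a D_b v - D_{[b,a]} v, w⟩ + tr_E (⟨D v, w⟩ ⟨D b, a⟩)`. -/
def generalisedRiemann (A : ExactCourantAlgebroid d F E)
    (D : (Π x, E x) → (Π x, E x) → (Π x, E x)) (a b v w : Π x, E x) (x : M) : ℝ :=
  (1 / 2 : ℝ) *
    (A.pairing x (D v (D w b) x - D w (D v b) x - D (A.bracket v w) b x) (a x)
      + A.pairing x (D b (D a v) x - D a (D b v) x - D (A.bracket b a) v x) (w x)
      + trE A (fun c c' y => A.pairing y (D c v y) (w y) * A.pairing y (D c' b y) (a y)) x)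

/-- The full generalised Ricci tensor `Rc^D(a, b) = tr_E Rm^D(·, a, ·, b)`. -/
def fullGeneralisedRicci (A : ExactCourantAlgebroid d F E)
    (D : (Π x, E x) → (Π x, E x) → (Π x, E x)) (a b : Π x, E x) (x : M) : ℝ :=
  trE A (fun c c' => generalisedRiemann A D c a c' b) x

end Construction

end GeneralisedGeometry

end

/-! Write `J` for the reflection of `E` that fixes `σ(TM)` and is `-1` on `ker π`. It exchanges `E₊`
and `E₋`, keeps the anchor and reverses the sign of the scalar product, so everything on `E₋` can be
transported to `E₊`. The bracket then defines two metric connections on `E₊`: `bis`, from `⟨[J a,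
b], c⟩`, and `bis'`, from `-⟨[a, J b], J c⟩`. Under `π` they are `∇ + H/2` and `∇ - H/2`. Hence `∇`
is their mean, `H` is their difference `tor`, and `∇ + H/6` is `2/3 bis + 1/3 bis'`. This turns `D`
into an expression in the bracket, the projections and `J` (`conn`), and the computation becomes
algebra over the ring of smooth functions.

The generalised Riemann tensor is tensorial in each argument: the trace term in its definition
absorbs the failure of the Dorfman bracket to be a derivation in its first argument. So the double
trace can be computed in any dual families (`scalar_indep`). The families used are `f i`, `J (f i)`,
where the `f i` in `E₊` are orthogonal at `x` and parallel at `x` for `∇`. In such a frame the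
coefficients of `D` at `x` involve only `H` and `e`.

Mixed terms vanish because `D` preserves `E₊` and `E₋` (`riemann_mixed`). The trace over `E₊`
(`sum_riemann`) is a scalar depending on `g` and `H` alone, plus a divergence term and minus the
square of `e₊`. Exchanging `E₊` and `E₋` gives the trace over `E₋`, in which the metric scalar has
the opposite sign (`metricScalar_flip`) since the scalar product has changed sign. These scalars
cancel. The first-order terms add up to `2 div_g e` (`div_eq`), and the squares give the two norms;
the relative sign in the result appears because `𝒢 = -⟨·,·⟩` on `E₋`. -/

noncomputable section

namespace GeneralisedGeometry

/-! ## Courant modules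

The algebraic structure carried by the smooth sections of a Courant algebroid: `R` stands for the
ring of smooth functions on `M`, and `Γ` for the module of smooth sections. -/

/-- A module `Γ` over a ring `R` of functions on `M` with a scalar product `P`, an anchor `ρ` and a
Dorfman bracket `br`. -/
structure CourantModule (M R Γ : Type*) [CommRing R] [Algebra ℝ R] [AddCommGroup Γ]
    [Module R Γ] where
  /-- evaluation of functions at points -/
  ev : M → R →ₐ[ℝ] ℝ
  ext_ev : ∀ f g, (∀ y, ev y f = ev y g) → f = g
  /-- the scalar product -/
  P : Γ →ₗ[R] Γ →ₗ[R] R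
  P_symm : ∀ u v, P u v = P v u
  P_nondeg : ∀ u, (∀ w, P u w = 0) → u = 0
  /-- operations which are tensorial at `x` only depend on the value at `x` -/
  tensor_zero : ∀ (x : M) (T : Γ → ℝ), (∀ u v, T (u + v) = T u + T v) →
    (∀ f u, T (f • u) = ev x f * T u) → ∀ u, (∀ w, ev x (P u w) = 0) → T u = 0
  /-- the anchor -/
  ρ : Γ →ₗ[R] Derivation ℝ R R
  /-- the Dorfman bracket -/
  br : Γ → Γ → Γ
  br_add_left : ∀ u v w, br (u + v) w = br u w + br v w
  br_add_right : ∀ u v w, br u (v + w) = br u v + br u w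
  br_smul : ∀ u f v, br u (f • v) = f • br u v + ρ u f • v
  ρ_br : ∀ u v f, ρ (br u v) f = ρ u (ρ v f) - ρ v (ρ u f)
  P_inv : ∀ u v w, ρ u (P v w) = P (br u v) w + P v (br u w)
  P_br_symm : ∀ u v w, ρ w (P u v) = P (br u v + br v u) w

namespace CourantModule

variable {M R Γ : Type*} [CommRing R] [Algebra ℝ R] [AddCommGroup Γ] [Module R Γ]
  (C : CourantModule M R Γ)

theorem ext_P {u v : Γ} (h : ∀ w, C.P u w = C.P v w) : u = v := by
  rw [← sub_eq_zero]
  exact C.P_nondeg _ fun w => by rw [map_sub, LinearMap.sub_apply, h, sub_self]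

/-- The Leibniz rule in the first slot follows from the one in the second by the formula for the
symmetric part. The last term, with the gradient of `f`, is the source of all non-tensoriality
below. -/
theorem P_br_smul_left (f : R) (u v w : Γ) :
    C.P (C.br (f • u) v) w = f * C.P (C.br u v) w - C.ρ v f * C.P u w + C.P u v * C.ρ w f := by
  have h1 := C.P_br_symm (f • u) v w
  have h2 := C.P_br_symm u v w
  rw [C.br_smul] at h1
  simp only [map_smul, LinearMap.smul_apply, smul_eq_mul, map_add, LinearMap.add_apply,
    Derivation.leibniz] at h1 h2
  linear_combination -h1 + f * h2

/-- Sections with vanishing scalar product have antisymmetric bracket. -/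
theorem P_br_swap {u v : Γ} (h : C.P u v = 0) (w : Γ) :
    C.P (C.br u v) w = -C.P (C.br v u) w := by
  have h1 := C.P_br_symm u v w
  rw [h, map_zero, map_add, LinearMap.add_apply] at h1
  linear_combination -h1

/-! ### Tensorial operations and traces -/

/-- An operation on `Γ` which is linear over functions, at the point `x`. -/
structure IsTensor (x : M) (T : Γ → ℝ) : Prop where
  add : ∀ u v, T (u + v) = T u + T v
  smul : ∀ f u, T (f • u) = C.ev x f * T u

/-- Two families of sections whose values at `x` are dual to each other. -/
def IsDualFamily (x : M) {ι : Type*} [Fintype ι] (k k' : ι → Γ) : Prop :=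
  ∀ u w, ∑ i, C.ev x (C.P (k' i) u) * C.ev x (C.P (k i) w) = C.ev x (C.P u w)

variable {C} {x : M}

theorem IsDualFamily.symm {ι : Type*} [Fintype ι] {k k' : ι → Γ} (h : C.IsDualFamily x k k') :
    C.IsDualFamily x k' k := fun u w => by
  rw [C.P_symm, ← h w u]
  exact Finset.sum_congr rfl fun _ _ => mul_comm _ _

namespace IsTensor

theorem zero {T : Γ → ℝ} (h : C.IsTensor x T) : T 0 = 0 := by
  simpa using h.smul 0 0

theorem neg {T : Γ → ℝ} (h : C.IsTensor x T) (u : Γ) : T (-u) = -T u := by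
  simpa using h.smul (-1) u

theorem sub {T : Γ → ℝ} (h : C.IsTensor x T) (u v : Γ) : T (u - v) = T u - T v := by
  rw [sub_eq_add_neg, h.add, h.neg, sub_eq_add_neg]

theorem sum {T : Γ → ℝ} (h : C.IsTensor x T) {ι : Type*} (s : Finset ι) (k : ι → Γ) :
    T (∑ i ∈ s, k i) = ∑ i ∈ s, T (k i) := by
  classical
  induction s using Finset.induction_on with
  | empty => simpa using h.zero
  | insert a s ha ih => rw [Finset.sum_insert ha, Finset.sum_insert ha, h.add, ih]

theorem eq_of_ev {T : Γ → ℝ} (h : C.IsTensor x T) {u v : Γ}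
    (huv : ∀ w, C.ev x (C.P u w) = C.ev x (C.P v w)) : T u = T v := by
  rw [← sub_eq_zero, ← h.sub]
  exact C.tensor_zero x T h.add h.smul _ fun w => by simp [huv]

/-- The section `u` and its expansion in `k` with constant coefficients have the same scalar
products at `x`, and a tensor at `x` sees nothing else. -/
theorem expand {ι : Type*} [Fintype ι] {k k' : ι → Γ} (hk : C.IsDualFamily x k k')
    {T : Γ → ℝ} (h : C.IsTensor x T) (u : Γ) :
    T u = ∑ i, C.ev x (C.P (k' i) u) * T (k i) := by
  have : T u = T (∑ i, algebraMap ℝ R (C.ev x (C.P (k' i) u)) • k i) := by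
    refine h.eq_of_ev fun w => ?_
    simp [← hk u w]
  rw [this, h.sum]
  simp [h.smul]

theorem finset_sum {ι : Type*} {s : Finset ι} {T : ι → Γ → ℝ} (h : ∀ i ∈ s, C.IsTensor x (T i)) :
    C.IsTensor x fun u => ∑ i ∈ s, T i u :=
  ⟨fun u v => by
    rw [← Finset.sum_add_distrib]; exact Finset.sum_congr rfl fun i hi => (h i hi).add u v,
   fun f u => by
    rw [Finset.mul_sum]; exact Finset.sum_congr rfl fun i hi => (h i hi).smul f u⟩

theorem const_mul {T : Γ → ℝ} (h : C.IsTensor x T) (c : ℝ) : C.IsTensor x fun u => c * T u :=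
  ⟨fun u v => by rw [h.add]; ring, fun f u => by rw [h.smul]; ring⟩

end IsTensor

theorem trace_indep {ι κ : Type*} [Fintype ι] [Fintype κ] {k k' : ι → Γ} {l l' : κ → Γ}
    (hk : C.IsDualFamily x k k') (hl : C.IsDualFamily x l l') {T : Γ → Γ → ℝ}
    (h1 : ∀ v, C.IsTensor x fun u => T u v) (h2 : ∀ u, C.IsTensor x (T u)) :
    ∑ i, T (k i) (k' i) = ∑ j, T (l j) (l' j) := by
  calc ∑ i, T (k i) (k' i) = ∑ i, ∑ j, C.ev x (C.P (l' j) (k i)) * T (l j) (k' i) :=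
        Finset.sum_congr rfl fun i _ => (h1 (k' i)).expand hl (k i)
    _ = ∑ j, ∑ i, C.ev x (C.P (k i) (l' j)) * T (l j) (k' i) := by
        rw [Finset.sum_comm]
        exact Finset.sum_congr rfl fun j _ => Finset.sum_congr rfl fun i _ => by rw [C.P_symm]
    _ = ∑ j, T (l j) (l' j) :=
        Finset.sum_congr rfl fun j _ => ((h2 (l j)).expand hk.symm (l' j)).symm

variable (C)

/-! ### Connections and their generalised Riemann tensor -/

/-- The axioms of a connection on a Courant module. -/
structure IsConnection (D : Γ → Γ → Γ) : Prop where
  add_left : ∀ a b c, D (a + b) c = D a c + D b c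
  smul_left : ∀ (f : R) a b, D (f • a) b = f • D a b
  add_right : ∀ a b c, D a (b + c) = D a b + D a c
  smul_right : ∀ a (f : R) b, D a (f • b) = f • D a b + C.ρ a f • b

/-- The generalised Riemann tensor at `x`, with the trace taken by means of the families `k`,
`k'`. -/
def riemann (D : Γ → Γ → Γ) (x : M) {ι : Type*} [Fintype ι] (k k' : ι → Γ) (a b v w : Γ) : ℝ :=
  (1 / 2 : ℝ) *
    (C.ev x (C.P (D v (D w b) - D w (D v b) - D (C.br v w) b) a)
      + C.ev x (C.P (D b (D a v) - D a (D b v) - D (C.br b a) v) w)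
      + ∑ i, C.ev x (C.P (D (k i) v) w) * C.ev x (C.P (D (k' i) b) a))

variable {C} {D : Γ → Γ → Γ} {ι : Type*} [Fintype ι] {k k' : ι → Γ}

theorem IsConnection.isTensor_left (hD : C.IsConnection D) (b a : Γ) :
    C.IsTensor x fun u => C.ev x (C.P (D u b) a) :=
  ⟨fun u v => by simp [hD.add_left], fun f u => by simp [hD.smul_left]⟩

/-- Reduces tensoriality in the last two slots to tensoriality in the first two. -/
theorem riemann_swap (a b v w : Γ) :
    C.riemann D x k k' a b v w = C.riemann D x k' k w v b a := by
  simp only [riemann]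
  rw [add_comm (C.ev x _) (C.ev x _)]
  simp only [mul_comm]

theorem riemann_isTensor_fst (hD : C.IsConnection D) (b v w : Γ) :
    C.IsTensor x fun a => C.riemann D x k k' a b v w := by
  constructor
  · intro a a'
    simp only [riemann, hD.add_left, hD.add_right, C.br_add_right, map_add, map_sub,
      LinearMap.add_apply, LinearMap.sub_apply, mul_add, Finset.sum_add_distrib]
    ring
  · intro f a
    simp only [riemann, hD.add_left, hD.add_right, hD.smul_left, hD.smul_right, C.br_smul, map_add,
      map_sub, LinearMap.add_apply, LinearMap.sub_apply, map_smul, LinearMap.smul_apply,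
      smul_eq_mul, map_mul, mul_left_comm _ (C.ev x f), ← Finset.mul_sum]
    ring

/-- The gradient term of `[f b, a]` contributes `-⟨b, a⟩ ∑ (ρ(k'ᵢ) f) ⟨D_{kᵢ} v, w⟩`, and the
Leibniz rule for `D_{k'ᵢ} (f b)` in the trace term contributes the same with the opposite sign. -/
theorem riemann_isTensor_snd (hD : C.IsConnection D) (hk : C.IsDualFamily x k k') (a v w : Γ) :
    C.IsTensor x fun b => C.riemann D x k k' a b v w := by
  constructor
  · intro b b'
    simp only [riemann, hD.add_left, hD.add_right, C.br_add_left, map_add, map_sub,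
      LinearMap.add_apply, LinearMap.sub_apply, mul_add, Finset.sum_add_distrib]
    ring
  · intro f b
    have key : C.ev x (C.P (D (C.br (f • b) a) v) w) =
        C.ev x f * C.ev x (C.P (D (C.br b a) v) w) - C.ev x (C.ρ a f) * C.ev x (C.P (D b v) w)
          + C.ev x (C.P b a) * ∑ i, C.ev x (C.ρ (k' i) f) * C.ev x (C.P (D (k i) v) w) := by
      have hT := hD.isTensor_left (x := x) v w
      rw [hT.expand hk, hT.expand hk (C.br b a), hT.expand hk b]
      simp only [Finset.mul_sum, ← Finset.sum_sub_distrib, ← Finset.sum_add_distrib]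
      refine Finset.sum_congr rfl fun i _ => ?_
      rw [C.P_symm, C.P_br_smul_left, C.P_symm (k' i), C.P_symm (k' i)]
      simp only [map_add, map_sub, map_mul]
      ring
    simp only [riemann, hD.add_left, hD.add_right, hD.smul_left, hD.smul_right, C.ρ_br, map_add,
      map_sub, LinearMap.add_apply, LinearMap.sub_apply, map_smul, LinearMap.smul_apply,
      smul_eq_mul, map_mul, key, mul_add, Finset.sum_add_distrib, sub_smul,
      mul_left_comm _ (C.ev x f)]
    simp only [← Finset.mul_sum]
    have : ∑ i, C.ev x (C.P (D (k i) v) w) * (C.ev x (C.ρ (k' i) f) * C.ev x (C.P b a)) =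
        C.ev x (C.P b a) * ∑ i, C.ev x (C.ρ (k' i) f) * C.ev x (C.P (D (k i) v) w) := by
      rw [Finset.mul_sum]
      exact Finset.sum_congr rfl fun i _ => by ring
    rw [this]
    ring

theorem riemann_isTensor_trd (hD : C.IsConnection D) (hk : C.IsDualFamily x k k') (a b w : Γ) :
    C.IsTensor x fun v => C.riemann D x k k' a b v w := by
  simp only [fun v => riemann_swap (C := C) (D := D) (x := x) (k := k) (k' := k') a b v w]
  exact riemann_isTensor_snd hD hk.symm _ _ _

theorem riemann_isTensor_fth (hD : C.IsConnection D) (a b v : Γ) :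
    C.IsTensor x fun w => C.riemann D x k k' a b v w := by
  simp only [fun w => riemann_swap (C := C) (D := D) (x := x) (k := k) (k' := k') a b v w]
  exact riemann_isTensor_fst hD _ _ _

theorem riemann_indep {κ : Type*} [Fintype κ] {l l' : κ → Γ} (hD : C.IsConnection D)
    (hk : C.IsDualFamily x k k') (hl : C.IsDualFamily x l l') (a b v w : Γ) :
    C.riemann D x k k' a b v w = C.riemann D x l l' a b v w := by
  have := trace_indep hk hl (T := fun u u' => C.ev x (C.P (D u v) w) * C.ev x (C.P (D u' b) a))
    (fun u' => by simpa only [mul_comm] using (hD.isTensor_left v w).const_mul _)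
    (fun u => (hD.isTensor_left b a).const_mul _)
  simp only [riemann, this]

/-- The double trace of the generalised Riemann tensor does not depend on the dual families. -/
theorem scalar_indep {κ : Type*} [Fintype κ] {l l' : κ → Γ} (hD : C.IsConnection D)
    (hk : C.IsDualFamily x k k') (hl : C.IsDualFamily x l l') :
    ∑ i, ∑ j, C.riemann D x k k' (k j) (k i) (k' j) (k' i) =
      ∑ i, ∑ j, C.riemann D x l l' (l j) (l i) (l' j) (l' i) := by
  have h1 : ∀ b w, ∑ j, C.riemann D x k k' (k j) b (k' j) w =
      ∑ j, C.riemann D x l l' (l j) b (l' j) w := fun b w => by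
    rw [trace_indep hk hl (T := fun a v => C.riemann D x k k' a b v w)
      (fun v => riemann_isTensor_fst hD b v w) (fun a => riemann_isTensor_trd hD hk a b w)]
    exact Finset.sum_congr rfl fun j _ => riemann_indep hD hk hl _ _ _ _
  simp only [h1]
  exact trace_indep hk hl (T := fun b w => ∑ j, C.riemann D x l l' (l j) b (l' j) w)
    (fun w => IsTensor.finset_sum fun j _ => riemann_isTensor_snd hD hl _ _ _)
    (fun b => IsTensor.finset_sum fun j _ => riemann_isTensor_fth hD _ _ _)

end CourantModule

/-! ### Generalised metrics on a Courant module. -/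

open CourantModule

/-- A generalised metric on a Courant module: the involution `G`, together with the reflection `J`
along the anti-diagonal, which exchanges the eigenspaces of `G` and fixes the splitting. -/
structure CourantMetric {M R Γ : Type*} [CommRing R] [Algebra ℝ R] [AddCommGroup Γ] [Module R Γ]
    (C : CourantModule M R Γ) where
  /-- the involution -/
  G : Γ →ₗ[R] Γ
  /-- the reflection -/
  J : Γ →ₗ[R] Γ
  G_G : ∀ u, G (G u) = u
  P_G : ∀ u v, C.P (G u) v = C.P u (G v)
  J_J : ∀ u, J (J u) = u
  G_J : ∀ u, G (J u) = -J (G u)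
  P_J : ∀ u v, C.P (J u) (J v) = -C.P u v
  ρ_J : ∀ u, C.ρ (J u) = C.ρ u
  br_ker : ∀ u v, C.br (u - J u) (v - J v) = 0

namespace CourantModule

variable {M R Γ : Type*} [CommRing R] [Algebra ℝ R] [AddCommGroup Γ] [Module R Γ]
  (C : CourantModule M R Γ)

theorem br_sub_left (u v w : Γ) : C.br (u - v) w = C.br u w - C.br v w := by
  rw [eq_sub_iff_add_eq, ← C.br_add_left, sub_add_cancel]

theorem br_sub_right (u v w : Γ) : C.br u (v - w) = C.br u v - C.br u w := by
  rw [eq_sub_iff_add_eq, ← C.br_add_right, sub_add_cancel]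

end CourantModule

namespace CourantMetric

variable {M R Γ : Type*} [CommRing R] [Algebra ℝ R] [AddCommGroup Γ] [Module R Γ]
  {C : CourantModule M R Γ} (K : CourantMetric C)

/-- The generalised metric with the roles of the eigenspaces exchanged. -/
def flip : CourantMetric C where
  G := -K.G
  J := K.J
  G_G u := by simp [K.G_G]
  P_G u v := by simp [K.P_G]
  J_J := K.J_J
  G_J u := by simp [K.G_J]
  P_J := K.P_J
  ρ_J := K.ρ_J
  br_ker := K.br_ker

@[simp] theorem flip_G (u : Γ) : K.flip.G u = -K.G u := rfl

@[simp] theorem flip_J : K.flip.J = K.J := rfl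

@[simp] theorem flip_flip : K.flip.flip = K := by
  simp [flip]

/-- The projection onto the `1`-eigenspace of `G`. -/
def p : Γ →ₗ[R] Γ := algebraMap ℝ R (1 / 2) • (LinearMap.id + K.G)

theorem p_apply (u : Γ) : K.p u = algebraMap ℝ R (1 / 2) • (u + K.G u) := rfl

theorem half_smul_add (u : Γ) : algebraMap ℝ R (1 / 2) • (u + u) = u := by
  rw [← two_smul R u, smul_smul]
  have : algebraMap ℝ R (1 / 2) * 2 = 1 := by
    rw [← map_ofNat (algebraMap ℝ R) 2, ← map_mul]
    norm_num
  rw [this, one_smul]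

theorem G_p (u : Γ) : K.G (K.p u) = K.p u := by
  rw [p_apply, map_smul, map_add, K.G_G, add_comm]

theorem p_eq_self {u : Γ} (hu : K.G u = u) : K.p u = u := by
  rw [p_apply, hu, half_smul_add]

theorem flip_p_eq_zero {u : Γ} (hu : K.G u = u) : K.flip.p u = 0 := by
  rw [p_apply, flip_G, hu, add_neg_cancel, smul_zero]

theorem p_eq_zero {u : Γ} (hu : K.G u = -u) : K.p u = 0 := by
  rw [p_apply, hu, add_neg_cancel, smul_zero]

theorem p_add_flip_p (u : Γ) : K.p u + K.flip.p u = u := by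
  rw [p_apply, p_apply, flip_G, ← smul_add]
  convert half_smul_add (R := R) u using 2
  abel

theorem P_p (u v : Γ) : C.P (K.p u) v = C.P u (K.p v) := by
  simp only [p_apply, map_smul, map_add, LinearMap.smul_apply, LinearMap.add_apply, K.P_G]

theorem P_J_left (u v : Γ) : C.P (K.J u) v = -C.P u (K.J v) := by
  rw [← K.P_J, K.J_J]

theorem J_p (u : Γ) : K.J (K.p u) = K.flip.p (K.J u) := by
  simp [p_apply, K.G_J]

theorem G_J_of {u : Γ} (hu : K.G u = u) : K.G (K.J u) = -K.J u := by
  rw [K.G_J, hu]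

theorem flip_G_J {u : Γ} (hu : K.G u = u) : K.flip.G (K.J u) = K.J u := by
  rw [flip_G, K.G_J, hu, neg_neg]

theorem P_eq_zero {u v : Γ} (hu : K.G u = u) (hv : K.G v = -v) : C.P u v = 0 := by
  have h : C.P u v = -C.P u v := by
    conv_lhs => rw [← hu, K.P_G, hv, map_neg]
  refine C.ext_ev _ _ fun y => ?_
  have h2 := congrArg (C.ev y) h
  rw [map_neg] at h2
  rw [map_zero]
  linarith

theorem P_eq_zero' {u v : Γ} (hu : K.G u = -u) (hv : K.G v = v) : C.P u v = 0 := by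
  rw [C.P_symm, K.P_eq_zero hv hu]

theorem P_eq_add (u v : Γ) :
    C.P u v = C.P (K.p u) (K.p v) + C.P (K.flip.p u) (K.flip.p v) := by
  conv_lhs => rw [← K.p_add_flip_p u]
  rw [map_add, LinearMap.add_apply, K.P_p, K.flip.P_p, ← K.p_eq_self (K.G_p v), ← K.P_p,
    ← K.flip.p_eq_self (K.flip.G_p v), ← K.flip.P_p]
  simp only [K.p_eq_self (K.G_p _), K.flip.p_eq_self (K.flip.G_p _)]

/-! ### The metric connections defined by the bracket -/

/-- The coefficients `⟨[J a, b], c⟩` of the metric connection with torsion on the `1`-eigenspace of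
`G`. -/
def bis (a b c : Γ) : R := C.P (C.br (K.J a) b) c

/-- The coefficients of the metric connection with torsion on the `-1`-eigenspace, transported to
the `1`-eigenspace. -/
def bis' (a b c : Γ) : R := -C.P (C.br a (K.J b)) (K.J c)

/-- The three-form: the difference of the two metric connections with torsion. -/
def tor (a b c : Γ) : R := K.bis a b c - K.bis' a b c

theorem flip_bis (a b c : Γ) : K.flip.bis (K.J a) (K.J b) (K.J c) = -K.bis' a b c := by
  simp [bis, bis', K.J_J]

theorem flip_bis' (a b c : Γ) : K.flip.bis' (K.J a) (K.J b) (K.J c) = -K.bis a b c := by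
  simp [bis, bis', K.J_J]

theorem flip_tor (a b c : Γ) : K.flip.tor (K.J a) (K.J b) (K.J c) = K.tor a b c := by
  rw [tor, flip_bis, flip_bis', tor]
  ring

variable {a b c : Γ}

theorem bis_metric (a b c : Γ) : C.ρ a (C.P b c) = K.bis a b c + K.bis a c b := by
  rw [bis, bis, ← K.ρ_J, C.P_inv, C.P_symm b]

theorem bis'_metric (a b c : Γ) : C.ρ a (C.P b c) = K.bis' a b c + K.bis' a c b := by
  have := C.P_inv a (K.J b) (K.J c)
  rw [K.P_J, map_neg, C.P_symm (K.J b)] at this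
  rw [bis', bis']
  linear_combination -this

/-- Expand `[a - J a, b - J b] = 0`, the vanishing of the bracket on `ker π`. The three terms other
than `⟨[a, b], c⟩` become connection coefficients, by invariance and by antisymmetry of the bracket
of orthogonal sections. -/
theorem P_br (ha : K.G a = a) (hb : K.G b = b) (hc : K.G c = c) :
    C.P (C.br a b) c = K.bis a b c - K.bis b a c + K.bis' c a b := by
  have h0 : C.P (C.br (a - K.J a) (b - K.J b)) c = 0 := by rw [K.br_ker]; simp
  simp only [C.br_sub_left, C.br_sub_right, map_sub, LinearMap.sub_apply] at h0
  have h1 := C.P_br_swap (K.P_eq_zero ha (K.G_J_of hb)) c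
  have h2 := C.P_inv (K.J a) (K.J b) c
  rw [K.P_eq_zero' (K.G_J_of hb) hc, map_zero, C.P_symm (K.J b),
    C.P_br_swap (K.P_eq_zero' (K.G_J_of ha) hc)] at h2
  simp only [bis, bis']
  linear_combination h0 + h1 + h2

/-- Invariance applied to the zero function `⟨b, J c⟩`. -/
theorem P_br_J (ha : K.G a = a) (hb : K.G b = b) (hc : K.G c = c) :
    C.P (C.br a b) (K.J c) = K.bis c a b := by
  have h := C.P_inv a b (K.J c)
  rw [K.P_eq_zero hb (K.G_J_of hc), map_zero, C.P_symm b,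
    C.P_br_swap (K.P_eq_zero ha (K.G_J_of hc))] at h
  simp only [bis]
  linear_combination -h

theorem tor_skew_right (a b c : Γ) : K.tor a b c = -K.tor a c b := by
  simp only [tor]
  linear_combination K.bis'_metric a b c - K.bis_metric a b c

/-- Compare the invariance of `⟨a, c⟩` under `[b, ·]`, rewritten by `P_br`, with the metricity of
`bis`. Together with skewness in the last two arguments, which only uses that both connections are
metric, this makes `tor` totally skew. -/
theorem tor_skew_left_right (ha : K.G a = a) (hb : K.G b = b) (hc : K.G c = c) :
    K.tor a b c = -K.tor c b a := by
  have h1 := K.P_br hb ha hc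
  have h2 := K.P_br hb hc ha
  have h3 := C.P_inv b a c
  rw [C.P_symm a (C.br b c)] at h3
  simp only [tor]
  linear_combination h3 + h1 + h2 - K.bis_metric b a c

theorem tor_skew_left (ha : K.G a = a) (hb : K.G b = b) (hc : K.G c = c) :
    K.tor a b c = -K.tor b a c := by
  rw [K.tor_skew_right, K.tor_skew_left_right ha hc hb, K.tor_skew_right b, neg_neg]

/-! ### The canonical connection -/

variable (e : Γ) (κ : ℝ)

/-- The part of the canonical connection with values in the `1`-eigenspace of `G`. -/
def connPlus (a b : Γ) : Γ :=
  K.p (C.br (K.flip.p a) (K.p b))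
    + algebraMap ℝ R (2 / 3) • K.p (C.br (K.J (K.p a)) (K.p b))
    + algebraMap ℝ R (1 / 3) • K.J (K.flip.p (C.br (K.p a) (K.J (K.p b))))
    + algebraMap ℝ R κ • (C.P (K.p a) (K.p b) • K.p e - C.P (K.p e) (K.p b) • K.p a)

/-- The canonical connection. -/
def conn (a b : Γ) : Γ := K.connPlus e κ a b + K.flip.connPlus e κ a b

theorem flip_conn : K.flip.conn e κ = K.conn e κ := by
  funext a b
  rw [conn, conn, flip_flip, add_comm]

/-- The coefficients are `2/3 bis + 1/3 bis'` on `E₊`, plus the mixed bracket and the tensor defined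
by `e`; identities for `connPlus` are checked on them. -/
theorem P_connPlus (a b c : Γ) : C.P (K.connPlus e κ a b) c =
    C.P (C.br (K.flip.p a) (K.p b)) (K.p c)
      + algebraMap ℝ R (2 / 3) * C.P (C.br (K.J (K.p a)) (K.p b)) (K.p c)
      - algebraMap ℝ R (1 / 3) * C.P (C.br (K.p a) (K.J (K.p b))) (K.J (K.p c))
      + algebraMap ℝ R κ * (C.P (K.p a) (K.p b) * C.P (K.p e) (K.p c)
          - C.P (K.p e) (K.p b) * C.P (K.p a) (K.p c)) := by
  have h : ∀ u, C.P (K.p u) c = C.P (K.p u) (K.p c) := fun u => by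
    rw [K.P_p, ← K.P_p, ← K.P_p, K.p_eq_self (K.G_p u), K.P_p]
  have hJ : ∀ u, C.P (K.J (K.flip.p u)) c = -C.P u (K.J (K.p c)) := fun u => by
    rw [K.P_J_left, K.flip.P_p, K.J_p]
  simp only [connPlus, map_add, map_sub, map_smul, LinearMap.add_apply, LinearMap.sub_apply,
    LinearMap.smul_apply, smul_eq_mul, hJ, K.P_p (C.br _ _), h]
  ring

theorem thirds : algebraMap ℝ R (2 / 3) + algebraMap ℝ R (1 / 3) = 1 := by
  rw [← map_add]
  norm_num

/-- The derivatives of `f` are multiplied by scalar products of sections from opposite eigenspaces,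
hence vanish. -/
theorem connPlus_smul_left (f : R) (a b : Γ) :
    K.connPlus e κ (f • a) b = f • K.connPlus e κ a b := by
  refine C.ext_P fun c => ?_
  have hm := fun u => K.flip.G_p u
  simp only [flip_G, neg_eq_iff_eq_neg] at hm
  have z1 := fun u v => K.P_eq_zero' (hm u) (K.G_p v)
  have z2 := fun u v => K.P_eq_zero' (K.G_J_of (K.G_p u)) (K.G_p v)
  have z3 := fun u v => K.P_eq_zero (K.G_p u) (K.G_J_of (K.G_p v))
  simp only [map_smul, LinearMap.smul_apply, smul_eq_mul, P_connPlus, C.P_br_smul_left, z1, z2, z3]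
  ring

theorem connPlus_smul_right (f : R) (a b : Γ) :
    K.connPlus e κ a (f • b) = f • K.connPlus e κ a b + C.ρ a f • K.p b := by
  refine C.ext_P fun c => ?_
  have h : C.ρ a f = C.ρ (K.p a) f + C.ρ (K.flip.p a) f := by
    conv_lhs => rw [← K.p_add_flip_p a, map_add, Derivation.add_apply]
  have h' : C.P (K.p b) c = C.P (K.p b) (K.p c) := by
    rw [K.P_p, ← K.P_p, ← K.P_p, K.p_eq_self (K.G_p b), K.P_p]
  simp only [map_smul, map_add, LinearMap.add_apply, LinearMap.smul_apply, smul_eq_mul, P_connPlus,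
    C.br_smul, K.P_J, K.ρ_J, h, h']
  -- Both `bis` and `bis'` obey the Leibniz rule, and the weights `2/3` and `1/3` add up to one.
  linear_combination (C.ρ (K.p a) f * C.P (K.p b) (K.p c)) * thirds (R := R)

theorem connPlus_metric (a b c : Γ) :
    C.ρ a (C.P (K.p b) (K.p c)) =
      C.P (K.connPlus e κ a b) c + C.P b (K.connPlus e κ a c) := by
  have h : ∀ f, C.ρ a f = C.ρ (K.p a) f + C.ρ (K.flip.p a) f := fun f => by
    conv_lhs => rw [← K.p_add_flip_p a, map_add, Derivation.add_apply]
  have h1 := C.P_inv (K.flip.p a) (K.p b) (K.p c)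
  have h2 := K.bis_metric (K.p a) (K.p b) (K.p c)
  have h3 := K.bis'_metric (K.p a) (K.p b) (K.p c)
  simp only [bis, bis'] at h2 h3
  rw [C.P_symm b, P_connPlus, P_connPlus, h]
  rw [C.P_symm (K.p b) (C.br (K.flip.p a) _)] at h1
  linear_combination h1 + algebraMap ℝ R (2 / 3) * h2 + algebraMap ℝ R (1 / 3) * h3 -
    C.ρ (K.p a) (C.P (K.p b) (K.p c)) * thirds (R := R)

theorem conn_isConnection : C.IsConnection (K.conn e κ) where
  add_left a b c := by
    simp only [conn, connPlus, map_add, C.br_add_left, LinearMap.add_apply, add_smul, smul_add,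
      smul_sub]
    abel
  add_right a b c := by
    simp only [conn, connPlus, map_add, C.br_add_right, add_smul, smul_add, smul_sub]
    abel
  smul_left f a b := by
    simp only [conn, connPlus_smul_left, smul_add]
  smul_right a f b := by
    simp only [conn, connPlus_smul_right, smul_add]
    conv_rhs => rw [← K.p_add_flip_p b, smul_add]
    simp only [K.p_add_flip_p]
    abel

theorem conn_metric (a b c : Γ) :
    C.ρ a (C.P b c) = C.P (K.conn e κ a b) c + C.P b (K.conn e κ a c) := by
  rw [K.P_eq_add, map_add, K.connPlus_metric e κ, K.flip.connPlus_metric e κ]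
  simp only [conn, map_add, LinearMap.add_apply]
  ring

theorem connPlus_of_neg (a : Γ) {b : Γ} (hb : K.G b = -b) : K.connPlus e κ a b = 0 := by
  refine C.ext_P fun c => ?_
  have h : ∀ u, C.br u 0 = 0 := fun u => by simpa using C.br_sub_right u 0 0
  simp [P_connPlus, K.p_eq_zero hb, h]

theorem G_connPlus (a b : Γ) : K.G (K.connPlus e κ a b) = K.connPlus e κ a b := by
  have h : ∀ u, K.G (K.J (K.flip.p u)) = K.J (K.flip.p u) := fun u => by
    have := K.flip.G_J (K.flip.p u)
    rw [K.flip.G_p] at this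
    simpa using this
  simp only [connPlus, map_add, map_smul, map_sub, K.G_p, h]

theorem conn_eq_connPlus (a : Γ) {b : Γ} (hb : K.G b = b) :
    K.conn e κ a b = K.connPlus e κ a b := by
  rw [conn, K.flip.connPlus_of_neg e κ a (by rw [flip_G, hb]), add_zero]

theorem G_conn (a : Γ) {b : Γ} (hb : K.G b = b) : K.G (K.conn e κ a b) = K.conn e κ a b := by
  rw [K.conn_eq_connPlus e κ a hb, G_connPlus]

theorem P_conn (ha : K.G a = a) (hb : K.G b = b) (hc : K.G c = c) :
    C.P (K.conn e κ a b) c = algebraMap ℝ R (2 / 3) * K.bis a b c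
      + algebraMap ℝ R (1 / 3) * K.bis' a b c
      + algebraMap ℝ R κ * (C.P a b * C.P e c - C.P e b * C.P a c) := by
  have h0 : C.P (C.br 0 b) c = 0 := by simpa using congrArg (C.P · c) (C.br_sub_left 0 0 b)
  rw [K.conn_eq_connPlus e κ a hb, P_connPlus, K.flip_p_eq_zero ha, K.p_eq_self ha,
    K.p_eq_self hb, K.p_eq_self hc, h0, bis, bis', K.P_p e, K.P_p e, K.p_eq_self hb,
    K.p_eq_self hc]
  ring

theorem P_conn_J (ha : K.G a = a) (hb : K.G b = b) (hc : K.G c = c) :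
    C.P (K.conn e κ (K.J a) b) c = K.bis a b c := by
  have h0 : ∀ u, C.br 0 u = 0 := fun u => by simpa using C.br_sub_left 0 0 u
  rw [K.conn_eq_connPlus e κ _ hb, P_connPlus, K.flip.p_eq_self (K.flip_G_J ha),
    K.p_eq_zero (K.G_J_of ha), K.p_eq_self hb, K.p_eq_self hc, bis]
  simp [h0]

end CourantMetric

/-! ### Algebra of traces in an orthogonal frame -/

section FrameAlgebra

variable {ι : Type*} [Fintype ι] [DecidableEq ι] {η ε : ι → ℝ}

/-- The trace `∑ ηᵢ β i i m` equals `ε m`: the skew part `h` drops out, and the `ε`-part gives `κ (n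
- 1) ε m`. The normalisation of `κ` is chosen for this. -/
theorem sum_trace_sq (hη : ∀ i, η i ≠ 0) {κ : ℝ} (hκ : κ * ((Fintype.card ι : ℝ) - 1) = 1)
    {h : ι → ι → ι → ℝ} (h12 : ∀ i j m, h i j m = -h j i m) {β : ι → ι → ι → ℝ}
    (hβ : ∀ j i m, β j i m = h j i m / 6 + κ * ((if j = i then (η j)⁻¹ else 0) * ε m
      - ε i * (if j = m then (η j)⁻¹ else 0))) :
    ∑ i, ∑ j, ∑ m, η i * η j * η m * (β i i m * β j j m) = ∑ m, η m * ε m ^ 2 := by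
  have h0 : ∀ i m, h i i m = 0 := fun i m => by linarith [h12 i i m]
  have key : ∀ m, ∑ i, η i * β i i m = ε m := by
    intro m
    have : ∀ i, η i * β i i m = κ * ε m - (if i = m then κ * ε i else 0) := by
      intro i
      have := hη i
      rw [hβ, h0, if_pos rfl]
      split_ifs <;> field_simp <;> ring
    rw [Finset.sum_congr rfl fun i _ => this i, Finset.sum_sub_distrib]
    simp only [Finset.sum_const, Finset.card_univ, nsmul_eq_mul, Finset.sum_ite_eq',
      Finset.mem_univ, if_true]
    linear_combination ε m * hκ
  calc _ = ∑ m, η m * ((∑ i, η i * β i i m) * (∑ j, η j * β j j m)) := by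
        rw [Finset.sum_congr rfl fun i _ => Finset.sum_comm, Finset.sum_comm]
        refine Finset.sum_congr rfl fun m _ => ?_
        rw [Finset.sum_mul_sum, Finset.mul_sum]
        refine Finset.sum_congr rfl fun i _ => ?_
        rw [Finset.mul_sum]
        exact Finset.sum_congr rfl fun j _ => by ring
    _ = _ := by simp only [key, sq]

/-- Cross terms between `h` and `ε` vanish because `h` is zero on repeated indices. The squares of
`ε` sum with total weight `2n - n - n = 0`, so only the squares of `h` survive. -/
theorem sum_quadratic (hη : ∀ i, η i ≠ 0) (κ : ℝ) {h : ι → ι → ι → ℝ}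
    (h12 : ∀ i j m, h i j m = -h j i m) (h23 : ∀ i j m, h i j m = -h i m j)
    {β : ι → ι → ι → ℝ}
    (hβ : ∀ j i m, β j i m = h j i m / 6 + κ * ((if j = i then (η j)⁻¹ else 0) * ε m
      - ε i * (if j = m then (η j)⁻¹ else 0))) :
    ∑ i, ∑ j, ∑ m, η i * η j * η m *
      (2 * (β j i m * β i j m) - (h j i m / 2 * β m i j - h j i m / 2 * (h m i j / 2))
        - (h i j m / 2 * β m j i - h i j m / 2 * (h m j i / 2))
        + (β m j i * β m i j - h m j i / 2 * (h m i j / 2))) =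
      -(1 / 6) * ∑ i, ∑ j, ∑ m, η i * η j * η m * h i j m ^ 2 := by
  have h0 : ∀ i m, h i i m = 0 := fun i m => by linarith [h12 i i m]
  have h0' : ∀ i m, h i m m = 0 := fun i m => by linarith [h23 i m m]
  have h0'' : ∀ i m, h i m i = 0 := fun i m => by linarith [h12 i m i, h0' m i]
  have key : ∀ i j m, η i * η j * η m *
      (2 * (β j i m * β i j m) - (h j i m / 2 * β m i j - h j i m / 2 * (h m i j / 2))
        - (h i j m / 2 * β m j i - h i j m / 2 * (h m j i / 2))
        + (β m j i * β m i j - h m j i / 2 * (h m i j / 2))) =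
      -(1 / 6) * (η i * η j * η m * h i j m ^ 2) + κ ^ 2 * (2 * (if i = j then η m * ε m ^ 2 else 0)
        - (if m = j then η i * ε i ^ 2 else 0) - (if m = i then η j * ε j ^ 2 else 0)) := by
    intro i j m
    have e1 : h j i m = -h i j m := h12 j i m
    have e2 : h m i j = h i j m := by rw [h12 m i j, h23 i m j, neg_neg]
    have e3 : h m j i = -h i j m := by rw [h23 m j i, e2]
    have hi := hη i
    have hj := hη j
    have hm := hη m
    simp only [hβ, e1, e2, e3]
    -- Where indices coincide `h` is zero; where they are distinct the Kronecker terms are zero.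
    by_cases hij : i = j
    · subst hij
      rw [h0 i m]
      by_cases him : m = i
      · subst him
        simp only [if_true]
        field_simp
        ring
      · simp only [him, Ne.symm him, if_true, if_false]
        field_simp
        ring
    · by_cases him : m = i
      · subst him
        rw [h0'' m j]
        simp only [hij, Ne.symm hij, if_true, if_false]
        field_simp
        ring
      · by_cases hjm : m = j
        · subst hjm
          rw [h0' i m]
          simp only [hij, him, if_true, if_false]
          field_simp
          ring
        · simp only [hij, Ne.symm hij, him, Ne.symm him, hjm, Ne.symm hjm, if_false]
          ring
  simp only [key, Finset.sum_add_distrib, ← Finset.mul_sum, Finset.sum_sub_distrib]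
  have s1 : ∑ i : ι, ∑ j : ι, ∑ m : ι, (if i = j then η m * ε m ^ 2 else 0) =
      Fintype.card ι * ∑ m, η m * ε m ^ 2 := by
    rw [Finset.sum_congr rfl fun i _ => Finset.sum_comm]
    simp [Finset.sum_ite_eq]
  have s2 : ∑ i : ι, ∑ j : ι, ∑ m : ι, (if m = j then η i * ε i ^ 2 else 0) =
      Fintype.card ι * ∑ m, η m * ε m ^ 2 := by
    simp [Finset.sum_ite_eq', Finset.mul_sum]
  have s3 : ∑ i : ι, ∑ j : ι, ∑ m : ι, (if m = i then η j * ε j ^ 2 else 0) =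
      Fintype.card ι * ∑ m, η m * ε m ^ 2 := by
    simp [Finset.sum_ite_eq']
  rw [s1, s2, s3]
  ring

/-- Each of the two diagonal terms contributes `κ n` times the divergence and the Kronecker terms
remove `2 κ`, leaving `2 κ (n - 1) = 2`. -/
theorem sum_divergence (hη : ∀ i, η i ≠ 0) {κ : ℝ} (hκ : κ * ((Fintype.card ι : ℝ) - 1) = 1)
    (E : ι → ι → ℝ) :
    ∑ i, ∑ j, η i * η j * (κ * ((η i)⁻¹ * E j j - (if i = j then (η i)⁻¹ else 0) * E j i
      - ((if j = i then (η j)⁻¹ else 0) * E i j - E i i * (η j)⁻¹))) = 2 * ∑ j, η j * E j j := by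
  have key : ∀ i j, η i * η j * (κ * ((η i)⁻¹ * E j j - (if i = j then (η i)⁻¹ else 0) * E j i
      - ((if j = i then (η j)⁻¹ else 0) * E i j - E i i * (η j)⁻¹))) =
      κ * (η j * E j j) + κ * (η i * E i i) - 2 * κ * (if i = j then η i * E i i else 0) := by
    intro i j
    have hi := hη i
    have hj := hη j
    by_cases hij : i = j
    · subst hij
      simp only [if_true]
      field_simp
      ring
    · simp only [hij, Ne.symm hij, if_false]
      field_simp
      ring
  simp only [key, Finset.sum_add_distrib, ← Finset.mul_sum, Finset.sum_sub_distrib,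
    Finset.sum_ite_eq, Finset.mem_univ, if_true, Finset.sum_const, Finset.card_univ, nsmul_eq_mul]
  have : ∑ j, η j * (Fintype.card ι * E j j) = Fintype.card ι * ∑ j, η j * E j j := by
    rw [Finset.mul_sum]
    exact Finset.sum_congr rfl fun j _ => by ring
  linear_combination (2 * ∑ j, η j * E j j) * hκ + κ * this

end FrameAlgebra

/-! ### Parallel frames and the coefficients of the connection in them. -/

namespace CourantMetric

variable {M R Γ : Type*} [CommRing R] [Algebra ℝ R] [AddCommGroup Γ] [Module R Γ]
  {C : CourantModule M R Γ} (K : CourantMetric C)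

/-- A frame of the `1`-eigenspace of `G` which is orthogonal at `x` and parallel at `x` for the
Levi-Civita connection. -/
structure IsParallelFrame (x : M) {ι : Type*} [Fintype ι] [DecidableEq ι] (f : ι → Γ)
    (η : ι → ℝ) : Prop where
  G_f : ∀ i, K.G (f i) = f i
  ne_zero : ∀ i, η i ≠ 0
  orth : ∀ i j, C.ev x (C.P (f i) (f j)) = if i = j then (η i)⁻¹ else 0
  expand : ∀ u w, K.G u = u →
    C.ev x (C.P u w) = ∑ i, η i * (C.ev x (C.P (f i) u) * C.ev x (C.P (f i) w))
  parallel : ∀ i c w, K.G c = c → K.G w = w →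
    C.ev x (K.bis c (f i) w) + C.ev x (K.bis' c (f i) w) = 0

/-- A dual family built from a frame of the `1`-eigenspace of `G`. -/
def frame {ι : Type*} (f : ι → Γ) : ι ⊕ ι → Γ := Sum.elim f fun i => K.J (f i)

/-- The dual of the family `frame`. -/
def coframe {ι : Type*} (f : ι → Γ) (η : ι → ℝ) : ι ⊕ ι → Γ :=
  Sum.elim (fun i => algebraMap ℝ R (η i) • f i) fun i => algebraMap ℝ R (-η i) • K.J (f i)

variable {K} {x : M} {ι : Type*} [Fintype ι] [DecidableEq ι] {f : ι → Γ} {η : ι → ℝ}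

namespace IsParallelFrame

theorem flip (hf : K.IsParallelFrame x f η) :
    K.flip.IsParallelFrame x (fun i => K.J (f i)) (-η) where
  G_f i := K.flip_G_J (hf.G_f i)
  ne_zero i := neg_ne_zero.2 (hf.ne_zero i)
  orth i j := by
    rw [K.P_J, map_neg, hf.orth]
    split_ifs <;> simp [inv_neg]
  expand u w hu := by
    have hu' : K.G (K.J u) = K.J u := by simpa using K.flip.flip_G_J hu
    have h := hf.expand (K.J u) (K.J w) hu'
    rw [K.P_J, map_neg, neg_eq_iff_eq_neg] at h
    rw [h, ← Finset.sum_neg_distrib]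
    refine Finset.sum_congr rfl fun i _ => ?_
    rw [K.P_J_left, K.P_J_left, map_neg, map_neg, Pi.neg_apply]
    ring
  parallel i c w hc hw := by
    have h := hf.parallel i (K.J c) (K.J w) (by simpa using K.flip.flip_G_J hc)
      (by simpa using K.flip.flip_G_J hw)
    have h1 := K.flip_bis (K.J c) (f i) (K.J w)
    have h2 := K.flip_bis' (K.J c) (f i) (K.J w)
    rw [K.J_J, K.J_J] at h1 h2
    rw [h1, h2, map_neg, map_neg]
    linarith

theorem isDualFamily (hf : K.IsParallelFrame x f η) :
    C.IsDualFamily x (K.frame f) (K.coframe f η) := by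
  intro u w
  have h1 := hf.expand (K.p u) (K.p w) (K.G_p u)
  have h2 := hf.flip.expand (K.flip.p u) (K.flip.p w) (K.flip.G_p u)
  have e1 : ∀ i v, C.P (f i) (K.p v) = C.P (f i) v := fun i v => by
    rw [← K.P_p, K.p_eq_self (hf.G_f i)]
  have e2 : ∀ i v, C.P (K.J (f i)) (K.flip.p v) = C.P (K.J (f i)) v := fun i v => by
    rw [← K.flip.P_p, K.flip.p_eq_self (hf.flip.G_f i)]
  rw [K.P_eq_add, map_add, h1, h2, Fintype.sum_sum_type]
  simp [frame, coframe, e1, e2, mul_assoc]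

variable (e : Γ) (κ : ℝ)

/-- On a parallel frame the sum of the two connections is zero at `x`, so each is plus or minus half
their difference `tor`. -/
theorem bis_eq (hf : K.IsParallelFrame x f η) (i : ι) {c w : Γ} (hc : K.G c = c) (hw : K.G w = w) :
    C.ev x (K.bis c (f i) w) = C.ev x (K.tor c (f i) w) / 2 := by
  rw [tor, map_sub]
  linarith [hf.parallel i c w hc hw]

theorem bis'_eq (hf : K.IsParallelFrame x f η) (i : ι) {c w : Γ} (hc : K.G c = c)
    (hw : K.G w = w) : C.ev x (K.bis' c (f i) w) = -(C.ev x (K.tor c (f i) w) / 2) := by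
  rw [tor, map_sub]
  linarith [hf.parallel i c w hc hw]

theorem ev_ρ_P (hf : K.IsParallelFrame x f η) {c : Γ} (hc : K.G c = c) (i j : ι) :
    C.ev x (C.ρ c (C.P (f i) (f j))) = 0 := by
  have h1 := congrArg (C.ev x) (K.bis_metric c (f i) (f j))
  rw [map_add, hf.bis_eq i hc (hf.G_f j), hf.bis_eq j hc (hf.G_f i), K.tor_skew_right, map_neg] at h1
  linarith

theorem P_conn (hf : K.IsParallelFrame x f η) (j i m : ι) :
    C.ev x (C.P (K.conn e κ (f j) (f i)) (f m)) = C.ev x (K.tor (f j) (f i) (f m)) / 6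
      + κ * ((if j = i then (η j)⁻¹ else 0) * C.ev x (C.P e (f m))
        - C.ev x (C.P e (f i)) * (if j = m then (η j)⁻¹ else 0)) := by
  rw [K.P_conn e κ (hf.G_f j) (hf.G_f i) (hf.G_f m)]
  simp only [map_add, map_sub, map_mul, AlgHom.commutes, Algebra.algebraMap_self, RingHom.id_apply,
    hf.orth, hf.bis_eq i (hf.G_f j) (hf.G_f m), hf.bis'_eq i (hf.G_f j) (hf.G_f m)]
  ring

theorem P_conn_J (hf : K.IsParallelFrame x f η) (m i j : ι) :
    C.ev x (C.P (K.conn e κ (K.J (f m)) (f i)) (f j)) = C.ev x (K.tor (f m) (f i) (f j)) / 2 := by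
  rw [K.P_conn_J e κ (hf.G_f m) (hf.G_f i) (hf.G_f j), hf.bis_eq i (hf.G_f m) (hf.G_f j)]

theorem P_br (hf : K.IsParallelFrame x f η) (j i m : ι) :
    C.ev x (C.P (C.br (f j) (f i)) (f m)) = C.ev x (K.tor (f j) (f i) (f m)) / 2 := by
  have e1 := K.tor_skew_left (hf.G_f i) (hf.G_f j) (hf.G_f m)
  have e2 := K.tor_skew_left (hf.G_f m) (hf.G_f j) (hf.G_f i)
  have e3 := K.tor_skew_right (f j) (f m) (f i)
  rw [K.P_br (hf.G_f j) (hf.G_f i) (hf.G_f m), map_add, map_sub,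
    hf.bis_eq i (hf.G_f j) (hf.G_f m), hf.bis_eq j (hf.G_f i) (hf.G_f m),
    hf.bis'_eq j (hf.G_f m) (hf.G_f i), e1, e2, e3]
  simp only [map_neg]
  ring

theorem P_br_J (hf : K.IsParallelFrame x f η) (j i m : ι) :
    C.ev x (C.P (C.br (f j) (f i)) (K.J (f m))) = C.ev x (K.tor (f j) (f i) (f m)) / 2 := by
  have e2 := K.tor_skew_left (hf.G_f m) (hf.G_f j) (hf.G_f i)
  have e3 := K.tor_skew_right (f j) (f m) (f i)
  rw [K.P_br_J (hf.G_f j) (hf.G_f i) (hf.G_f m), hf.bis_eq j (hf.G_f m) (hf.G_f i), e2, e3, neg_neg]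

/-- The components of `[f j, f i]` along `f m` and along `J (f m)` are both given by `tor / 2`. The
minus sign comes from `-η` in the coframe of `E₋`. -/
theorem P_conn_br (hf : K.IsParallelFrame x f η) (j i : ι) (k l : ι) :
    C.ev x (C.P (K.conn e κ (C.br (f j) (f i)) (f k)) (f l)) =
      ∑ m, η m * (C.ev x (K.tor (f j) (f i) (f m)) / 2 * C.ev x (C.P (K.conn e κ (f m) (f k)) (f l))
        - C.ev x (K.tor (f j) (f i) (f m)) / 2 * (C.ev x (K.tor (f m) (f k) (f l)) / 2)) := by
  rw [((K.conn_isConnection e κ).isTensor_left (f k) (f l)).expand hf.isDualFamily,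
    Fintype.sum_sum_type, ← Finset.sum_add_distrib]
  refine Finset.sum_congr rfl fun m _ => ?_
  simp only [frame, coframe, Sum.elim_inl, Sum.elim_inr, map_smul, LinearMap.smul_apply,
    smul_eq_mul, map_mul, AlgHom.commutes, Algebra.algebraMap_self, RingHom.id_apply]
  rw [C.P_symm (f m) (C.br _ _), C.P_symm (K.J (f m)), hf.P_br, hf.P_br_J, hf.P_conn_J]
  ring

/-- Metricity trades the second derivative of a section for the derivative of a coefficient
function, where only products of coefficients at `x` remain. -/
theorem P_conn_conn (hf : K.IsParallelFrame x f η) (a : Γ) (i j k : ι) :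
    C.ev x (C.P (K.conn e κ a (K.conn e κ (f i) (f j))) (f k)) =
      C.ev x (C.ρ a (C.P (K.conn e κ (f i) (f j)) (f k)))
        - C.ev x (C.P (K.conn e κ (f i) (f j)) (K.conn e κ a (f k))) := by
  rw [K.conn_metric e κ a, map_add]
  ring

end IsParallelFrame

end CourantMetric

/-! ### The double trace in a parallel frame. -/

namespace CourantMetric

variable {M R Γ : Type*} [CommRing R] [Algebra ℝ R] [AddCommGroup Γ] [Module R Γ]
  {C : CourantModule M R Γ} (K : CourantMetric C)

/-- The part of the double trace of the generalised Riemann tensor over the `1`-eigenspace of `G`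
that does not depend on the divergence operator. It is a multiple of `R - |H|² / 12`. -/
def metricScalar (x : M) {ι : Type*} [Fintype ι] (f : ι → Γ) (η : ι → ℝ) : ℝ :=
  1 / 4 * ∑ i, ∑ j, η i * η j *
    (C.ev x (C.ρ (f j) (K.bis (f i) (f i) (f j) + K.bis' (f i) (f i) (f j)))
      - C.ev x (C.ρ (f i) (K.bis (f j) (f i) (f j) + K.bis' (f j) (f i) (f j)))
      + C.ev x (C.ρ (f i) (K.bis (f j) (f j) (f i) + K.bis' (f j) (f j) (f i)))
      - C.ev x (C.ρ (f j) (K.bis (f i) (f j) (f i) + K.bis' (f i) (f j) (f i))))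
  - 1 / 12 * ∑ i, ∑ j, ∑ m, η i * η j * η m * C.ev x (K.tor (f i) (f j) (f m)) ^ 2

/-- The derivative terms carry two factors `η`, but the sum of the connection coefficients changes
sign; the cubic term carries three factors `η`, and `tor` is unchanged. Both parts are therefore
odd, and the metric contributions of `E₊` and `E₋` cancel. -/
theorem metricScalar_flip (x : M) {ι : Type*} [Fintype ι] (f : ι → Γ) (η : ι → ℝ) :
    K.flip.metricScalar x (fun i => K.J (f i)) (-η) = -K.metricScalar x f η := by
  simp only [metricScalar, K.flip_bis, K.flip_bis', K.flip_tor, K.ρ_J, Pi.neg_apply, ← neg_add,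
    map_neg]
  have e1 : ∀ i j (A B A' B' : ℝ), -η i * -η j * (-A - -B + -A' - -B') =
      -(η i * η j * (A - B + A' - B')) := fun i j A B A' B' => by ring
  have e2 : ∀ i j m (A : ℝ), -η i * -η j * -η m * A = -(η i * η j * η m * A) :=
    fun i j m A => by ring
  simp only [e1, e2, Finset.sum_neg_distrib, add_comm (K.bis' _ _ _)]
  ring

variable {K} {x : M} {ι : Type*} [Fintype ι] [DecidableEq ι] {f : ι → Γ} {η : ι → ℝ}
  (e : Γ) (κ : ℝ)

namespace IsParallelFrame

/-- The splitting uses `2/3 bis + 1/3 bis' = (bis + bis')/2 + tor/6`. The functions `⟨f i, f j⟩`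
have zero derivative at `x` along `E₊`, so in the last part only `⟨e, f k⟩` is differentiated. -/
theorem ρ_P_conn (hf : K.IsParallelFrame x f η) (l i j k : ι) :
    C.ev x (C.ρ (f l) (C.P (K.conn e κ (f i) (f j)) (f k))) =
      1 / 2 * C.ev x (C.ρ (f l) (K.bis (f i) (f j) (f k) + K.bis' (f i) (f j) (f k)))
        + 1 / 6 * C.ev x (C.ρ (f l) (K.tor (f i) (f j) (f k)))
        + κ * ((if i = j then (η i)⁻¹ else 0) * C.ev x (C.ρ (f l) (C.P e (f k)))
          - C.ev x (C.ρ (f l) (C.P e (f j))) * (if i = k then (η i)⁻¹ else 0)) := by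
  rw [K.P_conn e κ (hf.G_f i) (hf.G_f j) (hf.G_f k), tor]
  simp only [map_add, map_sub, Derivation.leibniz, Derivation.map_algebraMap, smul_zero, add_zero,
    smul_eq_mul, map_mul, AlgHom.commutes, Algebra.algebraMap_self, RingHom.id_apply,
    hf.ev_ρ_P (hf.G_f l), hf.orth, mul_zero]
  ring

/-- Every derivative of `tor` in the trace has a repeated argument, so derivatives of `H` do not
contribute. -/
theorem ρ_tor_self (hf : K.IsParallelFrame x f η) (l i j : ι) :
    C.ev x (C.ρ (f l) (K.tor (f i) (f i) (f j))) = 0 := by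
  have h := congrArg (fun r => C.ev x (C.ρ (f l) r))
    (K.tor_skew_left (hf.G_f i) (hf.G_f i) (hf.G_f j))
  simp only [map_neg] at h
  linarith

theorem ρ_tor_self' (hf : K.IsParallelFrame x f η) (l i j : ι) :
    C.ev x (C.ρ (f l) (K.tor (f i) (f j) (f i))) = 0 := by
  rw [K.tor_skew_right, map_neg, map_neg, hf.ρ_tor_self, neg_zero]

theorem riemann_frame (hf : K.IsParallelFrame x f η) (i j : ι) {β : ι → ι → ι → ℝ}
    (hβ : ∀ j i m, C.ev x (C.P (K.conn e κ (f j) (f i)) (f m)) = β j i m) {h : ι → ι → ι → ℝ}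
    (hh : ∀ j i m, C.ev x (K.tor (f j) (f i) (f m)) = h j i m) :
    2 * C.riemann (K.conn e κ) x (K.frame f) (K.coframe f η) (f j) (f i) (f j) (f i) =
      C.ev x (C.ρ (f j) (C.P (K.conn e κ (f i) (f i)) (f j)))
      - C.ev x (C.ρ (f i) (C.P (K.conn e κ (f j) (f i)) (f j)))
      + C.ev x (C.ρ (f i) (C.P (K.conn e κ (f j) (f j)) (f i)))
      - C.ev x (C.ρ (f j) (C.P (K.conn e κ (f i) (f j)) (f i)))
      + ∑ m, η m * (2 * (β j i m * β i j m) - (h j i m / 2 * β m i j - h j i m / 2 * (h m i j / 2))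
        - (h i j m / 2 * β m j i - h i j m / 2 * (h m j i / 2))
        + (β m j i * β m i j - h m j i / 2 * (h m i j / 2)))
      - 2 * ∑ m, η m * (β i i m * β j j m) := by
  -- The derivative of `f b` stays in `E₊`, so the frame of `E₊` suffices for the expansion.
  have hc : ∀ a b c d, C.ev x (C.P (K.conn e κ (f a) (f b)) (K.conn e κ (f c) (f d))) =
      ∑ m, η m * (β a b m * β c d m) := fun a b c d => by
    rw [hf.expand _ _ (K.G_conn e κ _ (hf.G_f b))]
    refine Finset.sum_congr rfl fun m _ => ?_
    rw [C.P_symm (f m), C.P_symm (f m), hβ, hβ]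
  simp only [riemann, map_sub, LinearMap.sub_apply, hf.P_conn_conn, hf.P_conn_br, hc, hh, hβ,
    Fintype.sum_sum_type, frame, coframe, Sum.elim_inl, Sum.elim_inr,
    (K.conn_isConnection e κ).smul_left, map_smul, LinearMap.smul_apply, smul_eq_mul, map_mul,
    AlgHom.commutes, Algebra.algebraMap_self, RingHom.id_apply, hf.P_conn_J]
  have s : ∀ m, η m * (2 * (β j i m * β i j m)
        - (h j i m / 2 * β m i j - h j i m / 2 * (h m i j / 2))
        - (h i j m / 2 * β m j i - h i j m / 2 * (h m j i / 2))
        + (β m j i * β m i j - h m j i / 2 * (h m i j / 2))) =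
      η m * (β j i m * β i j m) + η m * (β i j m * β j i m)
        - η m * (h j i m / 2 * β m i j - h j i m / 2 * (h m i j / 2))
        - η m * (h i j m / 2 * β m j i - h i j m / 2 * (h m j i / 2))
        + β m j i * (η m * β m i j) + h m j i / 2 * (-η m * (h m i j / 2)) := fun m => by ring
  simp only [s, Finset.sum_add_distrib, Finset.sum_sub_distrib, mul_comm (β j j _)]
  ring

/-- The double trace of the generalised Riemann tensor over the `1`-eigenspace of `G`. -/
theorem sum_riemann (hf : K.IsParallelFrame x f η)
    (hκ : κ * ((Fintype.card ι : ℝ) - 1) = 1) :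
    ∑ i, ∑ j, η i * η j *
        C.riemann (K.conn e κ) x (K.frame f) (K.coframe f η) (f j) (f i) (f j) (f i) =
      K.metricScalar x f η + 2 * ∑ j, η j * C.ev x (C.ρ (f j) (C.P e (f j)))
        - ∑ m, η m * C.ev x (C.P e (f m)) ^ 2 := by
  set h : ι → ι → ι → ℝ := fun j i m => C.ev x (K.tor (f j) (f i) (f m)) with hh
  set β : ι → ι → ι → ℝ := fun j i m => C.ev x (C.P (K.conn e κ (f j) (f i)) (f m)) with hβ
  set E : ι → ι → ℝ := fun j i => C.ev x (C.ρ (f j) (C.P e (f i))) with hE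
  have hβ' : ∀ j i m, β j i m = h j i m / 6 + κ * ((if j = i then (η j)⁻¹ else 0)
      * C.ev x (C.P e (f m)) - C.ev x (C.P e (f i)) * (if j = m then (η j)⁻¹ else 0)) :=
    fun j i m => hf.P_conn e κ j i m
  have h12 : ∀ i j m, h i j m = -h j i m := fun i j m => by
    simp only [hh]
    rw [K.tor_skew_left (hf.G_f i) (hf.G_f j) (hf.G_f m), map_neg]
  have h23 : ∀ i j m, h i j m = -h i m j := fun i j m => by
    simp only [hh]
    rw [K.tor_skew_right, map_neg]
  have q1 := sum_trace_sq hf.ne_zero hκ h12 hβ'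
  have q2 := sum_quadratic hf.ne_zero κ h12 h23 hβ'
  have q3 := sum_divergence hf.ne_zero hκ E
  -- The summand splits into the metric derivative terms, the quadratic terms of `sum_quadratic`,
  -- two copies of the divergence summand with `i` and `j` exchanged, and the product of traces.
  have key : ∀ i j, η i * η j *
      C.riemann (K.conn e κ) x (K.frame f) (K.coframe f η) (f j) (f i) (f j) (f i) =
    1 / 4 * (η i * η j *
    (C.ev x (C.ρ (f j) (K.bis (f i) (f i) (f j) + K.bis' (f i) (f i) (f j)))
      - C.ev x (C.ρ (f i) (K.bis (f j) (f i) (f j) + K.bis' (f j) (f i) (f j)))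
      + C.ev x (C.ρ (f i) (K.bis (f j) (f j) (f i) + K.bis' (f j) (f j) (f i)))
      - C.ev x (C.ρ (f j) (K.bis (f i) (f j) (f i) + K.bis' (f i) (f j) (f i)))))
    + 1 / 2 * (∑ m, η i * η j * η m *
      (2 * (β j i m * β i j m) - (h j i m / 2 * β m i j - h j i m / 2 * (h m i j / 2))
        - (h i j m / 2 * β m j i - h i j m / 2 * (h m j i / 2))
        + (β m j i * β m i j - h m j i / 2 * (h m i j / 2))))
    + 1 / 2 * (η i * η j * (κ * ((η i)⁻¹ * E j j - (if i = j then (η i)⁻¹ else 0) * E j i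
      - ((if j = i then (η j)⁻¹ else 0) * E i j - E i i * (η j)⁻¹))))
    + 1 / 2 * (η j * η i * (κ * ((η j)⁻¹ * E i i - (if j = i then (η j)⁻¹ else 0) * E i j
      - ((if i = j then (η i)⁻¹ else 0) * E j i - E j j * (η i)⁻¹))))
    - ∑ m, η i * η j * η m * (β i i m * β j j m) := by
    intro i j
    have hr := hf.riemann_frame e κ i j (β := β) (fun _ _ _ => rfl) (h := h) (fun _ _ _ => rfl)
    simp only [mul_assoc (η i * η j), ← Finset.mul_sum]
    simp only [hf.ρ_P_conn, hf.ρ_tor_self, hf.ρ_tor_self', if_true] at hr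
    simp only [hE]
    linear_combination (η i * η j / 2) * hr
  simp only [key, Finset.sum_add_distrib, Finset.sum_sub_distrib, ← Finset.mul_sum]
  rw [Finset.sum_comm (f := fun i j => η j * η i * (κ * ((η j)⁻¹ * E i i
    - (if j = i then (η j)⁻¹ else 0) * E i j
    - ((if i = j then (η i)⁻¹ else 0) * E j i - E j j * (η i)⁻¹))))]
  rw [q1, q2, q3, metricScalar]
  ring

end IsParallelFrame

/-- Derivatives of `b` stay in `E₊`, orthogonal to `a`, and derivatives of `v` stay in `E₋`,
orthogonal to `w`. Both curvature terms and the trace term vanish. -/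
theorem riemann_mixed {k k' : ι → Γ} {a b v w : Γ} (ha : K.G a = -a) (hv : K.G v = -v)
    (hb : K.G b = b) (hw : K.G w = w) : C.riemann (K.conn e κ) x k k' a b v w = 0 := by
  have hv' : K.flip.G v = v := by rw [flip_G, hv, neg_neg]
  have h1 : ∀ u c, K.G c = c → C.P (K.conn e κ u c) a = 0 := fun u c hc =>
    K.P_eq_zero (K.G_conn e κ u hc) ha
  have h2 : ∀ u c, K.flip.G c = c → C.P (K.conn e κ u c) w = 0 := fun u c hc => by
    have h := K.flip.G_conn e κ u hc
    rw [flip_conn, flip_G, neg_eq_iff_eq_neg] at h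
    exact K.P_eq_zero' h hw
  have h3 : ∀ u c, K.flip.G c = c → K.flip.G (K.conn e κ u c) = K.conn e κ u c := fun u c hc => by
    simpa only [flip_conn] using K.flip.G_conn e κ u hc
  simp only [riemann, map_sub, LinearMap.sub_apply, h1 _ _ hb, h1 _ _ (K.G_conn e κ _ hb),
    h2 _ _ hv', h2 _ _ (h3 _ _ hv')]
  simp

/-- The double trace of the generalised Riemann tensor of the canonical connection. -/
theorem IsParallelFrame.scalar (hf : K.IsParallelFrame x f η)
    (hκ : κ * ((Fintype.card ι : ℝ) - 1) = 1) {ι' : Type*} [Fintype ι'] {k k' : ι' → Γ}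
    (hk : C.IsDualFamily x k k') :
    ∑ i, ∑ j, C.riemann (K.conn e κ) x k k' (k j) (k i) (k' j) (k' i) =
      2 * ∑ j, η j * C.ev x (C.ρ (f j) (C.P (e + K.J e) (f j)))
        - (C.ev x (C.P (K.p e) (K.p e)) + C.ev x (C.P (K.flip.p e) (K.flip.p e))) := by
  have hD := K.conn_isConnection e κ
  have hd := hf.isDualFamily
  rw [scalar_indep hD hk hd]
  have t1 := hf.sum_riemann e κ hκ
  -- The trace over `E₋` is the trace over `E₊` for the exchanged metric; `conn` is symmetric under
  -- the exchange.
  have t2 := hf.flip.sum_riemann e κ hκ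
  rw [metricScalar_flip, flip_conn] at t2
  have hind : ∀ a b v w, C.riemann (K.conn e κ) x (K.flip.frame fun i => K.J (f i))
      (K.flip.coframe (fun i => K.J (f i)) (-η)) a b v w =
      C.riemann (K.conn e κ) x (K.frame f) (K.coframe f η) a b v w :=
    riemann_indep hD hf.flip.isDualFamily hd
  simp only [hind] at t2
  have hs : ∀ (r s : ℝ) (a b v w : Γ), C.riemann (K.conn e κ) x (K.frame f) (K.coframe f η) a b
      (algebraMap ℝ R r • v) (algebraMap ℝ R s • w) =
      r * s * C.riemann (K.conn e κ) x (K.frame f) (K.coframe f η) a b v w := by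
    intro r s a b v w
    rw [(riemann_isTensor_trd hD hd a b _).smul, (riemann_isTensor_fth hD a b v).smul]
    simp only [AlgHom.commutes, Algebra.algebraMap_self, RingHom.id_apply]
    ring
  have m1 : ∀ i j, C.riemann (K.conn e κ) x (K.frame f) (K.coframe f η) (K.J (f j)) (f i)
      (K.J (f j)) (f i) = 0 := fun i j =>
    riemann_mixed e κ (K.G_J_of (hf.G_f j)) (K.G_J_of (hf.G_f j)) (hf.G_f i) (hf.G_f i)
  have m2 : ∀ i j, C.riemann (K.conn e κ) x (K.frame f) (K.coframe f η) (f j) (K.J (f i))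
      (f j) (K.J (f i)) = 0 := fun i j => by
    have hj : K.flip.G (f j) = -f j := by rw [flip_G, hf.G_f]
    have := riemann_mixed (K := K.flip) (x := x) (k := K.frame f) (k' := K.coframe f η) e κ hj hj
      (hf.flip.G_f i) (hf.flip.G_f i)
    rwa [flip_conn] at this
  have n1 : C.ev x (C.P (K.p e) (K.p e)) = ∑ m, η m * C.ev x (C.P e (f m)) ^ 2 := by
    rw [hf.expand _ _ (K.G_p e)]
    refine Finset.sum_congr rfl fun m _ => ?_
    rw [← K.P_p, K.p_eq_self (hf.G_f m), C.P_symm, sq]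
  have n2 : C.ev x (C.P (K.flip.p e) (K.flip.p e)) =
      ∑ m, (-η) m * C.ev x (C.P e (K.J (f m))) ^ 2 := by
    rw [hf.flip.expand _ _ (K.flip.G_p e)]
    refine Finset.sum_congr rfl fun m _ => ?_
    rw [← K.flip.P_p, K.flip.p_eq_self (hf.flip.G_f m), C.P_symm, sq]
  -- The first-order terms of the two halves combine because `f j` and `J (f j)` have the same
  -- anchor and `⟨J e, f j⟩ = -⟨e, J (f j)⟩`.
  have n3 : ∑ j, η j * C.ev x (C.ρ (f j) (C.P (e + K.J e) (f j))) =
      ∑ j, η j * C.ev x (C.ρ (f j) (C.P e (f j)))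
        + ∑ j, (-η) j * C.ev x (C.ρ (K.J (f j)) (C.P e (K.J (f j)))) := by
    rw [← Finset.sum_add_distrib]
    refine Finset.sum_congr rfl fun j _ => ?_
    rw [map_add, LinearMap.add_apply, K.P_J_left, K.ρ_J]
    simp only [map_add, map_neg, Pi.neg_apply]
    ring
  rw [n1, n2, n3]
  simp only [Fintype.sum_sum_type, frame, coframe, Sum.elim_inl, Sum.elim_inr] at hs m1 m2 t1 t2 ⊢
  simp only [hs, m1, m2, mul_zero, Finset.sum_const_zero, add_zero, zero_add]
  simp only [Pi.neg_apply] at t2 ⊢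
  simp only [mul_comm (η _) (η _), neg_mul_neg] at t1 t2 ⊢
  linear_combination t1 + t2

end CourantMetric

/-! ## Smooth functions and smooth sections -/

section Smooth

variable {d : ℕ} {M : Type*} [TopologicalSpace M] [ChartedSpace (EuclideanSpace ℝ (Fin d)) M]

variable (d M) in
/-- The ring of smooth functions. -/
def smoothFunctions : Subalgebra ℝ (M → ℝ) where
  carrier := {f | IsSmoothFunction d f}
  mul_mem' hf hg := ContMDiff.mul hf hg
  add_mem' hf hg := ContMDiff.add hf hg
  algebraMap_mem' _ := contMDiff_const

variable {F : Type*} [NormedAddCommGroup F] [NormedSpace ℝ F] {V : M → Type*}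
  [TopologicalSpace (TotalSpace F V)] [∀ x, TopologicalSpace (V x)]
  [∀ x, AddCommGroup (V x)] [∀ x, Module ℝ (V x)] [FiberBundle F V] [VectorBundle ℝ F V]

variable (d F V) in
/-- The module of smooth sections over the ring of smooth functions. -/
def smoothSections : Submodule (smoothFunctions d M) (Π x, V x) where
  carrier := {s | IsSmoothSection d F s}
  add_mem' hs ht := ContMDiff.add_section hs ht
  zero_mem' := contMDiff_zeroSection ℝ V
  smul_mem' f _ hs := ContMDiff.smul_section f.2 hs

instance : CommRing (smoothFunctions d M) := Subalgebra.toCommRing _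

instance : Algebra ℝ (smoothFunctions d M) := Subalgebra.algebra _

instance : AddCommGroup (smoothSections d F V) := Submodule.addCommGroup _

instance : Module (smoothFunctions d M) (smoothSections d F V) := Submodule.module _

instance : SMul (smoothFunctions d M) (smoothSections d F V) :=
  (Submodule.module (smoothSections d F V)).toSMul

theorem IsSmoothFunction.mdifferentiableAt {f : M → ℝ} (hf : IsSmoothFunction d f) (x : M) :
    MDifferentiableAt (𝓡 d) 𝓘(ℝ, ℝ) f x :=
  (hf x).mdifferentiableAt (by simp)

theorem IsSmoothSection.add {s t : Π x, V x} (hs : IsSmoothSection d F s)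
    (ht : IsSmoothSection d F t) : IsSmoothSection d F (fun x => s x + t x) :=
  ContMDiff.add_section hs ht

theorem IsSmoothSection.sub {s t : Π x, V x} (hs : IsSmoothSection d F s)
    (ht : IsSmoothSection d F t) : IsSmoothSection d F (fun x => s x - t x) :=
  ContMDiff.sub_section hs ht

theorem IsSmoothSection.smul {f : M → ℝ} {s : Π x, V x} (hf : IsSmoothFunction d f)
    (hs : IsSmoothSection d F s) : IsSmoothSection d F (fun x => f x • s x) :=
  ContMDiff.smul_section hf hs

theorem IsSmoothSection.const_smul (c : ℝ) {s : Π x, V x}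
    (hs : IsSmoothSection d F s) : IsSmoothSection d F (fun x => c • s x) :=
  IsSmoothSection.smul (f := fun _ => c) contMDiff_const hs

variable [T2Space M] [IsManifold (𝓡 d) ∞ M]

theorem exists_bump (x : M) {s : Set M} (hs : s ∈ nhds x) :
    ∃ χ : M → ℝ, IsSmoothFunction d χ ∧ χ x = 1 ∧ tsupport χ ⊆ s := by
  obtain ⟨f, -, hf⟩ := (SmoothBumpFunction.nhds_basis_tsupport (I := 𝓡 d) x).mem_iff.1 hs
  exact ⟨f, f.contMDiff, f.eq_one, hf⟩

variable [ContMDiffVectorBundle ∞ F V (𝓡 d)]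

variable (F) in
theorem isSmoothSection_smoothExtension (x : M) (v : V x) :
    IsSmoothSection d F (smoothExtension d F x v) :=
  (exists_smoothSection_eq (d := d) F x v).choose_spec.1

variable (d F) in
theorem smoothExtension_apply (x : M) (v : V x) : smoothExtension d F x v x = v :=
  (exists_smoothSection_eq (d := d) F x v).choose_spec.2

/-- An operation on smooth sections which is tensorial at `x` vanishes on sections which vanish
at `x`. -/
theorem tensorial_eq_zero [FiniteDimensional ℝ F] (x : M) (T : smoothSections d F V → ℝ)
    (hadd : ∀ u v, T (u + v) = T u + T v)
    (hsmul : ∀ (f : smoothFunctions d M) u, T (f • u) = f.1 x * T u) (u : smoothSections d F V)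
    (hu : u.1 x = 0) : T u = 0 := by
  set t := trivializationAt F V x with ht
  have x_mem : x ∈ t.baseSet := FiberBundle.mem_baseSet_trivializationAt F V x
  haveI : ContMDiffVectorBundle 1 F V (𝓡 d) :=
    ContMDiffVectorBundle.of_le (n := ∞) (by exact_mod_cast le_top)
  let b := Module.finBasis ℝ F
  obtain ⟨χ, hχ, hχx, hχs⟩ := exists_bump (d := d) x (t.open_baseSet.mem_nhds x_mem)
  let c : Fin _ → M → ℝ := fun i y => t.localFrameCoeff (𝓡 d) b i y (u.1 y)
  have hc : ∀ i, IsSmoothFunction d (fun y => χ y * c i y) := fun i => by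
    refine contMDiff_of_tsupport fun y hy => ?_
    have hy' : y ∈ t.baseSet := hχs (closure_mono (Function.support_mul_subset_left _ _) hy)
    exact (hχ y).mul (contMDiffAt_localFrameCoeff b hy' (u.2 y) i)
  have hs : ∀ i, IsSmoothSection d F (fun y => χ y • t.localFrame b i y) := fun i =>
    ContMDiffOn.smul_section_of_tsupport hχ.contMDiffOn t.open_baseSet hχs
      (t.contMDiffOn_localFrame_baseSet ∞ b i)
  have h0 : T 0 = 0 := by simpa using hsmul 0 0
  have hsum : ∀ (s : Finset (Fin (Module.finrank ℝ F))) (k : _ → smoothSections d F V),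
      T (∑ i ∈ s, k i) = ∑ i ∈ s, T (k i) := by
    intro s k
    induction s using Finset.induction_on with
    | empty => simpa using h0
    | insert a s ha ih => rw [Finset.sum_insert ha, Finset.sum_insert ha, hadd, ih]
  -- One factor `χ` makes the coefficients global and the other makes the local frame global. At `x`
  -- the factor `χ²` is one and the coefficients vanish with `u`.
  have key : (⟨fun y => χ y * χ y, hχ.mul hχ⟩ : smoothFunctions d M) • u =
      ∑ i, (⟨_, hc i⟩ : smoothFunctions d M) • (⟨_, hs i⟩ : smoothSections d F V) := by
    refine Subtype.ext (funext fun y => ?_)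
    simp only [Submodule.coe_sum, Finset.sum_apply]
    change (χ y * χ y) • u.1 y = ∑ i, (χ y * c i y) • χ y • t.localFrame b i y
    by_cases hy : y ∈ t.baseSet
    · have e := t.eq_sum_localFrameCoeff_smul (I := 𝓡 d) (b := b) (s := u.1) hy
      conv_lhs => rw [e]
      rw [Finset.smul_sum]
      refine Finset.sum_congr rfl fun i _ => ?_
      rw [smul_smul, smul_smul]
      congr 1
      simp only [c]
      ring
    · have : χ y = 0 := by
        by_contra h
        exact hy (hχs (subset_tsupport _ h))
      simp [this]
  have h1 := congrArg T key
  rw [hsmul, hsum] at h1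
  simp only [hsmul, hχx, c, hu, map_zero, mul_zero, zero_mul, Finset.sum_const_zero, one_mul] at h1
  exact h1

end Smooth

/-! ### Smoothness of lifts of vector fields. -/

section Smooth

variable {d : ℕ} {M : Type*} [TopologicalSpace M] [ChartedSpace (EuclideanSpace ℝ (Fin d)) M]

theorem contMDiffAt_det {n : Type*} [Fintype n] [DecidableEq n] {B : M → Matrix n n ℝ} {x : M}
    (hB : ∀ i j, ContMDiffAt (𝓡 d) 𝓘(ℝ, ℝ) ∞ (fun y => B y i j) x) :
    ContMDiffAt (𝓡 d) 𝓘(ℝ, ℝ) ∞ (fun y => (B y).det) x := by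
  simp only [Matrix.det_apply']
  refine contMDiffAt_finsetSum fun τ _ => contMDiffAt_const.mul ?_
  exact contMDiffAt_finsetProd fun i _ => hB _ _

variable [T2Space M] [IsManifold (𝓡 d) ∞ M]
  {F : Type*} [NormedAddCommGroup F] [NormedSpace ℝ F] [FiniteDimensional ℝ F] {E : M → Type*}
  [TopologicalSpace (TotalSpace F E)] [∀ x, TopologicalSpace (E x)]
  [∀ x, AddCommGroup (E x)] [∀ x, Module ℝ (E x)] [FiberBundle F E] [VectorBundle ℝ F E]
  [ContMDiffVectorBundle ∞ F E (𝓡 d)]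

/-- A right inverse `L` of a smooth bundle map to the tangent bundle is smooth if sufficiently many
smooth sections are in the image of `L`. -/
theorem isSmoothSection_lift (q : Π x : M, E x →ₗ[ℝ] TangentSpace (𝓡 d) x)
    (hq : ∀ u : Π x, E x, IsSmoothSection d F u → IsSmoothVectorField (fun x => q x (u x)))
    (L : Π x : M, TangentSpace (𝓡 d) x →ₗ[ℝ] E x) (hqL : ∀ x v, q x (L x v) = v)
    (hL : ∀ x v, ∃ w : Π x, E x, IsSmoothSection d F w ∧ w x = L x v ∧
      ∀ y, L y (q y (w y)) = w y)
    {X : Π x : M, TangentSpace (𝓡 d) x} (hX : IsSmoothVectorField X) :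
    IsSmoothSection d F (fun x => L x (X x)) := by
  intro x
  set t := trivializationAt (EuclideanSpace ℝ (Fin d)) (TangentSpace (𝓡 d) : M → Type _) x with ht
  have x_mem : x ∈ t.baseSet := FiberBundle.mem_baseSet_trivializationAt _ _ x
  haveI : ContMDiffVectorBundle 1 (EuclideanSpace ℝ (Fin d)) (TangentSpace (𝓡 d) : M → Type _)
      (𝓡 d) := ContMDiffVectorBundle.of_le (n := ∞) (by exact_mod_cast le_top)
  let b : Module.Basis (Fin d) ℝ (EuclideanSpace ℝ (Fin d)) :=
    (EuclideanSpace.basisFun (Fin d) ℝ).toBasis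
  -- The matrix `B` of the fields `q (w i)` in the local frame is the identity at `x`, hence
  -- invertible nearby. Cramer's rule then writes `X` in the `q (w i)` with smooth coefficients, and
  -- applying `L` replaces each `q (w i)` by the smooth section `w i`.
  choose w hw hwx hLw using fun i => hL x (t.localFrame b i x)
  let B : M → Matrix (Fin d) (Fin d) ℝ :=
    fun y k i => t.localFrameCoeff (𝓡 d) b k y (q y (w i y))
  let a : M → Fin d → ℝ := fun y k => t.localFrameCoeff (𝓡 d) b k y (X y)
  have hB : ∀ k i, ContMDiffAt (𝓡 d) 𝓘(ℝ, ℝ) ∞ (fun y => B y k i) x := fun k i =>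
    contMDiffAt_localFrameCoeff b x_mem (hq _ (hw i) x) k
  have ha : ∀ k, ContMDiffAt (𝓡 d) 𝓘(ℝ, ℝ) ∞ (fun y => a y k) x := fun k =>
    contMDiffAt_localFrameCoeff b x_mem (hX x) k
  have hBx : B x = 1 := by
    ext k i
    simp only [B, hwx, hqL]
    rw [t.localFrameCoeff_apply_of_mem_baseSet b x_mem (t.localFrame b i) k,
      t.localFrame_apply_of_mem_baseSet b x_mem, Module.Basis.repr_self, Matrix.one_apply,
      Finsupp.single_apply]
    simp only [eq_comm]
  have hdet := contMDiffAt_det hB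
  have hdetx : (B x).det ≠ 0 := by rw [hBx, Matrix.det_one]; exact one_ne_zero
  have hc : ∀ i, ContMDiffAt (𝓡 d) 𝓘(ℝ, ℝ) ∞
      (fun y => (B y).cramer (a y) i * ((B y).det)⁻¹) x := fun i => by
    refine ContMDiffAt.mul ?_ (hdet.inv₀ hdetx)
    simp only [Matrix.cramer_apply]
    refine contMDiffAt_det fun k j => ?_
    simp only [Matrix.updateCol_apply]
    split_ifs
    · exact ha k
    · exact hB k j
  have hsum : ContMDiffAt (𝓡 d) ((𝓡 d).prod 𝓘(ℝ, F)) ∞ (fun y => TotalSpace.mk' F y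
      (∑ i, ((B y).cramer (a y) i * ((B y).det)⁻¹) • w i y)) x :=
    ContMDiffAt.sum_section fun i _ => (hc i).smul_section (hw i x)
  refine hsum.congr_of_eventuallyEq ?_
  filter_upwards [t.open_baseSet.mem_nhds x_mem, hdet.continuousAt.eventually_ne hdetx]
    with y hy hdy
  congr 1
  have hX' : X y = ∑ i, ((B y).cramer (a y) i * ((B y).det)⁻¹) • q y (w i y) := by
    have e1 := t.eq_sum_localFrameCoeff_smul (I := 𝓡 d) (b := b) (s := X) hy
    have e2 := fun i => t.eq_sum_localFrameCoeff_smul (I := 𝓡 d) (b := b)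
      (s := fun y => q y (w i y)) hy
    have e3 : ∀ k, a y k = ∑ i, B y k i * ((B y).cramer (a y) i * ((B y).det)⁻¹) := fun k => by
      have := congrFun (Matrix.mulVec_cramer (B y) (a y)) k
      simp only [Matrix.mulVec, dotProduct, Pi.smul_apply, smul_eq_mul] at this
      simp only [← mul_assoc, ← Finset.sum_mul, this]
      field_simp
    rw [e1]
    conv_rhs => rw [Finset.sum_congr rfl fun i _ => congrArg _ (e2 i)]
    simp only [Finset.smul_sum, smul_smul]
    rw [Finset.sum_comm]
    refine Finset.sum_congr rfl fun k _ => ?_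
    rw [← Finset.sum_smul]
    congr 1
    refine (e3 k).trans (Finset.sum_congr rfl fun i _ => mul_comm _ _)
  rw [hX', map_sum]
  simp only [map_smul, hLw]

end Smooth

/-! ### The Courant module of an exact Courant algebroid. -/

section Courant

variable {d : ℕ} {M : Type*} [TopologicalSpace M] [T2Space M]
  [ChartedSpace (EuclideanSpace ℝ (Fin d)) M] [IsManifold (𝓡 d) ∞ M]
  {F : Type*} [NormedAddCommGroup F] [NormedSpace ℝ F] [FiniteDimensional ℝ F] {E : M → Type*}
  [TopologicalSpace (TotalSpace F E)] [∀ x, TopologicalSpace (E x)]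
  [∀ x, AddCommGroup (E x)] [∀ x, Module ℝ (E x)] [FiberBundle F E] [VectorBundle ℝ F E]
  [ContMDiffVectorBundle ∞ F E (𝓡 d)]

namespace ExactCourantAlgebroid

variable (A : ExactCourantAlgebroid d F E)

theorem eq_of_pairing {x : M} {u v : E x}
    (h : ∀ w : Π y, E y, IsSmoothSection d F w → A.pairing x u (w x) = A.pairing x v (w x)) :
    u = v := by
  rw [← sub_eq_zero]
  refine (A.pairing_nondegenerate x).1 _ fun w => ?_
  have := h _ (isSmoothSection_smoothExtension F x w)
  rw [smoothExtension_apply] at this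
  rw [map_sub, LinearMap.sub_apply, this, sub_self]

/-- By the Leibniz rule `[u, f v] - f [u, v] = (π(u) f) v` is smooth. Pairing with a smooth `w` and
dividing by `⟨v, w⟩`, nonzero near the point, isolates `π(u) f`. -/
theorem isSmoothFunction_derivative {u : Π x, E x} (hu : IsSmoothSection d F u) {f : M → ℝ}
    (hf : IsSmoothFunction d f) :
    IsSmoothFunction d (fun x => mvfderiv (𝓡 d) f x (A.anchor x (u x))) := by
  rcases Nat.eq_zero_or_pos d with hd | hd
  · haveI : IsEmpty (Fin d) := by rw [hd]; infer_instance
    have : ∀ (x : M) (v : TangentSpace (𝓡 d) x), v = 0 := fun x v =>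
      Subsingleton.elim (α := EuclideanSpace ℝ (Fin d)) v 0
    simp only [this _ (A.anchor _ _), map_zero]
    exact contMDiff_const
  intro x
  -- For `d > 0` surjectivity of the anchor provides a nonzero vector in the fibre.
  obtain ⟨w, hw⟩ := A.anchor_surjective x (EuclideanSpace.single (⟨0, hd⟩ : Fin d) (1 : ℝ))
  have hw0 : w ≠ 0 := by
    rintro rfl
    rw [map_zero] at hw
    have := congrArg (fun v : EuclideanSpace ℝ (Fin d) => v ⟨0, hd⟩) hw
    simp at this
    exact zero_ne_one this
  obtain ⟨v, hv⟩ : ∃ v, A.pairing x v w ≠ 0 := by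
    by_contra! h
    exact hw0 ((A.pairing_nondegenerate x).2 w h)
  set v' := smoothExtension d F x v
  set w' := smoothExtension d F x w
  have hv' : IsSmoothSection d F v' := isSmoothSection_smoothExtension F x v
  have hw' : IsSmoothSection d F w' := isSmoothSection_smoothExtension F x w
  have h1 := A.smooth_bracket u _ hu (hv'.smul hf)
  have h2 := h1.sub ((A.smooth_bracket u v' hu hv').smul hf)
  have h3 := A.smooth_pairing _ _ h2 hw' x
  have h4 := A.smooth_pairing _ _ hv' hw' x
  have h5 : A.pairing x (v' x) (w' x) ≠ 0 := by
    simpa only [v', w', smoothExtension_apply] using hv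
  refine (h3.mul (h4.inv₀ h5)).congr_of_eventuallyEq ?_
  filter_upwards [h4.continuousAt.eventually_ne h5] with y hy
  simp only [A.bracket_leibniz u v' f hu hv' hf, add_sub_cancel_left, map_smul,
    LinearMap.smul_apply, smul_eq_mul]
  exact (mul_inv_cancel_right₀ hy _).symm

theorem pairing_ker {x : M} {u v : E x} (hu : A.anchor x u = 0) (hv : A.anchor x v = 0) :
    A.pairing x u v = 0 := by
  obtain ⟨ξ, hξ⟩ := (A.anchor_eq_zero_iff x u).1 hu
  rw [hξ, hv, map_zero]

/-- By invariance `⟨[u, v], w⟩ = -⟨v, [u, w]⟩`. Here `π [u, w] = [0, π w] = 0`, and `ker π` is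
isotropic. -/
theorem bracket_ker {u v : Π x, E x} (hu : IsSmoothSection d F u) (hv : IsSmoothSection d F v)
    (hu0 : ∀ x, A.anchor x (u x) = 0) (hv0 : ∀ x, A.anchor x (v x) = 0) :
    A.bracket u v = 0 := by
  funext x
  refine A.eq_of_pairing fun w hw => ?_
  have h1 := A.pairing_invariant u v w hu hv hw x
  have h2 := A.anchor_bracket u w hu hw x
  have h3 : (fun y => A.anchor y (u y)) = 0 := funext hu0
  rw [h3, VectorField.mlieBracket_zero_left] at h2
  rw [hu0, map_zero, A.pairing_ker (hv0 x) h2] at h1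
  simp only [Pi.zero_apply, map_zero, LinearMap.zero_apply]
  linarith

/-- Compare the Jacobi identity for `u, v, f w` with `f` times the one for `u, v, w`: what is left
is the claim times `w`. If the fibre is zero, so is the tangent space. -/
theorem derivative_bracket {u v : Π x, E x} (hu : IsSmoothSection d F u)
    (hv : IsSmoothSection d F v) {f : M → ℝ} (hf : IsSmoothFunction d f) (x : M) :
    mvfderiv (𝓡 d) f x (A.anchor x (A.bracket u v x)) =
      mvfderiv (𝓡 d) (fun y => mvfderiv (𝓡 d) f y (A.anchor y (v y))) x (A.anchor x (u x))
      - mvfderiv (𝓡 d) (fun y => mvfderiv (𝓡 d) f y (A.anchor y (u y))) x (A.anchor x (v x)) := by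
  by_cases hE : ∃ w : E x, w ≠ 0
  · obtain ⟨w₀, hw₀⟩ := hE
    set w := smoothExtension d F x w₀
    have hw : IsSmoothSection d F w := isSmoothSection_smoothExtension F x w₀
    have hwx : w x = w₀ := smoothExtension_apply d F x w₀
    have hfw := hw.smul hf
    have huf := A.isSmoothFunction_derivative hu hf
    have hvf := A.isSmoothFunction_derivative hv hf
    have huv := A.smooth_bracket u v hu hv
    have huw := A.smooth_bracket u w hu hw
    have hvw := A.smooth_bracket v w hv hw
    have j1 := congrFun (A.bracket_jacobi u v w hu hv hw) x
    have j2 := congrFun (A.bracket_jacobi u v _ hu hv hfw) x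
    have e1 : ∀ {u : Π x, E x}, IsSmoothSection d F u → A.bracket u (fun y => f y • w y) =
        (fun y => f y • A.bracket u w y)
          + fun y => mvfderiv (𝓡 d) f y (A.anchor y (u y)) • w y := fun hu =>
      funext fun y => A.bracket_leibniz _ w f hu hw hf y
    rw [e1 hv, e1 hu, A.bracket_add_right _ _ _ hu (hvw.smul hf) (hw.smul hvf),
      A.bracket_add_right _ _ _ hv (huw.smul hf) (hw.smul huf), e1 huv] at j2
    simp only [Pi.add_apply] at j1 j2
    rw [A.bracket_leibniz u _ f hu hvw hf, A.bracket_leibniz v _ f hv huw hf,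
      A.bracket_leibniz u w _ hu hw hvf, A.bracket_leibniz v w _ hv hw huf, j1] at j2
    rw [← sub_eq_zero]
    refine (smul_eq_zero.1 ?_).resolve_right (hwx ▸ hw₀ : w x ≠ 0)
    simp only [sub_smul]
    rw [← sub_eq_zero] at j2
    refine Eq.trans ?_ (neg_eq_zero.2 j2)
    module
  · push Not at hE
    have : ∀ v : TangentSpace (𝓡 d) x, v = 0 := fun v => by
      obtain ⟨w, rfl⟩ := A.anchor_surjective x v
      rw [hE w, map_zero]
    simp [this (A.anchor x _)]

/-- The scalar product as an operation on smooth sections. -/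
def pairingSections : smoothSections d F E →ₗ[smoothFunctions d M]
    smoothSections d F E →ₗ[smoothFunctions d M] smoothFunctions d M :=
  LinearMap.mk₂ (smoothFunctions d M)
    (fun u v => ⟨fun x => A.pairing x (u.1 x) (v.1 x), A.smooth_pairing u.1 v.1 u.2 v.2⟩)
    (fun u u' v => Subtype.ext (funext fun x =>
      LinearMap.congr_fun (map_add (A.pairing x) (u.1 x) (u'.1 x)) (v.1 x)))
    (fun f u v => Subtype.ext (funext fun x =>
      LinearMap.congr_fun (map_smul (A.pairing x) (f.1 x) (u.1 x)) (v.1 x)))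
    (fun u v v' => Subtype.ext (funext fun x => map_add (A.pairing x (u.1 x)) (v.1 x) (v'.1 x)))
    (fun f u v => Subtype.ext (funext fun x => map_smul (A.pairing x (u.1 x)) (f.1 x) (v.1 x)))

/-- The derivation of the ring of smooth functions defined by a smooth section. -/
def derivationOfSection (u : smoothSections d F E) :
    Derivation ℝ (smoothFunctions d M) (smoothFunctions d M) :=
  Derivation.mk'
    { toFun := fun f => ⟨fun x => mvfderiv (𝓡 d) f.1 x (A.anchor x (u.1 x)),
        A.isSmoothFunction_derivative u.2 f.2⟩
      map_add' := fun f g => Subtype.ext (funext fun x => congrArg (fun L => L (A.anchor x (u.1 x)))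
        (mvfderiv_add (f.2.mdifferentiableAt x) (g.2.mdifferentiableAt x)))
      map_smul' := fun c f => Subtype.ext (funext fun x => by
        have h := mvfderiv_mul (I := 𝓡 d) (x := x) (f := fun _ => c) mdifferentiableAt_const
          (f.2.mdifferentiableAt x)
        rw [mvfderiv_const, smul_zero, add_zero] at h
        exact congrArg (fun L => L (A.anchor x (u.1 x))) h) }
    fun f g => Subtype.ext (funext fun x => congrArg (fun L => L (A.anchor x (u.1 x)))
        (mvfderiv_mul (f.2.mdifferentiableAt x) (g.2.mdifferentiableAt x)))

/-- The anchor as an operation on smooth sections. -/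
def anchorSections : smoothSections d F E →ₗ[smoothFunctions d M]
    Derivation ℝ (smoothFunctions d M) (smoothFunctions d M) where
  toFun u := A.derivationOfSection u
  map_add' u v := Derivation.ext fun f => Subtype.ext (funext fun x =>
    (congrArg (mvfderiv (𝓡 d) f.1 x) (map_add (A.anchor x) (u.1 x) (v.1 x))).trans
      (map_add (mvfderiv (𝓡 d) f.1 x) _ _))
  map_smul' g u := Derivation.ext fun f => Subtype.ext (funext fun x =>
    (congrArg (mvfderiv (𝓡 d) f.1 x) (map_smul (A.anchor x) (g.1 x) (u.1 x))).trans
      (map_smul (mvfderiv (𝓡 d) f.1 x) _ _))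

/-- The bracket as an operation on smooth sections. -/
def bracketSections (u v : smoothSections d F E) : smoothSections d F E :=
  ⟨_, A.smooth_bracket u.1 v.1 u.2 v.2⟩

theorem eq_zero_of_pairingSections {u : smoothSections d F E} {x : M}
    (h : ∀ w, (A.pairingSections u w).1 x = 0) : u.1 x = 0 :=
  A.eq_of_pairing fun w hw => (h ⟨w, hw⟩).trans (by simp)

/-- The Courant module of smooth sections of an exact Courant algebroid. -/
def courantModule : CourantModule M (smoothFunctions d M) (smoothSections d F E) where
  ev x := (Pi.evalAlgHom ℝ (fun _ : M => ℝ) x).comp (smoothFunctions d M).val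
  ext_ev f g h := Subtype.ext (funext h)
  P := A.pairingSections
  P_symm u v := Subtype.ext (funext fun x => A.pairing_symm x _ _)
  P_nondeg u h := Subtype.ext (funext fun x => A.eq_zero_of_pairingSections fun w =>
    congrFun (congrArg Subtype.val (h w)) x)
  tensor_zero x T hadd hsmul u hu := tensorial_eq_zero x T hadd hsmul u
    (A.eq_zero_of_pairingSections hu)
  ρ := A.anchorSections
  br := A.bracketSections
  br_add_left u v w := Subtype.ext (A.bracket_add_left u.1 v.1 w.1 u.2 v.2 w.2)
  br_add_right u v w := Subtype.ext (A.bracket_add_right u.1 v.1 w.1 u.2 v.2 w.2)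
  br_smul u f v := Subtype.ext (funext fun x => A.bracket_leibniz u.1 v.1 f.1 u.2 v.2 f.2 x)
  ρ_br u v f := Subtype.ext (funext fun x => A.derivative_bracket u.2 v.2 f.2 x)
  P_inv u v w := Subtype.ext (funext fun x => A.pairing_invariant u.1 v.1 w.1 u.2 v.2 w.2 x)
  P_br_symm u v w := Subtype.ext (funext fun x =>
    A.bracket_symmetric_part u.1 v.1 w.1 u.2 v.2 w.2 x)

end ExactCourantAlgebroid

end Courant

/-! ### The reflection defined by a generalised metric. -/

section Courant

variable {d : ℕ} {M : Type*} [TopologicalSpace M]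
  [ChartedSpace (EuclideanSpace ℝ (Fin d)) M] [IsManifold (𝓡 d) ∞ M]
  {F : Type*} [NormedAddCommGroup F] [NormedSpace ℝ F] [FiniteDimensional ℝ F] {E : M → Type*}
  [TopologicalSpace (TotalSpace F E)] [∀ x, TopologicalSpace (E x)]
  [∀ x, AddCommGroup (E x)] [∀ x, Module ℝ (E x)] [FiberBundle F E] [VectorBundle ℝ F E]
  {A : ExactCourantAlgebroid d F E}

namespace GeneralisedMetric

variable (G : GeneralisedMetric A)

theorem splitting_anchor_of_horizontal {x : M} {u : E x} (hu : u ∈ G.horizontal x) :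
    G.splitting x (A.anchor x u) = u :=
  congrArg Subtype.val ((LinearEquiv.ofBijective _ (G.anchor_horizontal_bijective x)).symm_apply_apply
    ⟨u, hu⟩)

theorem splitting_mem_horizontal (x : M) (v : TangentSpace (𝓡 d) x) :
    G.splitting x v ∈ G.horizontal x :=
  Subtype.coe_prop _

theorem pairing_splitting (x : M) (v w : TangentSpace (𝓡 d) x) :
    A.pairing x (G.splitting x v) (G.splitting x w) = 0 := by
  have h := G.splitting_mem_horizontal x v _ (G.anchor_endo_splitting x w)
  change A.pairing x (G.endo x _) (G.endo x _) = 0 at h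
  rwa [← G.endo_symm, G.endo_endo] at h

theorem splitting_anchor_endo {x : M} {u : E x} (hu : A.anchor x u = 0) :
    G.splitting x (A.anchor x (G.endo x u)) = G.endo x u := by
  refine G.splitting_anchor_of_horizontal fun z hz => ?_
  change A.pairing x (G.endo x (G.endo x u)) z = 0
  obtain ⟨ξ, hξ⟩ := (A.anchor_eq_zero_iff x u).1 hu
  rw [G.endo_endo, hξ, hz, map_zero]

/-- The reflection of `E x` which fixes the image of the splitting and is `-1` on `ker π`. -/
def reflection (x : M) : E x →ₗ[ℝ] E x :=
  (2 : ℝ) • (G.splitting x ∘ₗ A.anchor x) - LinearMap.id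

theorem reflection_apply (x : M) (u : E x) :
    G.reflection x u = (2 : ℝ) • G.splitting x (A.anchor x u) - u := rfl

theorem anchor_reflection (x : M) (u : E x) : A.anchor x (G.reflection x u) = A.anchor x u := by
  rw [reflection_apply, map_sub, map_smul, G.anchor_splitting, two_smul, add_sub_cancel_right]

theorem reflection_reflection (x : M) (u : E x) : G.reflection x (G.reflection x u) = u := by
  rw [reflection_apply, anchor_reflection, reflection_apply, sub_sub_cancel]

/-- The involution exchanges `ker π` and the image of `σ`, on which the reflection is `-1` and `1`.
-/
theorem endo_reflection (x : M) (u : E x) :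
    G.endo x (G.reflection x u) = -G.reflection x (G.endo x u) := by
  have h1 := G.splitting_anchor_endo (x := x) (u := u - G.splitting x (A.anchor x u))
    (by rw [map_sub, G.anchor_splitting, sub_self])
  have h2 := G.anchor_endo_splitting x (A.anchor x u)
  simp only [map_sub, h2, map_zero, sub_zero] at h1
  rw [reflection_apply, reflection_apply, map_sub, map_smul, h1]
  module

theorem anchor_sub_splitting (x : M) (u : E x) :
    A.anchor x (u - G.splitting x (A.anchor x u)) = 0 := by
  rw [map_sub, G.anchor_splitting, sub_self]

/-- Both `ker π` and the image of `σ` are isotropic, so the scalar product only couples the two, and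
there the reflection produces one minus sign. -/
theorem pairing_reflection (x : M) (u v : E x) :
    A.pairing x (G.reflection x u) (G.reflection x v) = -A.pairing x u v := by
  have h1 := G.pairing_splitting x (A.anchor x u) (A.anchor x v)
  have h2 : A.pairing x (u - G.splitting x (A.anchor x u)) (v - G.splitting x (A.anchor x v)) = 0 := by
    obtain ⟨ξ, hξ⟩ := (A.anchor_eq_zero_iff x _).1 (G.anchor_sub_splitting x u)
    rw [hξ, G.anchor_sub_splitting, map_zero]
  simp only [reflection_apply, map_sub, map_smul, LinearMap.sub_apply, LinearMap.smul_apply,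
    smul_eq_mul, h1] at h2 ⊢
  linear_combination 2 * h2

theorem liftMinus_anchor (x : M) (u : E x) (hu : G.endo x u = -u) :
    G.liftMinus x (A.anchor x u) = u := by
  rw [← sub_eq_zero]
  set z := G.liftMinus x (A.anchor x u) - u with hz
  have hz0 : A.anchor x z = 0 := by rw [hz, map_sub, G.anchor_liftMinus, sub_self]
  have hzG : G.endo x z = -z := by rw [hz, map_sub, G.endo_liftMinus, hu, neg_sub_neg, neg_sub]
  refine G.nondegenerate_ker x z hz0 fun v hv => ?_
  obtain ⟨ξ, hξ⟩ := (A.anchor_eq_zero_iff x z).1 hz0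
  rw [hzG, map_neg, LinearMap.neg_apply, hξ, hv, map_zero, neg_zero]

theorem endo_plus (u : Π x, E x) (x : M) : G.endo x (G.plus u x) = G.plus u x := by
  simp only [plus, map_smul, map_add, G.endo_endo, add_comm]

theorem endo_minus (u : Π x, E x) (x : M) : G.endo x (G.minus u x) = -G.minus u x := by
  simp only [minus, map_smul, map_sub, G.endo_endo, ← smul_neg, neg_sub]

theorem plus_of_endo {u : Π x, E x} {x : M} (hu : G.endo x (u x) = u x) : G.plus u x = u x := by
  rw [plus, hu]
  module

theorem minus_of_endo {u : Π x, E x} {x : M} (hu : G.endo x (u x) = -u x) :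
    G.minus u x = u x := by
  rw [minus, hu]
  module

theorem isSmoothSection_plus {u : Π x, E x} (hu : IsSmoothSection d F u) :
    IsSmoothSection d F (G.plus u) :=
  (hu.add (G.smooth_endo u hu)).const_smul _

theorem isSmoothSection_minus {u : Π x, E x} (hu : IsSmoothSection d F u) :
    IsSmoothSection d F (G.minus u) :=
  (hu.sub (G.smooth_endo u hu)).const_smul _

variable [T2Space M] [ContMDiffVectorBundle ∞ F E (𝓡 d)]

theorem isSmoothSection_liftPlus {X : Π x : M, TangentSpace (𝓡 d) x} (hX : IsSmoothVectorField X) :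
    IsSmoothSection d F (fun x => G.liftPlus x (X x)) := by
  refine isSmoothSection_lift A.anchor A.smooth_anchor G.liftPlus G.anchor_liftPlus
    (fun x v => ⟨G.plus (smoothExtension d F x (G.liftPlus x v)),
      G.isSmoothSection_plus (isSmoothSection_smoothExtension F x _), ?_, fun y =>
      G.liftPlus_anchor y _ (G.endo_plus _ y)⟩) hX
  rw [G.plus_of_endo (by rw [smoothExtension_apply, G.endo_liftPlus]), smoothExtension_apply]

theorem isSmoothSection_liftMinus {X : Π x : M, TangentSpace (𝓡 d) x}
    (hX : IsSmoothVectorField X) : IsSmoothSection d F (fun x => G.liftMinus x (X x)) := by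
  refine isSmoothSection_lift A.anchor A.smooth_anchor G.liftMinus G.anchor_liftMinus
    (fun x v => ⟨G.minus (smoothExtension d F x (G.liftMinus x v)),
      G.isSmoothSection_minus (isSmoothSection_smoothExtension F x _), ?_, fun y =>
      G.liftMinus_anchor y _ (G.endo_minus _ y)⟩) hX
  rw [G.minus_of_endo (by rw [smoothExtension_apply, G.endo_liftMinus]), smoothExtension_apply]

theorem isSmoothSection_splitting {X : Π x : M, TangentSpace (𝓡 d) x}
    (hX : IsSmoothVectorField X) : IsSmoothSection d F (fun x => G.splitting x (X x)) := by
  have h := ((G.isSmoothSection_liftPlus hX).add (G.isSmoothSection_liftMinus hX)).const_smul (1 / 2)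
  convert h using 2 with x
  simp only [liftPlus, liftMinus, LinearMap.add_apply, LinearMap.sub_apply]
  module

theorem isSmoothSection_reflection {u : Π x, E x} (hu : IsSmoothSection d F u) :
    IsSmoothSection d F (fun x => G.reflection x (u x)) :=
  ((G.isSmoothSection_splitting (A.smooth_anchor u hu)).const_smul 2).sub hu

/-- The endomorphism `𝒢ᵉⁿᵈ` as an operation on smooth sections. -/
def endoSections : smoothSections d F E →ₗ[smoothFunctions d M] smoothSections d F E where
  toFun u := ⟨_, G.smooth_endo u.1 u.2⟩
  map_add' u v := Subtype.ext (funext fun x => map_add (G.endo x) (u.1 x) (v.1 x))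
  map_smul' f u := Subtype.ext (funext fun x => map_smul (G.endo x) (f.1 x) (u.1 x))

/-- The reflection as an operation on smooth sections. -/
def reflectionSections : smoothSections d F E →ₗ[smoothFunctions d M] smoothSections d F E where
  toFun u := ⟨_, G.isSmoothSection_reflection u.2⟩
  map_add' u v := Subtype.ext (funext fun x => map_add (G.reflection x) (u.1 x) (v.1 x))
  map_smul' f u := Subtype.ext (funext fun x => map_smul (G.reflection x) (f.1 x) (u.1 x))

theorem anchor_sub_reflection (x : M) (u : E x) : A.anchor x (u - G.reflection x u) = 0 := by
  rw [map_sub, anchor_reflection, sub_self]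

/-- The generalised metric on the Courant module of smooth sections. -/
def courantMetric : CourantMetric A.courantModule where
  G := G.endoSections
  J := G.reflectionSections
  G_G u := Subtype.ext (funext fun x => G.endo_endo x _)
  P_G u v := Subtype.ext (funext fun x => G.endo_symm x _ _)
  J_J u := Subtype.ext (funext fun x => G.reflection_reflection x _)
  G_J u := Subtype.ext (funext fun x => G.endo_reflection x _)
  P_J u v := Subtype.ext (funext fun x => G.pairing_reflection x _ _)
  ρ_J u := Derivation.ext fun f => Subtype.ext (funext fun x =>
    congrArg (mvfderiv (𝓡 d) f.1 x) (G.anchor_reflection x (u.1 x)))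
  br_ker u v := Subtype.ext (A.bracket_ker (u - G.reflectionSections u).2
    (v - G.reflectionSections v).2 (fun x => G.anchor_sub_reflection x _)
    fun x => G.anchor_sub_reflection x _)

end GeneralisedMetric

end Courant

/-! ### The Levi-Civita connection and the three-form in terms of the bracket. -/

namespace CourantMetric

variable {M R Γ : Type*} [CommRing R] [Algebra ℝ R] [AddCommGroup Γ] [Module R Γ]
  {C : CourantModule M R Γ} (K : CourantMetric C) {a b c : Γ}

theorem P_br_swap_J (ha : K.G a = a) (hb : K.G b = b) (c : Γ) :
    C.P (C.br a (K.J b)) c = -C.P (C.br (K.J b) a) c :=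
  C.P_br_swap (K.P_eq_zero ha (K.G_J_of hb)) c

/-- Since `a + J a = 2 σ π a`, the left side is `8 ⟨[σ, σ], σ⟩ = 4 H`; this identifies `tor` with
`H`. -/
theorem P_br_add_J (ha : K.G a = a) (hb : K.G b = b) (hc : K.G c = c) :
    C.P (C.br (a + K.J a) (b + K.J b)) (c + K.J c) = 4 * K.tor a b c := by
  have fa := K.flip_G_J ha
  have fb := K.flip_G_J hb
  have fc := K.flip_G_J hc
  have h1 := K.P_br ha hb hc
  have h2 := K.P_br_J ha hb hc
  have h3 := K.flip.P_br fa fb fc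
  have h4 := K.flip.P_br_J fa fb fc
  have h5 := K.P_br_swap_J ha hb c
  have h6 := K.P_br_swap_J hb ha (K.J c)
  have h7 := K.tor_skew_left ha hb hc
  simp only [flip_bis, flip_bis', flip_J, K.J_J] at h3 h4
  simp only [C.br_add_left, C.br_add_right, map_add, LinearMap.add_apply, h1, h2, h3, h4, h5]
  simp only [tor, bis, bis'] at h6 h7 ⊢
  linear_combination h6 - 2 * h7

theorem P_p_of (u : Γ) (hc : K.G c = c) : C.P (K.p u) c = C.P u c := by
  rw [K.P_p, K.p_eq_self hc]

theorem P_J_flip_p_of (u : Γ) (hc : K.G c = c) :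
    C.P (K.J (K.flip.p u)) c = -C.P u (K.J c) := by
  rw [K.P_J_left, K.flip.P_p, K.flip.p_eq_self (K.flip_G_J hc)]

theorem G_flip_p (u : Γ) : K.G (K.flip.p u) = -K.flip.p u := by
  have := K.flip.G_p u
  rwa [flip_G, neg_eq_iff_eq_neg] at this

theorem G_J_of_neg {u : Γ} (hu : K.G u = -u) : K.G (K.J u) = K.J u := by
  rw [K.G_J, hu, map_neg, neg_neg]

theorem G_J_flip_p (u : Γ) : K.G (K.J (K.flip.p u)) = K.J (K.flip.p u) :=
  K.G_J_of_neg (K.G_flip_p u)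

theorem P_add_J_br (ha : K.G a = a) (hb : K.G b = b) (c : Γ) :
    C.P (C.br (K.J a) b + K.J (C.br (K.J a) b)) c = K.bis a b c - K.bis' b a c := by
  rw [map_add, LinearMap.add_apply, K.P_J_left, bis, bis']
  linear_combination -K.P_br_swap_J hb ha (K.J c)

end CourantMetric

theorem sum_smul_dualBasis {V ι : Type*} [AddCommGroup V] [Module ℝ V] [Fintype ι] [DecidableEq ι]
    {B : LinearMap.BilinForm ℝ V} (hB : B.Nondegenerate) (b : Module.Basis ι ℝ V) (v : V) :
    ∑ i, B v (b i) • B.dualBasis hB b i = v := by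
  conv_rhs => rw [← (B.dualBasis hB b).sum_repr v]
  simp only [LinearMap.BilinForm.dualBasis_repr_apply]

section Courant

variable {d : ℕ} {M : Type*} [TopologicalSpace M] [T2Space M]
  [ChartedSpace (EuclideanSpace ℝ (Fin d)) M] [IsManifold (𝓡 d) ∞ M]
  {F : Type*} [NormedAddCommGroup F] [NormedSpace ℝ F] [FiniteDimensional ℝ F] {E : M → Type*}
  [TopologicalSpace (TotalSpace F E)] [∀ x, TopologicalSpace (E x)]
  [∀ x, AddCommGroup (E x)] [∀ x, Module ℝ (E x)] [FiberBundle F E] [VectorBundle ℝ F E]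
  [ContMDiffVectorBundle ∞ F E (𝓡 d)]
  {A : ExactCourantAlgebroid d F E}

variable (A) in
/-- The vector field underlying a smooth section. -/
def anchorField (u : smoothSections d F E) (x : M) : TangentSpace (𝓡 d) x := A.anchor x (u.1 x)

namespace GeneralisedMetric

variable (G : GeneralisedMetric A)

theorem courantMetric_flip_p (u : smoothSections d F E) :
    (G.courantMetric.flip.p u).1 = G.minus u.1 := by
  funext x
  rw [minus, sub_eq_add_neg]
  rfl

theorem anchorField_J (u : smoothSections d F E) :
    anchorField A (G.courantMetric.J u) = anchorField A u :=
  funext fun x => G.anchor_reflection x (u.1 x)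

theorem endo_of_G {u : smoothSections d F E} (hu : G.courantMetric.G u = u) (x : M) :
    G.endo x (u.1 x) = u.1 x :=
  congrFun (congrArg Subtype.val hu) x

theorem metric_anchor_plus {x : M} {u c : E x} (hu : G.endo x u = u) (hc : G.endo x c = c) :
    G.metric x (A.anchor x u) (A.anchor x c) = A.pairing x u c := by
  change A.pairing x (G.endo x (G.liftPlus x _)) (G.liftPlus x _) = _
  rw [G.liftPlus_anchor x u hu, G.liftPlus_anchor x c hc, hu]

theorem metric_anchor {x : M} (u : E x) {c : E x} (hc : G.endo x c = c) :
    G.metric x (A.anchor x u) (A.anchor x c) = A.pairing x (u + G.reflection x u) c := by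
  change A.pairing x (G.endo x (G.liftPlus x _)) (G.liftPlus x _) = _
  rw [G.liftPlus_anchor x c hc, G.endo_liftPlus, liftPlus, LinearMap.add_apply, map_add,
    LinearMap.add_apply, LinearMap.comp_apply, G.endo_symm, hc, reflection_apply,
    add_sub_cancel, map_smul, LinearMap.smul_apply, smul_eq_mul, two_mul]

theorem metric_anchorField {a b : smoothSections d F E} (ha : G.courantMetric.G a = a)
    (hb : G.courantMetric.G b = b) (x : M) :
    G.metric x (anchorField A a x) (anchorField A b x) = (A.courantModule.P a b).1 x :=
  G.metric_anchor_plus (G.endo_of_G ha x) (G.endo_of_G hb x)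

theorem metric_anchorField_right (u : smoothSections d F E) {c : smoothSections d F E}
    (hc : G.courantMetric.G c = c) (x : M) :
    G.metric x (anchorField A u x) (anchorField A c x) =
      (A.courantModule.P (u + G.courantMetric.J u) c).1 x :=
  G.metric_anchor _ (G.endo_of_G hc x)

theorem anchorField_br (u v : smoothSections d F E) (x : M) :
    anchorField A (A.courantModule.br u v) x =
      VectorField.mlieBracket (𝓡 d) (anchorField A u) (anchorField A v) x :=
  A.anchor_bracket u.1 v.1 u.2 v.2 x

variable {a b c : smoothSections d F E}

/-- The section `[J a, b]` also lies over `[π a, π b]`, and its pairings with `E₊` and `E₋` are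
coefficients of `bis` and `bis'`. The primed variant follows by antisymmetry of the Lie bracket. -/
theorem metric_mlieBracket (ha : G.courantMetric.G a = a) (hb : G.courantMetric.G b = b)
    (hc : G.courantMetric.G c = c) (x : M) :
    G.metric x (VectorField.mlieBracket (𝓡 d) (anchorField A a) (anchorField A b) x)
        (anchorField A c x) =
      (G.courantMetric.bis a b c - G.courantMetric.bis' b a c).1 x := by
  rw [← G.anchorField_J a, ← anchorField_br, G.metric_anchorField_right _ hc]
  rw [G.courantMetric.P_add_J_br ha hb]

theorem metric_mlieBracket' (ha : G.courantMetric.G a = a) (hb : G.courantMetric.G b = b)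
    (hc : G.courantMetric.G c = c) (x : M) :
    G.metric x (VectorField.mlieBracket (𝓡 d) (anchorField A a) (anchorField A b) x)
        (anchorField A c x) =
      (G.courantMetric.bis' a b c - G.courantMetric.bis b a c).1 x := by
  rw [VectorField.mlieBracket_swap_apply, map_neg, LinearMap.neg_apply,
    G.metric_mlieBracket hb ha hc]
  exact neg_sub _ _

theorem mvfderiv_metric (ha : G.courantMetric.G a = a) (hb : G.courantMetric.G b = b)
    (c : smoothSections d F E) (x : M) :
    mvfderiv (𝓡 d) (fun y => G.metric y (anchorField A a y) (anchorField A b y)) x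
        (anchorField A c x) = (A.courantModule.ρ c (A.courantModule.P a b)).1 x := by
  rw [funext (G.metric_anchorField ha hb)]
  rfl

theorem koszul_anchorField (ha : G.courantMetric.G a = a) (hb : G.courantMetric.G b = b)
    (hc : G.courantMetric.G c = c) (x : M) :
    G.koszul (anchorField A a) (anchorField A b) (anchorField A c) x =
      (G.courantMetric.bis a b c + G.courantMetric.bis' a b c).1 x := by
  rw [koszul, G.mvfderiv_metric hb hc, G.mvfderiv_metric ha hc, G.mvfderiv_metric ha hb,
    G.metric_mlieBracket ha hb hc, G.metric_mlieBracket' ha hc hb, G.metric_mlieBracket' hb hc ha,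
    G.courantMetric.bis'_metric, G.courantMetric.bis'_metric, G.courantMetric.bis_metric]
  simp only [Subalgebra.coe_add, Subalgebra.coe_sub, Pi.add_apply, Pi.sub_apply]
  ring

theorem sharp_eq {x : M} {φ : TangentSpace (𝓡 d) x → ℝ} {v : TangentSpace (𝓡 d) x}
    (h : ∀ z, φ z = G.metric x v z) : G.sharp x φ = v := by
  rw [sharp, ← sum_smul_dualBasis (G.metric_nondegenerate x) (tangentBasis x) v]
  exact Finset.sum_congr rfl fun i _ => by rw [h]

/-- The lift to the `1`-eigenspace of a smooth vector field. -/
def liftPlusSections (X : Π x : M, TangentSpace (𝓡 d) x) (hX : IsSmoothVectorField X) :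
    smoothSections d F E :=
  ⟨fun x => G.liftPlus x (X x), G.isSmoothSection_liftPlus hX⟩

theorem anchorField_liftPlusSections (X : Π x : M, TangentSpace (𝓡 d) x)
    (hX : IsSmoothVectorField X) : anchorField A (G.liftPlusSections X hX) = X :=
  funext fun x => G.anchor_liftPlus x (X x)

theorem G_liftPlusSections (X : Π x : M, TangentSpace (𝓡 d) x) (hX : IsSmoothVectorField X) :
    G.courantMetric.G (G.liftPlusSections X hX) = G.liftPlusSections X hX :=
  Subtype.ext (funext fun x => G.endo_liftPlus x (X x))

theorem leviCivita_anchorField (ha : G.courantMetric.G a = a) (hb : G.courantMetric.G b = b)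
    (x : M) :
    G.leviCivita (anchorField A a) (anchorField A b) x = (1 / 2 : ℝ) •
      (anchorField A (G.courantMetric.p (A.courantModule.br (G.courantMetric.J a) b)) x +
        anchorField A (G.courantMetric.J (G.courantMetric.flip.p
          (A.courantModule.br a (G.courantMetric.J b)))) x) := by
  refine G.sharp_eq fun z => ?_
  have hZ := isSmoothSection_smoothExtension (d := d) (EuclideanSpace ℝ (Fin d)) x z
  set Z := smoothExtension d (EuclideanSpace ℝ (Fin d)) x z
  have hc := G.G_liftPlusSections Z hZ
  -- The extension of `z` is itself the anchor of a section of `E₊`, so the Koszul expression can be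
  -- evaluated on anchors.
  have hz : z = anchorField A (G.liftPlusSections Z hZ) x := by
    rw [anchorField_liftPlusSections]
    exact (smoothExtension_apply d (EuclideanSpace ℝ (Fin d)) x z).symm
  conv_lhs => rw [← G.anchorField_liftPlusSections Z hZ]
  rw [G.koszul_anchorField ha hb hc, hz, map_smul, LinearMap.smul_apply, map_add,
    LinearMap.add_apply, G.metric_anchorField (G.courantMetric.G_p _) hc,
    G.metric_anchorField (G.courantMetric.G_J_flip_p _) hc, G.courantMetric.P_p_of _ hc,
    G.courantMetric.P_J_flip_p_of _ hc]
  rfl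

theorem threeForm_anchorField (ha : G.courantMetric.G a = a) (hb : G.courantMetric.G b = b)
    (hc : G.courantMetric.G c = c) (x : M) :
    G.threeForm (anchorField A a) (anchorField A b) x (anchorField A c x) =
      (G.courantMetric.tor a b c).1 x := by
  have hs : ∀ (u : smoothSections d F E) (y : M), G.splitting y (anchorField A u y) =
      (algebraMap ℝ (smoothFunctions d M) (1 / 2) • (u + G.courantMetric.J u)).1 y := fun u y => by
    change _ = (1 / 2 : ℝ) • (u.1 y + G.reflection y (u.1 y))
    rw [reflection_apply, add_sub_cancel, smul_smul, one_div, inv_mul_cancel₀ two_ne_zero,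
      one_smul]
    rfl
  rw [threeForm, hs, funext (hs a), funext (hs b)]
  change 2 * (A.courantModule.P (A.courantModule.br _ _) _).1 x = _
  rw [A.courantModule.br_smul, Derivation.map_algebraMap, zero_smul, add_zero, map_smul, map_smul,
    LinearMap.smul_apply, smul_eq_mul, smul_eq_mul, A.courantModule.P_br_smul_left,
    Derivation.map_algebraMap, Derivation.map_algebraMap, G.courantMetric.P_br_add_J ha hb hc,
    zero_mul, mul_zero, sub_zero, add_zero]
  change 2 * ((1 / 2 : ℝ) * ((1 / 2 : ℝ) * ((1 / 2 : ℝ) * (4 *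
    (G.courantMetric.tor a b c).1 x)))) = _
  ring

theorem sharp_threeForm_anchorField (ha : G.courantMetric.G a = a) (hb : G.courantMetric.G b = b)
    (x : M) :
    G.sharp x (G.threeForm (anchorField A a) (anchorField A b) x) =
      anchorField A (G.courantMetric.p (A.courantModule.br (G.courantMetric.J a) b)) x -
        anchorField A (G.courantMetric.J (G.courantMetric.flip.p
          (A.courantModule.br a (G.courantMetric.J b)))) x := by
  refine G.sharp_eq fun z => ?_
  have hZ := isSmoothSection_smoothExtension (d := d) (EuclideanSpace ℝ (Fin d)) x z
  set Z := smoothExtension d (EuclideanSpace ℝ (Fin d)) x z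
  have hc := G.G_liftPlusSections Z hZ
  have hz : z = anchorField A (G.liftPlusSections Z hZ) x := by
    rw [anchorField_liftPlusSections]
    exact (smoothExtension_apply d (EuclideanSpace ℝ (Fin d)) x z).symm
  rw [hz, G.threeForm_anchorField ha hb hc, map_sub,
    LinearMap.sub_apply, G.metric_anchorField (G.courantMetric.G_p _) hc,
    G.metric_anchorField (G.courantMetric.G_J_flip_p _) hc, G.courantMetric.P_p_of _ hc,
    G.courantMetric.P_J_flip_p_of _ hc]
  rfl

end GeneralisedMetric

end Courant

/-! ### The canonical connection in algebraic form. -/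

section Courant

variable {d : ℕ} {M : Type*} [TopologicalSpace M] [T2Space M]
  [ChartedSpace (EuclideanSpace ℝ (Fin d)) M] [IsManifold (𝓡 d) ∞ M]
  {F : Type*} [NormedAddCommGroup F] [NormedSpace ℝ F] [FiniteDimensional ℝ F] {E : M → Type*}
  [TopologicalSpace (TotalSpace F E)] [∀ x, TopologicalSpace (E x)]
  [∀ x, AddCommGroup (E x)] [∀ x, Module ℝ (E x)] [FiberBundle F E] [VectorBundle ℝ F E]
  [ContMDiffVectorBundle ∞ F E (𝓡 d)]
  {A : ExactCourantAlgebroid d F E}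

namespace GeneralisedMetric

variable (G : GeneralisedMetric A) {a b : smoothSections d F E}

theorem liftPlus_anchorField (ha : G.courantMetric.G a = a) (x : M) :
    G.liftPlus x (anchorField A a x) = a.1 x :=
  G.liftPlus_anchor x _ (G.endo_of_G ha x)

theorem liftMinus_anchorField (ha : G.courantMetric.G a = a) (x : M) :
    G.liftMinus x (anchorField A a x) = (G.courantMetric.J a).1 x := by
  rw [← anchorField_J]
  exact G.liftMinus_anchor x _ (congrFun (congrArg Subtype.val (G.courantMetric.G_J_of ha)) x)

/-- The weights are `1/2 + 1/6 = 2/3` and `1/2 - 1/6 = 1/3`. On `E₋` the roles of the two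
connections are exchanged by `J`, which matches the opposite sign of `H` there. -/
theorem liftPlus_connection (ha : G.courantMetric.G a = a) (hb : G.courantMetric.G b = b) (x : M) :
    G.liftPlus x (G.leviCivita (anchorField A a) (anchorField A b) x +
        (1 / 6 : ℝ) • G.sharp x (G.threeForm (anchorField A a) (anchorField A b) x)) =
      (2 / 3 : ℝ) •
          (G.courantMetric.p (A.courantModule.br (G.courantMetric.J a) b)).1 x +
        (1 / 3 : ℝ) • (G.courantMetric.J (G.courantMetric.flip.p
          (A.courantModule.br a (G.courantMetric.J b)))).1 x := by
  rw [G.leviCivita_anchorField ha hb, G.sharp_threeForm_anchorField ha hb]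
  simp only [map_add, map_smul, map_sub, G.liftPlus_anchorField (G.courantMetric.G_p _),
    G.liftPlus_anchorField (G.courantMetric.G_J_flip_p _)]
  module

theorem liftMinus_connection (ha : G.courantMetric.G a = -a) (hb : G.courantMetric.G b = -b)
    (x : M) :
    G.liftMinus x (G.leviCivita (anchorField A a) (anchorField A b) x -
        (1 / 6 : ℝ) • G.sharp x (G.threeForm (anchorField A a) (anchorField A b) x)) =
      (2 / 3 : ℝ) •
          (G.courantMetric.flip.p (A.courantModule.br (G.courantMetric.J a) b)).1 x +
        (1 / 3 : ℝ) • (G.courantMetric.J (G.courantMetric.p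
          (A.courantModule.br a (G.courantMetric.J b)))).1 x := by
  have ha' : G.courantMetric.G (G.courantMetric.J a) = G.courantMetric.J a :=
    G.courantMetric.G_J_of_neg ha
  have hb' : G.courantMetric.G (G.courantMetric.J b) = G.courantMetric.J b :=
    G.courantMetric.G_J_of_neg hb
  rw [← G.anchorField_J a, ← G.anchorField_J b,
    G.leviCivita_anchorField ha' hb', G.sharp_threeForm_anchorField ha' hb']
  simp only [map_add, map_smul, map_sub, G.liftMinus_anchorField (G.courantMetric.G_p _),
    G.liftMinus_anchorField (G.courantMetric.G_J_flip_p _), G.courantMetric.J_J]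
  module

theorem connectionZero_add_divergenceTensor (e a b : smoothSections d F E) (x : M) :
    G.connectionZero a.1 b.1 x + G.divergenceTensor e.1 a.1 b.1 x =
      (G.courantMetric.conn e (1 / ((d : ℝ) - 1)) a b).1 x := by
  have h1 := G.liftPlus_connection (G.courantMetric.G_p a) (G.courantMetric.G_p b) x
  have h2 := G.liftMinus_connection (G.courantMetric.G_flip_p a) (G.courantMetric.G_flip_p b) x
  have e1 : connectionZero G a.1 b.1 x =
      (G.courantMetric.p (A.courantModule.br (G.courantMetric.flip.p a) (G.courantMetric.p b))).1 x
      + (G.courantMetric.flip.p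
          (A.courantModule.br (G.courantMetric.p a) (G.courantMetric.flip.p b))).1 x
      + G.liftPlus x (G.leviCivita (anchorField A (G.courantMetric.p a))
          (anchorField A (G.courantMetric.p b)) x + (1 / 6 : ℝ) • G.sharp x
          (G.threeForm (anchorField A (G.courantMetric.p a))
            (anchorField A (G.courantMetric.p b)) x))
      + G.liftMinus x (G.leviCivita (anchorField A (G.courantMetric.flip.p a))
          (anchorField A (G.courantMetric.flip.p b)) x - (1 / 6 : ℝ) • G.sharp x
          (G.threeForm (anchorField A (G.courantMetric.flip.p a))
            (anchorField A (G.courantMetric.flip.p b)) x)) := by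
    have h := G.courantMetric_flip_p
      (A.courantModule.br (G.courantMetric.p a) (G.courantMetric.flip.p b))
    rw [connectionZero, h, ← G.courantMetric_flip_p, ← G.courantMetric_flip_p]
    rfl
  have e2 : divergenceTensor G e.1 a.1 b.1 x = (1 / ((d : ℝ) - 1)) •
      (((A.courantModule.P (G.courantMetric.p a) (G.courantMetric.p b) • G.courantMetric.p e -
        A.courantModule.P (G.courantMetric.p e) (G.courantMetric.p b) • G.courantMetric.p a).1 x)
      + (A.courantModule.P (G.courantMetric.flip.p a) (G.courantMetric.flip.p b) •
            G.courantMetric.flip.p e -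
          A.courantModule.P (G.courantMetric.flip.p e) (G.courantMetric.flip.p b) •
            G.courantMetric.flip.p a).1 x) := by
    rw [divergenceTensor, ← courantMetric_flip_p, ← courantMetric_flip_p, ← courantMetric_flip_p]
    rfl
  rw [e1, e2, h1, h2, smul_add]
  have e3 : ∀ u v w z s t p q : E x, u + v + (w + z) + (s + t) + (p + q) =
      (u + w + z + p) + (v + s + t + q) := fun _ _ _ _ _ _ _ _ => by abel
  rw [e3, CourantMetric.conn, CourantMetric.connPlus, CourantMetric.connPlus,
    CourantMetric.flip_flip]
  rfl

theorem divergenceSection_eq {δ : DivergenceOperator A} {e : Π x, E x}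
    (hδ : ∀ a : Π x, E x, IsSmoothSection d F a →
      ∀ x, δ.toFun a x = G.div a x - A.pairing x (e x) (a x)) : G.divergenceSection δ = e := by
  funext x
  rw [divergenceSection, ← sum_smul_dualBasis (A.pairing_nondegenerate x) (fibreBasis A x) (e x)]
  refine Finset.sum_congr rfl fun i _ => ?_
  rw [hδ _ (isSmoothSection_smoothExtension F x _), sub_sub_cancel, smoothExtension_apply]

theorem canonicalConnection_eq {δ : DivergenceOperator A} {e : smoothSections d F E}
    (hδ : ∀ a : Π x, E x, IsSmoothSection d F a →
      ∀ x, δ.toFun a x = G.div a x - A.pairing x (e.1 x) (a x)) (a b : smoothSections d F E) :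
    G.canonicalConnection δ a.1 b.1 =
      (G.courantMetric.conn e (1 / ((d : ℝ) - 1)) a b).1 := by
  funext x
  rw [canonicalConnection, G.divergenceSection_eq hδ, connectionZero_add_divergenceTensor]

end GeneralisedMetric

/-! ### The double trace -/

/-- The smooth section extending the `i`-th vector of the basis of the fibre. -/
def fibreFrame (A : ExactCourantAlgebroid d F E) (x : M) (i : Fin (Module.finrank ℝ (E x))) :
    smoothSections d F E :=
  ⟨_, isSmoothSection_smoothExtension F x (fibreBasis A x i)⟩

/-- The smooth section extending the `i`-th vector of the dual basis of the fibre. -/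
def fibreCoframe (A : ExactCourantAlgebroid d F E) (x : M) (i : Fin (Module.finrank ℝ (E x))) :
    smoothSections d F E :=
  ⟨_, isSmoothSection_smoothExtension F x
    ((A.pairing x).dualBasis (A.pairing_nondegenerate x) (fibreBasis A x) i)⟩

theorem trE_eq (T : (Π x, E x) → (Π x, E x) → M → ℝ) (x : M) :
    trE A T x = ∑ i, T (fibreFrame A x i).1 (fibreCoframe A x i).1 x := rfl

theorem fibreFrame_isDualFamily (x : M) :
    A.courantModule.IsDualFamily x (fibreFrame A x) (fibreCoframe A x) := by
  intro u w
  have h := sum_smul_dualBasis (A.pairing_nondegenerate x) (fibreBasis A x) (w.1 x)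
  have h' := congrArg (fun v => A.pairing x v (u.1 x)) h
  rw [map_sum, LinearMap.sum_apply, A.pairing_symm x (w.1 x)] at h'
  refine Eq.trans (Finset.sum_congr rfl fun i _ => ?_) h'
  rw [map_smul, LinearMap.smul_apply, smul_eq_mul, mul_comm, A.pairing_symm x (w.1 x)]
  change A.pairing x ((fibreFrame A x i).1 x) (w.1 x) * A.pairing x _ _ = _
  rw [show (fibreFrame A x i).1 x = fibreBasis A x i from smoothExtension_apply d F x _,
    show (fibreCoframe A x i).1 x = _ from smoothExtension_apply d F x _]

theorem generalisedRiemann_eq {D : (Π x, E x) → (Π x, E x) → (Π x, E x)}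
    {D' : smoothSections d F E → smoothSections d F E → smoothSections d F E}
    (h : ∀ a b, D a.1 b.1 = (D' a b).1) (a b v w : smoothSections d F E) (x : M) :
    generalisedRiemann A D a.1 b.1 v.1 w.1 x =
      A.courantModule.riemann D' x (fibreFrame A x) (fibreCoframe A x) a b v w := by
  have hbr : ∀ u v : smoothSections d F E, A.bracket u.1 v.1 = (A.courantModule.br u v).1 :=
    fun _ _ => rfl
  simp only [generalisedRiemann, trE_eq, h, hbr]
  rfl

theorem trE_fullGeneralisedRicci {D : (Π x, E x) → (Π x, E x) → (Π x, E x)}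
    {D' : smoothSections d F E → smoothSections d F E → smoothSections d F E}
    (h : ∀ a b, D a.1 b.1 = (D' a b).1) (x : M) :
    trE A (fullGeneralisedRicci A D) x = ∑ i, ∑ j,
      A.courantModule.riemann D' x (fibreFrame A x) (fibreCoframe A x) (fibreFrame A x j)
        (fibreFrame A x i) (fibreCoframe A x j) (fibreCoframe A x i) := by
  simp only [trE_eq, fullGeneralisedRicci, generalisedRiemann_eq h]

end Courant

/-! ### Existence of parallel frames. -/

namespace CourantMetric

variable {M R Γ : Type*} [CommRing R] [Algebra ℝ R] [AddCommGroup Γ] [Module R Γ]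
  {C : CourantModule M R Γ} (K : CourantMetric C) {a b c : Γ}

theorem bis_add_left (a a' b c : Γ) : K.bis (a + a') b c = K.bis a b c + K.bis a' b c := by
  simp only [bis, map_add, C.br_add_left, LinearMap.add_apply]

theorem bis'_add_left (a a' b c : Γ) : K.bis' (a + a') b c = K.bis' a b c + K.bis' a' b c := by
  simp only [bis', map_add, C.br_add_left, LinearMap.add_apply, neg_add]

theorem bis_smul_left (f : R) (ha : K.G a = a) (hb : K.G b = b) (hc : K.G c = c) :
    K.bis (f • a) b c = f * K.bis a b c := by
  rw [bis, map_smul, C.P_br_smul_left, K.P_eq_zero' (K.G_J_of ha) hb,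
    K.P_eq_zero' (K.G_J_of ha) hc, bis]
  ring

theorem bis'_smul_left (f : R) (ha : K.G a = a) (hb : K.G b = b) (hc : K.G c = c) :
    K.bis' (f • a) b c = f * K.bis' a b c := by
  rw [bis', C.P_br_smul_left, K.P_eq_zero ha (K.G_J_of hb), K.P_eq_zero ha (K.G_J_of hc), bis']
  ring

theorem bis_sub_mid (a b b' c : Γ) : K.bis a (b - b') c = K.bis a b c - K.bis a b' c := by
  simp only [bis, C.br_sub_right, map_sub, LinearMap.sub_apply]

theorem bis'_sub_mid (a b b' c : Γ) : K.bis' a (b - b') c = K.bis' a b c - K.bis' a b' c := by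
  simp only [bis', C.br_sub_right, map_sub, LinearMap.sub_apply]
  ring

theorem bis_smul_mid (f : R) (a b c : Γ) :
    K.bis a (f • b) c = f * K.bis a b c + C.ρ a f * C.P b c := by
  simp only [bis, C.br_smul, map_add, map_smul, LinearMap.add_apply, LinearMap.smul_apply,
    smul_eq_mul, K.ρ_J]

theorem bis'_smul_mid (f : R) (a b c : Γ) :
    K.bis' a (f • b) c = f * K.bis' a b c + C.ρ a f * C.P b c := by
  simp only [bis', C.br_smul, map_add, map_smul, LinearMap.add_apply, LinearMap.smul_apply,
    smul_eq_mul, K.P_J]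
  ring

theorem bis_sum_mid {ι : Type*} (s : Finset ι) (a : Γ) (b : ι → Γ) (c : Γ) :
    K.bis a (∑ i ∈ s, b i) c = ∑ i ∈ s, K.bis a (b i) c := by
  classical
  induction s using Finset.induction_on with
  | empty => simpa using K.bis_sub_mid a 0 0 c
  | insert i s hi ih =>
    rw [Finset.sum_insert hi, Finset.sum_insert hi, ← ih, bis, C.br_add_right, map_add]
    rfl

theorem bis'_sum_mid {ι : Type*} (s : Finset ι) (a : Γ) (b : ι → Γ) (c : Γ) :
    K.bis' a (∑ i ∈ s, b i) c = ∑ i ∈ s, K.bis' a (b i) c := by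
  classical
  induction s using Finset.induction_on with
  | empty => simpa using K.bis'_sub_mid a 0 0 c
  | insert i s hi ih =>
    rw [Finset.sum_insert hi, Finset.sum_insert hi, ← ih, bis', map_add, C.br_add_right, map_add,
      LinearMap.add_apply, neg_add]
    rfl

/-- The component in the `1`-eigenspace of `G` of a lift with the same anchor. -/
def lift : Γ →ₗ[R] Γ := K.p ∘ₗ (LinearMap.id + K.J)

theorem G_lift (u : Γ) : K.G (K.lift u) = K.lift u := K.G_p _

theorem lift_J (u : Γ) : K.lift (K.J u) = K.lift u := by
  simp only [lift, LinearMap.comp_apply, LinearMap.add_apply, LinearMap.id_apply, K.J_J, add_comm]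

theorem lift_eq_self {u : Γ} (hu : K.G u = u) : K.lift u = u := by
  simp only [lift, LinearMap.comp_apply, LinearMap.add_apply, LinearMap.id_apply, map_add,
    K.p_eq_self hu, K.p_eq_zero (K.G_J_of hu), add_zero]

/-- Precomposing with `lift` extends the coefficients from `E₊` to a form on all sections that is
invariant under `J`, hence a covector on `M`. -/
theorem lift_bis_isTensor (x : M) (hb : K.G b = b) (hc : K.G c = c) (t : ℝ) :
    C.IsTensor x fun u => t * (C.ev x (K.bis (K.lift u) b c) + C.ev x (K.bis' (K.lift u) b c)) where
  add u v := by
    simp only [map_add, bis_add_left, bis'_add_left]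
    ring
  smul f u := by
    rw [map_smul, K.bis_smul_left f (K.G_lift u) hb hc, K.bis'_smul_left f (K.G_lift u) hb hc,
      map_mul, map_mul]
    ring

/-- A frame which is orthogonal at `x` can be corrected to a parallel frame. -/
theorem exists_isParallelFrame {x : M}
    (H : ∀ T, C.IsTensor x T → (∀ u, T (K.J u) = T u) →
      ∃ r : R, C.ev x r = 0 ∧ ∀ u, C.ev x (C.ρ u r) = T u)
    {ι : Type*} [Fintype ι] [DecidableEq ι] {y : ι → Γ} {η : ι → ℝ} (hG : ∀ i, K.G (y i) = y i)
    (hη : ∀ i, η i ≠ 0)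
    (horth : ∀ i j, C.ev x (C.P (y i) (y j)) = if i = j then (η i)⁻¹ else 0)
    (hexp : ∀ u w, K.G u = u →
      C.ev x (C.P u w) = ∑ i, η i * (C.ev x (C.P (y i) u) * C.ev x (C.P (y i) w))) :
    ∃ f : ι → Γ, K.IsParallelFrame x f η := by
  -- The functions `r i j` vanish at `x`, so the corrected frame has the same values there. Their
  -- differentials are the Levi-Civita coefficients, scaled by `η j`; the factor `1/2` is there
  -- because the correction enters both `bis` and `bis'`.
  choose r hr0 hr using fun i j => H _ (K.lift_bis_isTensor x (hG i) (hG j) (η j / 2))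
    fun u => by rw [lift_J]
  have hP : ∀ i w, C.ev x (C.P (y i - ∑ j, r i j • y j) w) = C.ev x (C.P (y i) w) := fun i w => by
    simp [hr0]
  refine ⟨fun i => y i - ∑ j, r i j • y j, fun i => ?_, hη, fun i j => ?_, fun u w hu => ?_,
    fun i c w hc hw => ?_⟩
  · simp only [map_sub, map_sum, map_smul, hG]
  · rw [hP, C.P_symm, hP, C.P_symm, horth]
  · simp only [hP, hexp u w hu]
  · have e1 := hexp (K.p (C.br (K.J c) (y i))) w (K.G_p _)
    have e2 := hexp (K.J (K.flip.p (C.br c (K.J (y i))))) w (K.G_J_flip_p _)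
    have hs : ∀ j, C.ev x (C.ρ c (r i j)) = η j / 2 *
        (C.ev x (K.bis c (y i) (y j)) + C.ev x (K.bis' c (y i) (y j))) := fun j => by
      rw [hr, K.lift_eq_self hc]
    simp only [fun j u => C.P_symm (y j) (K.p u), fun j u => C.P_symm (y j) (K.J u), K.P_p_of _ hw,
      K.P_J_flip_p_of _ hw, K.P_p_of _ (hG _), K.P_J_flip_p_of _ (hG _)] at e1 e2
    rw [bis_sub_mid, bis'_sub_mid, bis_sum_mid, bis'_sum_mid]
    simp only [bis_smul_mid, bis'_smul_mid, map_sub, map_sum, map_add, map_mul, hr0, zero_mul,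
      zero_add, hs]
    rw [bis, bis', e1, e2, sub_add_sub_comm, ← Finset.sum_add_distrib, ← Finset.sum_add_distrib,
      ← Finset.sum_sub_distrib]
    refine Finset.sum_eq_zero fun j _ => ?_
    rw [bis, bis']
    ring

end CourantMetric

theorem eq_sum_of_isOrtho {V ι : Type*} [AddCommGroup V] [Module ℝ V] [Fintype ι]
    {B : LinearMap.BilinForm ℝ V} {v : Module.Basis ι ℝ V} (hv : B.IsOrthoᵢ v)
    (h : ∀ i, B (v i) (v i) ≠ 0) (u : V) :
    u = ∑ i, ((B (v i) (v i))⁻¹ * B (v i) u) • v i := by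
  conv_lhs => rw [← v.sum_repr u]
  refine Finset.sum_congr rfl fun i _ => ?_
  have : B (v i) u = v.repr u i * B (v i) (v i) := by
    conv_lhs => rw [← v.sum_repr u]
    rw [map_sum, Finset.sum_eq_single i]
    · rw [map_smul, smul_eq_mul]
    · intro j _ hj
      rw [map_smul, smul_eq_mul, LinearMap.isOrthoᵢ_def.1 hv i j hj.symm, mul_zero]
    · simp
  rw [this, mul_comm, mul_assoc, mul_inv_cancel₀ (h i), mul_one]

/-! ### Functions with prescribed differential. -/

section Smooth

variable {d : ℕ} {M : Type*} [TopologicalSpace M] [T2Space M]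
  [ChartedSpace (EuclideanSpace ℝ (Fin d)) M] [IsManifold (𝓡 d) ∞ M]

/-- Every covector is the differential of a smooth function. -/
theorem exists_smooth_of_covector (x : M) (φ : TangentSpace (𝓡 d) x →ₗ[ℝ] ℝ) :
    ∃ r : M → ℝ, IsSmoothFunction d r ∧ r x = 0 ∧ ∀ v, mvfderiv (𝓡 d) r x v = φ v := by
  haveI : IsManifold (𝓡 d) 1 M := IsManifold.of_le (n := ∞) (by exact_mod_cast le_top)
  obtain ⟨L, hL⟩ := isInvertible_mfderiv_extChartAt (I := 𝓡 d) (mem_extChartAt_source (I := 𝓡 d) x)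
  -- The function is a linear form in a chart centred at `x`, times a bump function; `ℓ` is `φ`
  -- transported by the differential of the chart.
  let ℓ : EuclideanSpace ℝ (Fin d) →L[ℝ] ℝ := (LinearMap.toContinuousLinearMap (𝕜 := ℝ)
    (E := EuclideanSpace ℝ (Fin d)) φ).comp L.symm.toContinuousLinearMap
  obtain ⟨χ, hχ, hχx, hχs⟩ := exists_bump (d := d) x
    ((chartAt (EuclideanSpace ℝ (Fin d)) x).open_source.mem_nhds (mem_chart_source _ x))
  let h : EuclideanSpace ℝ (Fin d) → ℝ := fun z => ℓ (z - extChartAt (𝓡 d) x x)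
  have hh : HasFDerivAt h ℓ (extChartAt (𝓡 d) x x) :=
    ℓ.hasFDerivAt.comp _ ((hasFDerivAt_id _).sub_const _)
  have hhs : ContDiff ℝ ∞ h := ℓ.contDiff.comp (contDiff_id.sub contDiff_const)
  let g : M → ℝ := h ∘ extChartAt (𝓡 d) x
  have hg : ∀ y ∈ (chartAt (EuclideanSpace ℝ (Fin d)) x).source,
      ContMDiffAt (𝓡 d) 𝓘(ℝ, ℝ) ∞ g y := fun y hy =>
    hhs.contMDiff.contMDiffAt.comp y (contMDiffAt_extChartAt' hy)
  have hgx : g x = 0 := by simp [g, h]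
  refine ⟨χ * g, contMDiff_of_tsupport fun y hy => ?_, ?_, fun v => ?_⟩
  · exact (hχ y).mul (hg y (hχs (closure_mono (Function.support_mul_subset_left _ _) hy)))
  · simp [hgx]
  · rw [mvfderiv_mul (hχ.mdifferentiableAt x)
      ((hg x (mem_chart_source _ x)).mdifferentiableAt (by simp)), hχx, hgx, zero_smul, one_smul,
      add_zero]
    have h1 := mvfderiv_comp_apply (I := 𝓡 d) (I' := 𝓡 d) (g := h)
      (f := extChartAt (𝓡 d) x) x hh.differentiableAt.mdifferentiableAt
      (mdifferentiableAt_extChartAt (mem_chart_source _ x)) v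
    refine h1.trans ?_
    rw [← hL]
    have h2 : mvfderiv (𝓡 d) h (extChartAt (𝓡 d) x x) (L v) = ℓ (L v) := by
      rw [← hh.fderiv, ← mfderiv_eq_fderiv]
      rfl
    refine h2.trans ?_
    exact congrArg φ (L.symm_apply_apply v)

end Smooth

/-! ### Parallel frames on the manifold and the divergence. -/

section Courant

variable {d : ℕ} {M : Type*} [TopologicalSpace M] [T2Space M]
  [ChartedSpace (EuclideanSpace ℝ (Fin d)) M] [IsManifold (𝓡 d) ∞ M]
  {F : Type*} [NormedAddCommGroup F] [NormedSpace ℝ F] [FiniteDimensional ℝ F] {E : M → Type*}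
  [TopologicalSpace (TotalSpace F E)] [∀ x, TopologicalSpace (E x)]
  [∀ x, AddCommGroup (E x)] [∀ x, Module ℝ (E x)] [FiberBundle F E] [VectorBundle ℝ F E]
  [ContMDiffVectorBundle ∞ F E (𝓡 d)]
  {A : ExactCourantAlgebroid d F E}

theorem isTensor_congr {x : M} {T : smoothSections d F E → ℝ} (hT : A.courantModule.IsTensor x T)
    {u v : smoothSections d F E} (h : u.1 x = v.1 x) : T u = T v :=
  hT.eq_of_ev fun w => by
    change A.pairing x (u.1 x) _ = A.pairing x (v.1 x) _
    rw [h]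

namespace GeneralisedMetric

variable (G : GeneralisedMetric A)

/-- A tensor invariant under the reflection satisfies `2 T(u) = T(u + J u)`, and `u + J u = 2 σ π u`
depends only on the anchor. So `T` is a covector on `M`. -/
theorem exists_function_of_isTensor {x : M} {T : smoothSections d F E → ℝ}
    (hT : A.courantModule.IsTensor x T) (hJ : ∀ u, T (G.courantMetric.J u) = T u) :
    ∃ r : smoothFunctions d M, A.courantModule.ev x r = 0 ∧
      ∀ u, A.courantModule.ev x (A.courantModule.ρ u r) = T u := by
  let s : TangentSpace (𝓡 d) x → smoothSections d F E := fun v =>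
    ⟨_, isSmoothSection_smoothExtension F x (G.splitting x v)⟩
  have hs : ∀ v, (s v).1 x = G.splitting x v := fun v => smoothExtension_apply d F x _
  let φ : TangentSpace (𝓡 d) x →ₗ[ℝ] ℝ :=
    { toFun := fun v => T (s v)
      map_add' := fun v w => by
        rw [← hT.add]
        refine isTensor_congr hT ?_
        change (s (v + w)).1 x = (s v).1 x + (s w).1 x
        rw [hs, hs, hs, map_add]
      map_smul' := fun c v => by
        refine (isTensor_congr hT (v := algebraMap ℝ (smoothFunctions d M) c • s v) ?_).trans
          ((hT.smul _ _).trans ?_)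
        · change (s (c • v)).1 x = c • (s v).1 x
          rw [hs, hs, map_smul]
        · rfl }
  obtain ⟨r, hr, hrx, hφ⟩ := exists_smooth_of_covector x φ
  refine ⟨⟨r, hr⟩, hrx, fun u => (hφ _).trans ?_⟩
  have h1 : T (u + G.courantMetric.J u) = T (s (A.anchor x (u.1 x)) + s (A.anchor x (u.1 x))) := by
    refine isTensor_congr hT ?_
    change u.1 x + G.reflection x (u.1 x) =
      (s (A.anchor x (u.1 x))).1 x + (s (A.anchor x (u.1 x))).1 x
    rw [hs, reflection_apply, add_sub_cancel, two_smul]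
  rw [hT.add, hT.add, hJ] at h1
  change T (s (A.anchor x (u.1 x))) = T u
  linarith

theorem metric_apply (x : M) (v w : TangentSpace (𝓡 d) x) :
    G.metric x v w = A.pairing x (G.liftPlus x v) (G.liftPlus x w) := by
  change A.pairing x (G.endo x _) _ = _
  rw [G.endo_liftPlus]
  rfl

theorem exists_parallelFrame (x : M) :
    ∃ (η : Fin d → ℝ) (f : Fin d → smoothSections d F E),
      G.courantMetric.IsParallelFrame x f η := by
  have hd : Module.finrank ℝ (TangentSpace (𝓡 d) x) = d := finrank_euclideanSpace_fin
  haveI : FiniteDimensional ℝ (TangentSpace (𝓡 d) x) :=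
    inferInstanceAs (FiniteDimensional ℝ (EuclideanSpace ℝ (Fin d)))
  -- An orthogonal basis suffices: the weights `η i = 1 / g(v i, v i)` make normalisation
  -- unnecessary, in any signature.
  obtain ⟨v', hv'⟩ := LinearMap.BilinForm.exists_orthogonal_basis (B := G.metric x)
    ⟨fun v w => G.metric_symm x v w⟩
  obtain ⟨v, hv⟩ : ∃ v : Module.Basis (Fin d) ℝ (TangentSpace (𝓡 d) x),
      (G.metric x).IsOrthoᵢ v := by
    refine ⟨v'.reindex (finCongr hd), LinearMap.isOrthoᵢ_def.2 fun i j hij => ?_⟩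
    rw [Module.Basis.reindex_apply, Module.Basis.reindex_apply]
    exact LinearMap.isOrthoᵢ_def.1 hv' _ _ fun h => hij ((finCongr hd).symm.injective h)
  have hne := hv.not_isOrtho_basis_self_of_separatingLeft (G.metric_nondegenerate x).1
  have hX := fun i => isSmoothSection_smoothExtension (d := d) (EuclideanSpace ℝ (Fin d)) x (v i)
  have hy : ∀ i, (G.liftPlusSections _ (hX i)).1 x = G.liftPlus x (v i) := fun i =>
    congrArg (G.liftPlus x) (smoothExtension_apply d (EuclideanSpace ℝ (Fin d)) x (v i))
  have hP : ∀ i w, A.courantModule.ev x (A.courantModule.P (G.liftPlusSections _ (hX i)) w) =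
      A.pairing x (G.liftPlus x (v i)) (w.1 x) := fun i w =>
    congrArg (fun u => A.pairing x u (w.1 x)) (hy i)
  refine ⟨fun i => (G.metric x (v i) (v i))⁻¹, G.courantMetric.exists_isParallelFrame
    (fun T hT hJ => G.exists_function_of_isTensor hT hJ) (fun i => G.G_liftPlusSections _ (hX i))
    (fun i => inv_ne_zero (hne i)) (fun i j => ?_) fun u w hu => ?_⟩
  · rw [hP, hy, ← metric_apply]
    split_ifs with hij
    · rw [hij, inv_inv]
    · exact hv hij
  · have h1 := eq_sum_of_isOrtho hv hne (A.anchor x (u.1 x))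
    have h2 := congrArg (fun z => A.pairing x (G.liftPlus x z) (w.1 x)) h1
    simp only [G.liftPlus_anchor x _ (G.endo_of_G hu x), map_sum, map_smul, LinearMap.sum_apply,
      LinearMap.smul_apply, smul_eq_mul, metric_apply] at h2
    simp only [hP, metric_apply]
    refine Eq.trans h2 (Finset.sum_congr rfl fun i _ => mul_assoc _ _ _)

theorem eq_sum_parallelFrame {x : M} {η : Fin d → ℝ} {f : Fin d → smoothSections d F E}
    (hf : G.courantMetric.IsParallelFrame x f η) (v : TangentSpace (𝓡 d) x) :
    v = ∑ j, (η j * G.metric x v (anchorField A (f j) x)) • anchorField A (f j) x := by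
  have hX := isSmoothSection_smoothExtension (d := d) (EuclideanSpace ℝ (Fin d)) x v
  have hy : (G.liftPlusSections _ hX).1 x = G.liftPlus x v :=
    congrArg (G.liftPlus x) (smoothExtension_apply d (EuclideanSpace ℝ (Fin d)) x v)
  have h1 : G.liftPlus x v =
      ∑ j, (η j * G.metric x v (anchorField A (f j) x)) • (f j).1 x := by
    refine A.eq_of_pairing fun w hw => ?_
    have := hf.expand _ ⟨w, hw⟩ (G.G_liftPlusSections _ hX)
    rw [map_sum, LinearMap.sum_apply]
    simp only [map_smul, LinearMap.smul_apply, smul_eq_mul, metric_apply,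
      G.liftPlus_anchorField (hf.G_f _)]
    rw [← hy]
    refine Eq.trans this (Finset.sum_congr rfl fun j _ => ?_)
    rw [A.courantModule.P_symm, ← mul_assoc]
    rfl
  have h2 := congrArg (A.anchor x) h1
  simp only [G.anchor_liftPlus, map_sum, map_smul] at h2
  exact h2

theorem metric_leviCivita {a b c : smoothSections d F E} (ha : G.courantMetric.G a = a)
    (hb : G.courantMetric.G b = b) (hc : G.courantMetric.G c = c) (x : M) :
    G.metric x (G.leviCivita (anchorField A a) (anchorField A b) x) (anchorField A c x) =
      1 / 2 * ((G.courantMetric.bis a b c).1 x + (G.courantMetric.bis' a b c).1 x) := by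
  rw [G.leviCivita_anchorField ha hb, map_smul, LinearMap.smul_apply, map_add,
    LinearMap.add_apply, G.metric_anchorField (G.courantMetric.G_p _) hc,
    G.metric_anchorField (G.courantMetric.G_J_flip_p _) hc, G.courantMetric.P_p_of _ hc,
    G.courantMetric.P_J_flip_p_of _ hc]
  rfl

theorem anchorField_lift (u : smoothSections d F E) :
    anchorField A (G.courantMetric.lift u) = anchorField A u := by
  funext x
  have h : u.1 x + G.reflection x (u.1 x) = (2 : ℝ) • G.splitting x (A.anchor x (u.1 x)) := by
    rw [reflection_apply, add_sub_cancel]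
  change A.anchor x ((1 / 2 : ℝ) • ((u.1 x + G.reflection x (u.1 x)) +
    G.endo x (u.1 x + G.reflection x (u.1 x)))) = A.anchor x (u.1 x)
  rw [h, map_smul, map_add, map_smul, map_smul, map_smul, G.anchor_splitting,
    G.anchor_endo_splitting, smul_zero, add_zero, smul_smul, one_div, inv_mul_cancel₀ two_ne_zero,
    one_smul]

/-- The trace of `∇ (π e)` is computed in the frame `π (f j)`. Since `∇` is metric and `f j` is
parallel at `x`, `g(∇_{f j} (π e), f j)` is the derivative of `g(π e, π (f j)) = ⟨e + J e, f j⟩`. -/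
theorem div_eq (e : smoothSections d F E) {x : M} {η : Fin d → ℝ}
    {f : Fin d → smoothSections d F E} (hf : G.courantMetric.IsParallelFrame x f η) :
    G.div e.1 x = ∑ j, η j * A.courantModule.ev x (A.courantModule.ρ (f j)
      (A.courantModule.P (e + G.courantMetric.J e) (f j))) := by
  have hX := fun i => isSmoothSection_smoothExtension (d := d) (EuclideanSpace ℝ (Fin d)) x
    (tangentBasis (d := d) x i)
  let z := fun i => G.liftPlusSections _ (hX i)
  have hz : ∀ i, G.courantMetric.G (z i) = z i := fun i => G.G_liftPlusSections _ (hX i)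
  have hzx : ∀ i, anchorField A (z i) x = tangentBasis (d := d) x i := fun i => by
    rw [anchorField_liftPlusSections]
    exact smoothExtension_apply d (EuclideanSpace ℝ (Fin d)) x _
  have ha := G.courantMetric.G_lift e
  set a := G.courantMetric.lift e with ha_def
  let T : Fin d → smoothSections d F E → ℝ := fun j u => 1 / 2 *
    (A.courantModule.ev x (G.courantMetric.bis (G.courantMetric.lift u) a (f j)) +
      A.courantModule.ev x (G.courantMetric.bis' (G.courantMetric.lift u) a (f j)))
  have hT : ∀ j, A.courantModule.IsTensor x (T j) := fun j =>
    G.courantMetric.lift_bis_isTensor x ha (hf.G_f j) (1 / 2)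
  have hTz : ∀ i j, G.metric x (G.leviCivita (anchorField A (z i)) (anchorField A a) x)
      (anchorField A (f j) x) = T j (z i) := fun i j => by
    rw [G.metric_leviCivita (hz i) ha (hf.G_f j)]
    simp only [T, G.courantMetric.lift_eq_self (hz i)]
    rfl
  -- By tensoriality of `T j` the sum over the coordinate basis is `T j (f j)`.
  have hTf : ∀ j, ∑ i, (tangentBasis (d := d) x).coord i (anchorField A (f j) x) * T j (z i) =
      A.courantModule.ev x (A.courantModule.ρ (f j)
        (A.courantModule.P (e + G.courantMetric.J e) (f j))) := fun j => by
    have h1 : T j (f j) =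
        T j (∑ i, algebraMap ℝ (smoothFunctions d M)
          ((tangentBasis (d := d) x).coord i (anchorField A (f j) x)) • z i) := by
      refine isTensor_congr (hT j) ?_
      rw [← G.liftPlus_anchorField (hf.G_f j),
        ← (tangentBasis (d := d) x).sum_repr (anchorField A (f j) x), map_sum, Submodule.coe_sum,
        Finset.sum_apply]
      refine Finset.sum_congr rfl fun i _ => ?_
      rw [map_smul, ← hzx, G.liftPlus_anchorField (hz i)]
      simp only [Module.Basis.sum_repr]
      rfl
    rw [(hT j).sum] at h1
    simp only [(hT j).smul, AlgHom.commutes, Algebra.algebraMap_self, RingHom.id_apply] at h1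
    rw [← h1, ← G.courantMetric.P_p_of _ (hf.G_f j)]
    change T j (f j) = A.courantModule.ev x (A.courantModule.ρ (f j) (A.courantModule.P a (f j)))
    have m1 := congrArg (A.courantModule.ev x) (G.courantMetric.bis_metric (f j) a (f j))
    have m2 := congrArg (A.courantModule.ev x) (G.courantMetric.bis'_metric (f j) a (f j))
    have m3 := hf.parallel j (f j) a (hf.G_f j) ha
    simp only [T, G.courantMetric.lift_eq_self (hf.G_f j)]
    rw [map_add] at m1 m2
    linarith
  have h0 : ∀ i, (tangentBasis (d := d) x).coord i (G.leviCivita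
      (smoothExtension d (EuclideanSpace ℝ (Fin d)) x (tangentBasis (d := d) x i)) (anchorField A e) x) =
      ∑ j, η j * ((tangentBasis (d := d) x).coord i (anchorField A (f j) x) * T j (z i)) := fun i => by
    rw [← G.anchorField_lift e, ← G.anchorField_liftPlusSections _ (hX i)]
    conv_lhs => rw [G.eq_sum_parallelFrame hf (G.leviCivita _ _ x)]
    rw [map_sum]
    refine Finset.sum_congr rfl fun j _ => ?_
    rw [map_smul, smul_eq_mul, hTz i j]
    ring
  change ∑ i, (tangentBasis (d := d) x).coord i (G.leviCivita
      (smoothExtension d (EuclideanSpace ℝ (Fin d)) x (tangentBasis (d := d) x i)) (anchorField A e) x) = _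
  rw [Finset.sum_congr rfl fun i _ => h0 i, Finset.sum_comm]
  refine Finset.sum_congr rfl fun j _ => ?_
  rw [← Finset.mul_sum, hTf]

end GeneralisedMetric

end Courant

end GeneralisedGeometry

end

theorem mainTheorem6 {d : ℕ} (hd : 2 ≤ d)
    {M : Type*} [TopologicalSpace M] [T2Space M] [ChartedSpace (EuclideanSpace ℝ (Fin d)) M]
    [IsManifold (𝓡 d) ∞ M]
    {F : Type*} [NormedAddCommGroup F] [NormedSpace ℝ F] [FiniteDimensional ℝ F]
    {E : M → Type*} [TopologicalSpace (TotalSpace F E)] [∀ x, TopologicalSpace (E x)]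
    [∀ x, AddCommGroup (E x)] [∀ x, Module ℝ (E x)] [FiberBundle F E] [VectorBundle ℝ F E]
    [ContMDiffVectorBundle ∞ F E (𝓡 d)]
    (A : GeneralisedGeometry.ExactCourantAlgebroid d F E)
    (G : GeneralisedGeometry.GeneralisedMetric A)
    (δ : GeneralisedGeometry.DivergenceOperator A)
    (e : Π x, E x) (he : GeneralisedGeometry.IsSmoothSection d F e)
    (hδ : ∀ a : Π x, E x, GeneralisedGeometry.IsSmoothSection d F a →
      ∀ x, δ.toFun a x = G.div a x - A.pairing x (e x) (a x))
    (x : M) :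
    GeneralisedGeometry.trE A
        (GeneralisedGeometry.fullGeneralisedRicci A (G.canonicalConnection δ)) x =
      2 * G.div e x
        - (G.form x (G.plus e x) (G.plus e x) - G.form x (G.minus e x) (G.minus e x)) := by
  obtain ⟨η, f, hf⟩ := G.exists_parallelFrame x
  have hd' : (d : ℝ) - 1 ≠ 0 := by
    have : (2 : ℝ) ≤ d := by exact_mod_cast hd
    linarith
  have hκ : 1 / ((d : ℝ) - 1) * ((Fintype.card (Fin d) : ℝ) - 1) = 1 := by
    rw [Fintype.card_fin, one_div, inv_mul_cancel₀ hd']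
  let e' : GeneralisedGeometry.smoothSections d F E := ⟨e, he⟩
  have hp : G.form x (G.plus e x) (G.plus e x) = A.courantModule.ev x
      (A.courantModule.P (G.courantMetric.p e') (G.courantMetric.p e')) := by
    change A.pairing x (G.endo x _) _ = _
    rw [G.endo_plus]
    rfl
  -- The involution is `-1` on `E₋`, so the sum of scalar products in `scalar` becomes a difference
  -- of `𝒢`-norms.
  have hm : G.form x (G.minus e x) (G.minus e x) = -A.courantModule.ev x
      (A.courantModule.P (G.courantMetric.flip.p e') (G.courantMetric.flip.p e')) := by
    change A.pairing x (G.endo x _) _ = _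
    rw [G.endo_minus, map_neg, LinearMap.neg_apply, ← G.courantMetric_flip_p e']
    rfl
  rw [GeneralisedGeometry.trE_fullGeneralisedRicci (G.canonicalConnection_eq (e := e') hδ),
    hf.scalar e' _ hκ (GeneralisedGeometry.fibreFrame_isDualFamily x), ← G.div_eq e' hf, hp, hm,
    sub_neg_eq_add]
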